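/- **Setting.** Let $M^\circ$ be an episodic MDP (the abstract simulator) with finite state space $\mathcal S$, finite action set $\mathcal A$, horizon $H\ge 1$, rewards $R_h(s,a)\in[0,1]$, deterministic transitions, and initial state drawn from a distribution $\mu$ on a set $\mathcal S_1\subseteq\mathcal S$ of $N$ states. Let $\mathbf M^\star$ be a block MDP with perfect decoder $\phi^\star:\mathcal X\to\mathcal S$ (every state $s$ emits observations $x\sim q^\star(\cdot\mid s)$ with $\phi^\star(x)=s$ almost surely), whose latent MDP $M^\star$, with transitions $T_h$, has the same initial states and distribution $\mu$ and is an $\eta$-perturbation of $M^\circ$ with $0\le\eta<1/2$: there are $\xi_h(\cdot\mid s,a)\in\Delta(\mathcal A)$ with $\xi_h(a\mid s,a)\ge 1-\eta$ such that transitions and rewards of $M^\star$ at $(h,s,a)$ are the $\xi_h(\cdot\mid s,a)$-averages of those of $M^\circ$ at $(h,s,\cdot)$. Assume $\mu(s)\ge\mu_{\min}>0$ for all $s\in\mathcal S_1$ and, for some $\Gamma\in(0,1]$, $\|T_1(\cdot\mid s,a)-T_1(\cdot\mid\tilde s,a)\|_{\mathrm{TV}}\ge\Gamma$ for all distinct $s,\tilde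 s\in\mathcal S_1$ and all $a\in\mathcal A$. Let $\mathcal F\subseteq\{\mathcal X^2\to\Delta(\mathcal A)\}$, $\mathcal G\subseteq\{[N]\times\mathcal A\times\mathcal X\to[0,1]\}$, $\Phi\subseteq\{\mathcal X\to[N]\}$ be finite classes of measurable functions that are realizable: for each $1\le h<H$ some $f\in\mathcal F$ satisfies $f(a\mid x,x')=T_h(\phi^\star(x')\mid\phi^\star(x),a)/\sum_{a'}T_h(\phi^\star(x')\mid\phi^\star(x),a')$ for almost all $x,x'$ that can occur at steps $h,h+1$; and some $g\circ\phi$, with $(g\circ\phi)(x,a,x')=g(\phi(x),a,x')$, $g\in\mathcal G$, $\phi\in\Phi$, equals $\frac{T_1(\phi^\star(x')\mid\phi^\star(x),a)}{T_1(\phi^\star(x')\mid\phi^\star(x),a)+\varrho(\phi^\star(x'))}$ for almost all initial $x$, all $a$, and almost all $x'$ that can occur at step 2, where $\varrho$ is the law of the second latent state under a uniformly random first action. Optimization oracles and argmax rules break ties in any measurable way. **Algorithm** (inputs $\epsilon>0$, $\delta\in(0,1)$, $n_0$). Let $\rho$ be any output of robust dynamic programming on $(M^\circ,\eta)$: with $\tilde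 V_{H+1}=0$, $\tilde Q_h(s,a)=R^\circ_h(s,a)+\sum_{s'}T^\circ_h(s'\mid s,a)\tilde V_{h+1}(s')$, $\tilde V_h(s)=(1-\eta)\max_a\tilde Q_h(s,a)+\eta\min_a\tilde Q_h(s,a)$, put $\rho_h(s)\in\arg\max_a\tilde Q_h(s,a)$. *Clustering.* From $n_0$ samples (two episodes with a uniformly random first action each; with probability $1/2$ the real transition $(x_1,a_1,x_2)$ with label $y=1$, otherwise the imposter in which $x_2$ comes from the second episode, with $y=0$) compute a least-squares minimizer $(\hat g,\hat\phi)\in\mathcal G\times\Phi$ of $\sum(g(\phi(x),a,x')-y)^2$. *Testing.* Thereafter each episode belongs to the cluster $i=\hat\phi(x_1)\in[N]$ of its initial observation. In each cluster the hypotheses $s\in\mathcal S_1$ are tested one after the other. For a hypothesis $s$ the inner algorithm TASID is run with initial state $s$ for $n_l=H n_D$ episodes of the cluster, $n_D=\big\lceil\frac{8H^3|\mathcal A|^3\ln(N^2|\mathcal F|/\delta)}{\epsilon(1-2\eta)^2}\big\rceil$: for $h=1,2,\dots$ it gathers $n_D$ triples $(x_h,a_h,x_{h+1})$ by following the policy learned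 so far before step $h$ and taking $a_h$ uniformly at random, fits $f_h\in\mathcal F$ by maximum likelihood, sets $\alpha_h(x,x')\in\arg\max_a f_h(a\mid x,x')$, and at step $h+1$ plays $\rho_{h+1}$ at the state that the simulator reaches from $s$ by the actions $\alpha_1(x_1,x_2),\dots,\alpha_h(x_h,x_{h+1})$. Then the learned policy is rolled out for $n_t=\big\lceil\frac{H^2\ln(N^2/\delta)}{2\epsilon^2}\big\rceil$ episodes of the cluster and its average return $v(s)$ is recorded. When all $N$ hypotheses are tested, the policy learned for a maximizer of $v$ is executed in the cluster forever. For a cluster $i$ let $V_i^\pi$ be the expected sum of rewards of $\pi$ in $\mathbf M^\star$ given $\hat\phi(x_1)=i$. An episode is a *mistake* if it is one of the $2n_0$ data-gathering episodes of the clustering, or if it lies in a cluster $i$ and the policy $\pi$ executed in it has $V_i^\pi<V_i^{\rho\circ\phi^\star}-4\epsilon$. **Theorem.** There are absolute constants $c_0,C>0$ such that, in this setting, with $\Lambda=\ln(|\mathcal G||\Phi|/\delta)$, the following holds whenever $$n_0\ \ge\ \theta:=c_0\max\left\{\frac{256H^2N^4|\mathcal A|^4\Lambda}{\epsilon^2\Gamma^2\mu_{\min}^4},\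 \frac{1024N^4|\mathcal A|^4\Lambda}{\Gamma^2\mu_{\min}^6}\right\}.$$ The policy $\rho$ is robust, i.e. it maximizes, over all Markovian abstract policies $\psi$, the infimum of the value of $\psi$ over all $\eta$-perturbations of $M^\circ$; and with probability at least $1-3\delta$ the number of mistakes is at most $$2n_0+C\left(\frac{N^2H^4|\mathcal A|^3\ln(N^2|\mathcal F|/\delta)}{\epsilon(1-2\eta)^2}+\frac{N^2H^2\ln(N^2/\delta)}{\epsilon^2}\right).$$ In particular (with the same constants), if $n_0=\lceil\theta\rceil$, then with probability at least $1-3\delta$ the number of mistakes is at most $$C\left(\frac{N^2H^4|\mathcal A|^3\ln(N^2|\mathcal F|/\delta)}{\epsilon(1-2\eta)^2}+\frac{N^2H^2\ln(N^2/\delta)}{\epsilon^2}+\frac{N^4|\mathcal A|^4\Lambda}{\Gamma^2\mu_{\min}^4}\max\left\{\frac{H^2}{\epsilon^2},\frac1{\mu_{\min}^2}\right\}\right).$$ -/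

import Mathlib

open MeasureTheory ProbabilityTheory

noncomputable section

namespace TASID

/-! ### Episodic MDPs with a stochastic initial state

Steps are numbered `0, 1, …, H - 1`; transitions and rewards at steps `h ≥ H` play no role. -/

/-- An episodic MDP with horizon `H` and latent states `S`.  Its `N` possible initial states are
`start 0, …, start (N - 1)` (distinct), and `μ` is the distribution of the index of the initial
state. -/
structure MDP (S A : Type*) (N H : ℕ) where
  start : Fin N ↪ S
  μ : PMF (Fin N)
  T : ℕ → S → A → PMF S
  R : ℕ → S → A → ℝ
  R_mem : ∀ h s a, R h s a ∈ Set.Icc (0 : ℝ) 1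

namespace MDP

variable {S A : Type*} {N H : ℕ}

/-- `T_h(s' | s, a)` as a real number. -/
def prob (M : MDP S A N H) (h : ℕ) (s : S) (a : A) (s' : S) : ℝ := (M.T h s a s').toReal

/-- All transition probabilities are `0` or `1`. -/
def IsDeterministic (M : MDP S A N H) : Prop :=
  ∀ h < H, ∀ s a s', M.T h s a s' = 0 ∨ M.T h s a s' = 1

open Classical in
/-- The state reached from `s` by action `a` at step `h` of a deterministic MDP (the state that has
probability `1`; the default value `s` is used only if there is none). -/
def nextState (M : MDP S A N H) (h : ℕ) (s : S) (a : A) : S :=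
  if e : ∃ s', M.T h s a s' = 1 then e.choose else s

/-- `M'` is an `η`-perturbation of `M`: it follows the dynamics of `M` with every action distorted
by a noise `ξ` that keeps the action with probability at least `1 - η`. -/
def IsPerturbation [Fintype A] (η : ℝ) (M M' : MDP S A N H) : Prop :=
  M'.start = M.start ∧ M'.μ = M.μ ∧
    ∃ ξ : ℕ → S → A → PMF A, ∀ h < H, ∀ s a,
      1 - η ≤ (ξ h s a a).toReal ∧
      (∀ s', M'.prob h s a s' = ∑ a', M.prob h s a' s' * (ξ h s a a').toReal) ∧
      M'.R h s a = ∑ a', M.R h s a' * (ξ h s a a').toReal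

/-- The states that can occur at step `h`. -/
def Reach (M : MDP S A N H) : ℕ → Set S
  | 0 => {s | ∃ i, M.μ i ≠ 0 ∧ M.start i = s}
  | h + 1 => {s' | ∃ s ∈ Reach M h, ∃ a, M.T h s a s' ≠ 0}

variable [Fintype S]

/-- Expected sum of the rewards of the last `n` steps (from step `H - n` on) from state `s` at
step `H - n`, under the abstract policy `ψ`. -/
def valueToGo (M : MDP S A N H) (ψ : ℕ → S → A) : ℕ → S → ℝ
  | 0, _ => 0
  | n + 1, s => M.R (H - (n + 1)) s (ψ (H - (n + 1)) s) +
      ∑ s', M.prob (H - (n + 1)) s (ψ (H - (n + 1)) s) s' * valueToGo M ψ n s'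

/-- The value `V^ψ_M` of the abstract policy `ψ`. -/
def value (M : MDP S A N H) (ψ : ℕ → S → A) : ℝ :=
  ∑ i, (M.μ i).toReal * M.valueToGo ψ H (M.start i)

/-- The worst value of `ψ` over all `η`-perturbations of `M`. -/
def worstValue [Fintype A] (η : ℝ) (M : MDP S A N H) (ψ : ℕ → S → A) : ℝ :=
  ⨅ M' : {M' : MDP S A N H // IsPerturbation η M M'}, M'.1.value ψ

/-- A robust abstract policy: it maximizes the worst value over all `η`-perturbations. -/
def IsRobustPolicy [Fintype A] (η : ℝ) (M : MDP S A N H) (ρ : ℕ → S → A) : Prop :=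
  ∀ ψ : ℕ → S → A, M.worstValue η ψ ≤ M.worstValue η ρ

/-- Bellman backup of a value function `V` (for step `h + 1`) at step `h`. -/
def backup (M : MDP S A N H) (h : ℕ) (V : S → ℝ) (s : S) (a : A) : ℝ :=
  M.R h s a + ∑ s', M.prob h s a s' * V s'

/-- The values computed by robust dynamic programming; `rdpV n` is the value function with `n`
steps to go, i.e. at step `H - n`. -/
def rdpV (η : ℝ) (M : MDP S A N H) : ℕ → S → ℝ
  | 0, _ => 0
  | n + 1, s => (1 - η) * (⨆ a, M.backup (H - (n + 1)) (rdpV η M n) s a) +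
      η * (⨅ a, M.backup (H - (n + 1)) (rdpV η M n) s a)

/-- `ρ` is an output of robust dynamic programming: at each step and state it maximizes the
computed action values (ties are broken arbitrarily). -/
def IsRDPOutput (η : ℝ) (M : MDP S A N H) (ρ : ℕ → S → A) : Prop :=
  ∀ h < H, ∀ s a, M.backup h (M.rdpV η (H - (h + 1))) s a ≤
    M.backup h (M.rdpV η (H - (h + 1))) s (ρ h s)

end MDP

/-! ### Block MDPs and practicable policies -/

/-- A block MDP: a latent MDP, emission distributions `q`, and the perfect decoder `dec`.
The blocks are the disjoint sets `dec ⁻¹' {s}`. -/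
structure BlockMDP (S A X : Type*) (N H : ℕ) [MeasurableSpace S] [MeasurableSpace X] where
  latent : MDP S A N H
  q : S → ProbabilityMeasure X
  dec : X → S
  dec_meas : Measurable dec
  dec_spec : ∀ s, (q s : Measure X) (dec ⁻¹' {s}) = 1

/-- A practicable policy: at step `t` the action is a function of the observations up to `t`.
The last argument is a uniformly random action, drawn once per episode, that exploring policies
may use; deterministic policies ignore it. -/
abbrev Policy (X A : Type*) := (t : ℕ) → (Fin (t + 1) → X) → A → A

/-- The randomness of one episode: the index of the initial state, for every step and state the
observation that would be emitted there, for every step, state and action the state that would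
come next, a random action, and a random bit.  An episode visits each step once, so it uses each
entry at most once. -/
abbrev Seed (S A X : Type*) (N : ℕ) :=
  Fin N × (ℕ → S → X) × (ℕ → S → A → S) × A × Bool

namespace Seed

variable {S A X : Type*} {N : ℕ}

def idx (w : Seed S A X N) : Fin N := w.1
def emit (w : Seed S A X N) : ℕ → S → X := w.2.1
def trans (w : Seed S A X N) : ℕ → S → A → S := w.2.2.1
def act (w : Seed S A X N) : A := w.2.2.2.1
def coin (w : Seed S A X N) : Bool := w.2.2.2.2

end Seed

/-- What the agent records of an episode: observations, actions and the sum of the rewards. -/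
structure Episode (X A : Type*) where
  obs : ℕ → X
  act : ℕ → A
  ret : ℝ

instance {X A : Type*} [Nonempty X] [Nonempty A] : Inhabited (Episode X A) :=
  ⟨⟨fun _ => Classical.arbitrary X, fun _ => Classical.arbitrary A, 0⟩⟩

namespace BlockMDP

variable {S A X : Type*} {N H : ℕ} [MeasurableSpace S] [MeasurableSpace X]

section Law

variable [Fintype S] [Fintype A] [Nonempty A] [MeasurableSpace A]

/-- The law of the randomness of one episode: all entries are independent, with the distributions
`μ`, `q(· | s)`, `T_h(· | s, a)`, uniform on actions, and a fair coin. -/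
def seedLaw (B : BlockMDP S A X N H) : Measure (Seed S A X N) :=
  B.latent.μ.toMeasure.prod <|
    (Measure.infinitePi fun _ : ℕ => Measure.pi fun s : S => (B.q s : Measure X)).prod <|
      (Measure.infinitePi fun h : ℕ => Measure.pi fun s : S => Measure.pi fun a : A =>
        (B.latent.T h s a).toMeasure).prod <|
          (PMF.uniformOfFintype A).toMeasure.prod (PMF.uniformOfFintype Bool).toMeasure

instance (B : BlockMDP S A X N H) : IsProbabilityMeasure B.seedLaw := by
  unfold seedLaw; infer_instance

/-- The law of the randomness of an infinite sequence of independent episodes. -/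
def runLaw (B : BlockMDP S A X N H) : Measure (ℕ → Seed S A X N) :=
  Measure.infinitePi fun _ : ℕ => B.seedLaw

end Law

/-- Latent state and observation history at step `t` of the episode played with policy `π`. -/
def traj (B : BlockMDP S A X N H) (π : Policy X A) (w : Seed S A X N) :
    (t : ℕ) → S × (Fin (t + 1) → X)
  | 0 => (B.latent.start w.idx, fun _ => w.emit 0 (B.latent.start w.idx))
  | t + 1 =>
      let p := traj B π w t
      let s' := w.trans t p.1 (π t p.2 w.act)
      (s', Fin.snoc (α := fun _ => X) p.2 (w.emit (t + 1) s'))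

/-- The action at step `t`. -/
def action (B : BlockMDP S A X N H) (π : Policy X A) (w : Seed S A X N) (t : ℕ) : A :=
  π t (B.traj π w t).2 w.act

/-- The observation at step `t`. -/
def obs (B : BlockMDP S A X N H) (π : Policy X A) (w : Seed S A X N) (t : ℕ) : X :=
  (B.traj π w t).2 (Fin.last t)

/-- The sum of the rewards of the episode. -/
def ret (B : BlockMDP S A X N H) (π : Policy X A) (w : Seed S A X N) : ℝ :=
  ∑ t ∈ Finset.range H, B.latent.R t (B.traj π w t).1 (B.action π w t)

def episode (B : BlockMDP S A X N H) (π : Policy X A) (w : Seed S A X N) : Episode X A :=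
  ⟨B.obs π w, B.action π w, B.ret π w⟩

/-- The initial observation (which does not depend on the policy). -/
def obs₀ (B : BlockMDP S A X N H) (w : Seed S A X N) : X := w.emit 0 (B.latent.start w.idx)

/-- The value of `π` in episodes whose initial observation is put into cluster `i` by `φ`:
the expected sum of rewards given `φ(x_1) = i`. -/
def clusterValue [Fintype S] [Fintype A] [Nonempty A] [MeasurableSpace A]
    (B : BlockMDP S A X N H) (φ : X → Fin N) (i : Fin N) (π : Policy X A) : ℝ :=
  ∫ w, B.ret π w ∂(cond B.seedLaw {w | φ (B.obs₀ w) = i})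

/-- The practicable policy `ψ ∘ φ⋆`. -/
def lift (B : BlockMDP S A X N H) (ψ : ℕ → S → A) : Policy X A :=
  fun t x _ => ψ t (B.dec (x (Fin.last t)))

section Conditions

/-- Marginal probability of the second latent state when the first action is uniform. -/
def secondProb [Fintype A] (B : BlockMDP S A X N H) (s' : S) : ℝ :=
  ∑ i, (B.latent.μ i).toReal *
    ((∑ a, B.latent.prob 0 (B.latent.start i) a s') / Fintype.card A)

/-- Realizability of the inverse dynamics: for each step `h` some member of the class equals
`T_h(x' | x, a) / ∑ a', T_h(x' | x, a')` for (almost) all `x, x'` that can occur at steps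
`h, h + 1`.  The emission densities cancel in this ratio. -/
def RealizableInverse [Fintype A] {ι : Type*} (B : BlockMDP S A X N H)
    (F : ι → X → X → A → ℝ) : Prop :=
  ∀ h, h + 1 < H → ∃ j, ∀ s ∈ B.latent.Reach h, ∀ s', (∃ a, B.latent.T h s a s' ≠ 0) →
    ∀ᵐ x ∂(B.q s : Measure X), ∀ᵐ x' ∂(B.q s' : Measure X), ∀ a,
      F j x x' a = B.latent.prob h s a s' / ∑ a', B.latent.prob h s a' s'

/-- Realizability of the classifier between real and imposter first transitions: some `g ∘ φ` with
`g`, `φ` in the classes equals `T(x' | x, a) / (T(x' | x, a) + ρ(x'))` for (almost) all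
`(x, a, x')` in the support of the data, where `ρ` is the marginal law of the second
observation.  The emission densities cancel in this ratio. -/
def RealizableClassifier [Fintype A] {κ l : Type*} (B : BlockMDP S A X N H)
    (G : κ → Fin N → A → X → ℝ) (Φ : l → X → Fin N) : Prop :=
  ∃ g p, ∀ i a s', 0 < B.secondProb s' →
    ∀ᵐ x ∂(B.q (B.latent.start i) : Measure X), ∀ᵐ x' ∂(B.q s' : Measure X),
      G g (Φ p x) a x' = B.latent.prob 0 (B.latent.start i) a s' /
        (B.latent.prob 0 (B.latent.start i) a s' + B.secondProb s')

/-- Any two initial states are `Γ`-separated, in total variation, by their transitions. -/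
def InitialMargin [Fintype S] (B : BlockMDP S A X N H) (Γ : ℝ) : Prop :=
  ∀ i j, i ≠ j → ∀ a, Γ ≤ (1 / 2) * ∑ s', |B.latent.prob 0 (B.latent.start i) a s' -
    B.latent.prob 0 (B.latent.start j) a s'|

end Conditions

end BlockMDP

/-! ### Optimization oracles -/

/-- A measurable rule that selects a maximizer of a real function on a finite type. -/
def IsArgmaxRule {α : Type*} (sel : (α → ℝ) → α) : Prop :=
  (∀ (v : α → ℝ) (a : α), v a ≤ v (sel v)) ∧ ∀ a, MeasurableSet (sel ⁻¹' {a})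

/-- `mle` maximizes the likelihood `∏ f(a | x, x')` of the data over the class `F` (equivalently the
log-likelihood, with `ln 0 = -∞`), measurably in the data. -/
def IsMLE {X A ι : Type*} [MeasurableSpace X] [MeasurableSpace A] (F : ι → X → X → A → ℝ)
    (mle : (n : ℕ) → (Fin n → X × A × X) → ι) : Prop :=
  (∀ n D j, ∏ r, F j (D r).1 (D r).2.2 (D r).2.1 ≤
    ∏ r, F (mle n D) (D r).1 (D r).2.2 (D r).2.1) ∧
  ∀ n j, MeasurableSet (mle n ⁻¹' {j})

/-- The squared error of `g ∘ φ` on a data set of labelled transitions `(x, a, x', y)`. -/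
def sqLoss {X A : Type*} {N n : ℕ} (g : Fin N → A → X → ℝ) (φ : X → Fin N)
    (D : Fin n → X × A × X × Bool) : ℝ :=
  ∑ r, (g (φ (D r).1) (D r).2.1 (D r).2.2.1 - if (D r).2.2.2 then 1 else 0) ^ 2

/-- `erm` minimizes the squared error over the two classes, measurably in the data. -/
def IsERM {X A κ l : Type*} {N : ℕ} [MeasurableSpace X] [MeasurableSpace A]
    (G : κ → Fin N → A → X → ℝ) (Φ : l → X → Fin N)
    (erm : (n : ℕ) → (Fin n → X × A × X × Bool) → κ × l) : Prop :=
  (∀ n D g p, sqLoss (G (erm n D).1) (Φ (erm n D).2) D ≤ sqLoss (G g) (Φ p) D) ∧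
  ∀ n r, MeasurableSet (erm n ⁻¹' {r})

/-! ### The algorithm -/

/-- Everything the agent works with: the horizon, initial states and transitions of the
(deterministic) simulator, the abstract policy `ρ` to be imitated, the function class with its
optimization oracle, the rules for the two kinds of argmax, the size `nD` of each data set of
the inner algorithm, and the number `nt` of test episodes per hypothesis. -/
structure Learner (S A X ι : Type*) (N : ℕ) where
  H : ℕ
  start : Fin N → S
  next : ℕ → S → A → S
  ρ : ℕ → S → A
  F : ι → X → X → A → ℝ
  mle : (n : ℕ) → (Fin n → X × A × X) → ι
  selA : (A → ℝ) → A
  selN : (Fin N → ℝ) → Fin N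
  nD : ℕ
  nt : ℕ

namespace Learner

variable {S A X ι : Type*} {N : ℕ}

/-- Number of learning episodes per hypothesis: one data set per step. -/
def nl (L : Learner S A X ι N) : ℕ := L.H * L.nD

/-- The shadow action decoder of step `h`, from the records of the learning episodes: the
inverse dynamics model is fitted to the `h`-th batch of `nD` episodes. -/
def shadow (L : Learner S A X ι N) (rec : ℕ → Episode X A) (h : ℕ) (x x' : X) : A :=
  L.selA (L.F (L.mle L.nD fun r : Fin L.nD =>
    ((rec (h * L.nD + r)).obs h, (rec (h * L.nD + r)).act h, (rec (h * L.nD + r)).obs (h + 1)))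
    x x')

/-- The state decoder: run the simulator from the initial state `s` with the decoded shadow
actions. -/
def decode (L : Learner S A X ι N) (α : ℕ → X → X → A) (s : S) :
    (t : ℕ) → (Fin (t + 1) → X) → S
  | 0, _ => s
  | t + 1, x => L.next t (decode L α s t fun i => x i.castSucc)
      (α t (x (Fin.last t).castSucc) (x (Fin.last (t + 1))))

/-- The practicable policy learned under the hypothesis that the initial state has index `j`. -/
def learned (L : Learner S A X ι N) (rec : ℕ → Episode X A) (j : Fin N) : Policy X A :=
  fun t x _ => L.ρ t (L.decode (L.shadow rec) (L.start j) t x)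

/-- The policy that gathers data for step `h`: follow the learned policy before step `h`, then take
a uniformly random action. -/
def explore (L : Learner S A X ι N) (rec : ℕ → Episode X A) (j : Fin N) (h : ℕ) : Policy X A :=
  fun t x u => if t < h then L.learned rec j t x u else u

variable [Nonempty X] [Nonempty A]

/-- In the list `m` of all episodes of a cluster, hypothesis `j` is tested in the block of `nl + nt`
episodes that begins with episode `j * (nl + nt)`; this is the `k`-th episode of the block. -/
def block (L : Learner S A X ι N) (m : List (Episode X A)) (j : Fin N) (k : ℕ) : Episode X A :=
  m.getD (j * (L.nl + L.nt) + k) default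

/-- The average return of the test episodes of hypothesis `j`. -/
def testValue (L : Learner S A X ι N) (m : List (Episode X A)) (j : Fin N) : ℝ :=
  (∑ k ∈ Finset.range L.nt, (L.block m j (L.nl + k)).ret) / L.nt

/-- The policy executed in the next episode of a cluster, given the list `m` of the earlier
episodes of the cluster.  The hypotheses are tested one after the other: `nl` episodes of
learning, batch by batch, and then `nt` test episodes of the learned policy.  When all `N`
hypotheses have been tested, the cluster is mapped to a hypothesis with the largest average
return, and the policy learned for it is executed from then on. -/
def policy (L : Learner S A X ι N) (m : List (Episode X A)) : Policy X A :=
  if hk : m.length / (L.nl + L.nt) < N then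
    let j : Fin N := ⟨m.length / (L.nl + L.nt), hk⟩
    let r := m.length % (L.nl + L.nt)
    if r < L.nl then L.explore (L.block m j) j (r / L.nD) else L.learned (L.block m j) j
  else
    let j := L.selN (L.testValue m)
    L.learned (L.block m j) j

variable [MeasurableSpace S] [MeasurableSpace X] {H : ℕ}

/-- The episodes of every cluster, in order, after the first `e` episodes of the algorithm run with
clustering function `φ`. -/
def memory (L : Learner S A X ι N) (B : BlockMDP S A X N H) (φ : X → Fin N)
    (ω : ℕ → Seed S A X N) : ℕ → Fin N → List (Episode X A)
  | 0 => fun _ => []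
  | e + 1 =>
      let m := memory L B φ ω e
      let i := φ (B.obs₀ (ω e))
      Function.update m i (m i ++ [B.episode (L.policy (m i)) (ω e)])

/-- The policy executed in episode `e`. -/
def executed (L : Learner S A X ι N) (B : BlockMDP S A X N H) (φ : X → Fin N)
    (ω : ℕ → Seed S A X N) (e : ℕ) : Policy X A :=
  L.policy (L.memory B φ ω e (φ (B.obs₀ (ω e))))

end Learner

variable {S A X ι κ l : Type*} {N H : ℕ} [MeasurableSpace S] [MeasurableSpace X]

/-- The `n` labelled transitions for learning the clustering function.  For each of them two
episodes with a uniformly random first action are played.  A fair coin `y` decides between the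
real transition (`y = 1`) of the first one and the imposter (`y = 0`) in which the second
observation is that of the second episode. -/
def clusterData (B : BlockMDP S A X N H) (n : ℕ) (ω : ℕ → Seed S A X N) :
    Fin n → X × A × X × Bool :=
  fun k =>
    let e₁ := B.episode (fun _ _ u => u) (ω (2 * k))
    let e₂ := B.episode (fun _ _ u => u) (ω (2 * k + 1))
    let y := (ω (2 * k)).coin
    (e₁.obs 0, e₁.act 0, if y then e₁.obs 1 else e₂.obs 1, y)

/-- The learned clustering function. -/
def clustering (B : BlockMDP S A X N H) (Φ : l → X → Fin N)
    (erm : (n : ℕ) → (Fin n → X × A × X × Bool) → κ × l) (n : ℕ) (ω : ℕ → Seed S A X N) :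
    X → Fin N :=
  Φ (erm n (clusterData B n ω)).2

/-- The episodes counted as mistakes in the whole run: the `2 n` episodes that provide the data for
the clustering function, and the later episodes whose executed policy has, in the cluster of the
episode, a value more than `gap` below that of the benchmark policy. -/
def mistakes [Fintype S] [Fintype A] [Nonempty A] [Nonempty X] [MeasurableSpace A]
    (B : BlockMDP S A X N H) (L : Learner S A X ι N) (Φ : l → X → Fin N)
    (erm : (n : ℕ) → (Fin n → X × A × X × Bool) → κ × l) (n : ℕ) (bench : Policy X A) (gap : ℝ)
    (ω : ℕ → Seed S A X N) : Set ℕ :=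
  let φ := clustering B Φ erm n ω
  {e | e < 2 * n ∨ ∃ k, e = 2 * n + k ∧
    let ω' : ℕ → Seed S A X N := fun k => ω (2 * n + k)
    let i := φ (B.obs₀ (ω' k))
    B.clusterValue φ i (L.executed B φ ω' k) < B.clusterValue φ i bench - gap}

/-- Size of each data set of the inner algorithm; `H` of them make up the learning episodes of
one hypothesis.  Here `A`, `F` are the numbers of actions and of functions in the class. -/
def dataSize (N H A F : ℕ) (ε η δ : ℝ) : ℕ :=
  ⌈8 * (H : ℝ) ^ 3 * (A : ℝ) ^ 3 * Real.log ((N : ℝ) ^ 2 * F / δ) / (ε * (1 - 2 * η) ^ 2)⌉₊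

/-- Number of test episodes per hypothesis. -/
def testSize (N H : ℕ) (ε δ : ℝ) : ℕ :=
  ⌈(H : ℝ) ^ 2 * Real.log ((N : ℝ) ^ 2 / δ) / (2 * ε ^ 2)⌉₊

/-- The required number of labelled transitions for the clustering function; `C` stands for the
complexity term of the classes at confidence level `δ`. -/
def clusterThreshold (N H A : ℕ) (ε Γ μmin C : ℝ) : ℝ :=
  max (256 * (H : ℝ) ^ 2 * (N : ℝ) ^ 4 * (A : ℝ) ^ 4 * C / (ε ^ 2 * Γ ^ 2 * μmin ^ 4))
    (1024 * (N : ℝ) ^ 4 * (A : ℝ) ^ 4 * C / (Γ ^ 2 * μmin ^ 6))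

end TASID

end

open scoped ENNReal

set_option linter.unusedSectionVars false

namespace TASID

noncomputable section

/-! Robustness is a saddle point. A distortion that keeps the action chosen by `ρ` with probability
at least `1 - η` has action value at least min plus `1 - η` times (max minus min), so by backward
induction `rdpV` bounds the value of `ρ` from below under every perturbation. Conversely, the
adversary who substitutes a worst action with probability `η` holds every policy down to `rdpV`, and
it does not depend on the policy it opposes.

Clustering. Realizability makes the Bayes classifier a competitor in the least squares problem. For
any other classifier the exponential moment of its loss advantage over the Bayes classifier is at
most one minus a multiple of its excess risk (`exp_excess_le`). A classifier can only be selected if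
the product of these exponentials over the sample is at least one, so Markov's inequality and a
union bound give excess risk of order `Λ / n` (`measure_excess_erm_le`). The prediction sees the
first observation only through its cluster. Were two initial states both well represented in a
cluster, one prediction would have to approximate two Bayes classifiers that differ because of `Γ`
(`le_stateExcess_add`). With as many clusters as states, a pigeonhole argument
(`exists_dominant_row`) shows that each cluster has positive mass and one dominant state, up to a
fraction `ε / H`.

Inverse dynamics. Given the latent states at both ends, an action that leads to the observed
successor in the simulator has transition probability at least `1 - η`, any other at most `η`. A
model that prefers a wrong action is therefore bounded away from the true posterior in Hellinger
affinity (`sum_mul_sqrt_add_le`). Products of root likelihood ratios control maximum likelihood just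
as exponentials control least squares (`measure_badFit_le`). Realizability is a pointwise statement
about the true latent state, so other initial states in the cluster do not spoil the regression;
they matter only through the starting point of the decoder. For the dominant hypothesis, the learned
policy and the benchmark coincide on the same randomness unless the initial state is another one or
a decoding error occurs, which costs at most `2 ε` in value (`le_clusterValue_imitate`).

Testing. Hoeffding's bound makes one-sided errors of the test averages at least as large as `ε`
unlikely. Selecting the best average costs `2 ε` more, hence the gap `4 ε`
(`clusterValue_policy_of_not_bad`). Other hypotheses may learn arbitrary policies, since their tests
need not recognize them but only must not flatter them.

Adaptivity. Policies depend on the past and episodes of the clusters interleave. Independence is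
used in the form that redrawing one coordinate preserves a product measure; a supermartingale
argument (`measure_exists_bad_le`) reduces events about the memory of a cluster to a fixed number of
fresh episodes drawn from the conditional law of that cluster. After `N * (nl + nt)` episodes a
cluster makes no more mistakes, and there are `N` clusters. -/

theorem sum_pmf {α : Type*} [Fintype α] (p : PMF α) : ∑ a, p a = 1 := by
  have h := p.tsum_coe
  rwa [tsum_fintype] at h

theorem sum_toReal_pmf {α : Type*} [Fintype α] (p : PMF α) : ∑ a, (p a).toReal = 1 := by
  rw [← ENNReal.toReal_sum fun a _ => p.apply_ne_top a, sum_pmf, ENNReal.toReal_one]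

open Classical in
/-- The distribution that puts mass `1 - η` on `a` and mass `η` on `b`. -/
def mixPMF {A : Type*} [Fintype A] (η : ℝ) (h0 : 0 ≤ η) (h1 : η ≤ 1) (a b : A) : PMF A :=
  PMF.ofFintype
    (fun a' => ENNReal.ofReal ((if a' = a then 1 - η else 0) + if a' = b then η else 0)) (by
      rw [← ENNReal.ofReal_sum_of_nonneg]
      · simp [Finset.sum_add_distrib]
      · intro i _
        have : 0 ≤ 1 - η := by linarith
        positivity)

open Classical in
theorem mixPMF_toReal {A : Type*} [Fintype A] {η : ℝ} (h0 : 0 ≤ η) (h1 : η ≤ 1) (a b a' : A) :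
    (mixPMF η h0 h1 a b a').toReal = (if a' = a then 1 - η else 0) + if a' = b then η else 0 := by
  have : 0 ≤ 1 - η := by linarith
  simp only [mixPMF, PMF.ofFintype_apply]
  exact ENNReal.toReal_ofReal (by positivity)

open Classical in
theorem sum_mul_mixPMF {A : Type*} [Fintype A] {η : ℝ} (h0 : 0 ≤ η) (h1 : η ≤ 1) (a b : A)
    (f : A → ℝ) :
    ∑ a', f a' * (mixPMF η h0 h1 a b a').toReal = (1 - η) * f a + η * f b := by
  simp only [mixPMF_toReal, mul_add, Finset.sum_add_distrib, mul_ite, mul_zero,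
    Finset.sum_ite_eq', Finset.mem_univ, if_true]
  ring

theorem toReal_bind {α β : Type*} [Fintype α] (p : PMF α) (f : α → PMF β) (b : β) :
    ((p.bind f) b).toReal = ∑ a, (f a b).toReal * (p a).toReal := by
  rw [PMF.bind_apply, tsum_fintype, ENNReal.toReal_sum]
  · simp [ENNReal.toReal_mul, mul_comm]
  · exact fun a _ => ENNReal.mul_ne_top (p.apply_ne_top a) ((f a).apply_ne_top b)

/-! ### Robust dynamic programming as a saddle point -/

namespace MDP

variable {S A : Type*} {N H : ℕ}

theorem prob_nonneg (M : MDP S A N H) (h : ℕ) (s : S) (a : A) (s' : S) : 0 ≤ M.prob h s a s' :=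
  ENNReal.toReal_nonneg

theorem sum_prob [Fintype S] (M : MDP S A N H) (h : ℕ) (s : S) (a : A) :
    ∑ s', M.prob h s a s' = 1 :=
  sum_toReal_pmf (M.T h s a)

/-- The perturbation of `M` in which the adversary replaces the action by `b` with probability
`η`. -/
def adversarial [Fintype A] (M : MDP S A N H) (η : ℝ) (h0 : 0 ≤ η) (h1 : η ≤ 1)
    (b : ℕ → S → A) : MDP S A N H where
  start := M.start
  μ := M.μ
  T h s a := (mixPMF η h0 h1 a (b h s)).bind fun a' => M.T h s a'
  R h s a := (1 - η) * M.R h s a + η * M.R h s (b h s)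
  R_mem h s a :=
    convex_Icc (0 : ℝ) 1 (M.R_mem h s a) (M.R_mem h s (b h s)) (by linarith) h0 (by ring)

theorem isPerturbation_adversarial [Fintype A] (M : MDP S A N H) {η : ℝ} (h0 : 0 ≤ η)
    (h1 : η ≤ 1) (b : ℕ → S → A) : IsPerturbation η M (M.adversarial η h0 h1 b) := by
  refine ⟨rfl, rfl, fun h s a => mixPMF η h0 h1 a (b h s), fun h _ s a => ⟨?_, fun s' => ?_, ?_⟩⟩
  · rw [mixPMF_toReal, if_pos rfl]
    split_ifs <;> linarith
  · exact toReal_bind _ _ _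
  · rw [sum_mul_mixPMF]; rfl

variable [Fintype S]

/-- The backup of a perturbed MDP is the average of the backups of the unperturbed one. -/
theorem backup_eq_sum [Fintype A] (M M' : MDP S A N H) (ξ : PMF A) (h : ℕ) (s : S) (a : A)
    (hT : ∀ s', M'.prob h s a s' = ∑ a', M.prob h s a' s' * (ξ a').toReal)
    (hR : M'.R h s a = ∑ a', M.R h s a' * (ξ a').toReal) (V : S → ℝ) :
    M'.backup h V s a = ∑ a', M.backup h V s a' * (ξ a').toReal := by
  simp only [backup, hR, hT, Finset.sum_mul, add_mul, Finset.sum_add_distrib]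
  rw [Finset.sum_comm]
  congr 1
  refine Finset.sum_congr rfl fun a' _ => Finset.sum_congr rfl fun s' _ => by ring

theorem backup_mono (M : MDP S A N H) (h : ℕ) {V V' : S → ℝ} (hV : ∀ s, V s ≤ V' s) (s : S)
    (a : A) : M.backup h V s a ≤ M.backup h V' s a := by
  unfold backup
  gcongr with s'
  · exact M.prob_nonneg h s a s'
  · exact hV s'

theorem valueToGo_succ (M : MDP S A N H) (ψ : ℕ → S → A) (n : ℕ) (s : S) :
    M.valueToGo ψ (n + 1) s =
      M.backup (H - (n + 1)) (M.valueToGo ψ n) s (ψ (H - (n + 1)) s) := rfl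

variable [Fintype A]

/-- Backward induction for the lower half of the saddle point: since `ρ` attains the maximum, the
mass that `ξ` keeps on it secures `1 - η` times the gap between maximum and minimum, and the
remaining mass can do no worse than the minimum. -/
theorem rdpV_le_valueToGo [Nonempty A] {M M' : MDP S A N H} {η : ℝ} {ρ : ℕ → S → A}
    (hM : IsPerturbation η M M') (hρ : M.IsRDPOutput η ρ) :
    ∀ n ≤ H, ∀ s, M.rdpV η n s ≤ M'.valueToGo ρ n s := by
  obtain ⟨-, -, ξ, hξ⟩ := hM
  intro n
  induction n with
  | zero => intro _ s; exact le_rfl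
  | succ n ih =>
    intro hn s
    rw [valueToGo_succ]
    set h := H - (n + 1) with hh
    have hlt : h < H := by omega
    have hHn : H - (h + 1) = n := by omega
    obtain ⟨hkeep, hT, hR⟩ := hξ h hlt s (ρ h s)
    refine le_trans ?_ (backup_mono M' h (ih (by omega)) s (ρ h s))
    rw [backup_eq_sum M M' (ξ h s (ρ h s)) h s _ hT hR]
    have hmax := hρ h hlt s
    rw [hHn] at hmax
    set Q : A → ℝ := M.backup h (M.rdpV η n) s
    have hb : BddBelow (Set.range Q) := (Set.finite_range Q).bddBelow
    have hmin : ∀ a, ⨅ a, Q a ≤ Q a := ciInf_le hb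
    have hsup : ⨆ a, Q a = Q (ρ h s) :=
      le_antisymm (ciSup_le hmax) (le_ciSup (Set.finite_range Q).bddAbove _)
    change (1 - η) * (⨆ a, Q a) + η * (⨅ a, Q a) ≤ _
    rw [hsup]
    set p : A → ℝ := fun a => (ξ h s (ρ h s) a).toReal with hp
    have hp1 : ∑ a, p a = 1 := sum_toReal_pmf _
    -- Centering at the minimum makes all terms nonnegative, so the term of the kept action may be
    -- isolated.
    have key : ∑ a, Q a * p a = (⨅ a, Q a) + ∑ a, (Q a - ⨅ a, Q a) * p a := by
      simp only [sub_mul, Finset.sum_sub_distrib, ← Finset.mul_sum, hp1]; ring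
    have hle : (Q (ρ h s) - ⨅ a, Q a) * p (ρ h s) ≤ ∑ a, (Q a - ⨅ a, Q a) * p a :=
      Finset.single_le_sum (f := fun a => (Q a - ⨅ a, Q a) * p a)
        (fun a _ => mul_nonneg (sub_nonneg.2 (hmin a)) ENNReal.toReal_nonneg) (Finset.mem_univ _)
    have := mul_le_mul_of_nonneg_left hkeep (sub_nonneg.2 (hmin (ρ h s)))
    change _ ≤ ∑ a, Q a * p a
    rw [key]
    nlinarith

/-- The adversary minimizes the backup of `rdpV`, not that of the value of `ψ`; hence one
perturbation works against all `ψ` simultaneously, and inf and sup can be exchanged. -/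
theorem exists_valueToGo_le_rdpV [Nonempty A] (M : MDP S A N H) {η : ℝ} (h0 : 0 ≤ η)
    (h1 : η ≤ 1) :
    ∃ M' : MDP S A N H, IsPerturbation η M M' ∧
      ∀ ψ : ℕ → S → A, ∀ n ≤ H, ∀ s, M'.valueToGo ψ n s ≤ M.rdpV η n s := by
  have hex : ∀ h s, ∃ b, ∀ a, M.backup h (M.rdpV η (H - (h + 1))) s b ≤
      M.backup h (M.rdpV η (H - (h + 1))) s a := fun h s => Finite.exists_min _
  choose b hb using hex
  refine ⟨M.adversarial η h0 h1 b, M.isPerturbation_adversarial h0 h1 b, fun ψ n => ?_⟩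
  induction n with
  | zero => intro _ s; exact le_rfl
  | succ n ih =>
    intro hn s
    rw [valueToGo_succ]
    set h := H - (n + 1) with hh
    have hHn : H - (h + 1) = n := by omega
    refine (backup_mono _ h (ih (by omega)) s (ψ h s)).trans ?_
    rw [backup_eq_sum M (M.adversarial η h0 h1 b) (mixPMF η h0 h1 (ψ h s) (b h s)) h s _ (fun _ => toReal_bind _ _ _)
      (by rw [sum_mul_mixPMF]; rfl), sum_mul_mixPMF]
    have hmin := hb h s
    rw [hHn] at hmin
    change _ ≤ (1 - η) * (⨆ a, M.backup h (M.rdpV η n) s a) +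
      η * (⨅ a, M.backup h (M.rdpV η n) s a)
    have : 0 ≤ 1 - η := by linarith
    gcongr
    · exact le_ciSup (f := fun a => M.backup h (M.rdpV η n) s a)
        (Set.finite_range _).bddAbove _
    · exact le_ciInf hmin

/-- Robust dynamic programming finds a robust policy. -/
theorem IsRDPOutput.isRobustPolicy [Nonempty A] {M : MDP S A N H} {η : ℝ} {ρ : ℕ → S → A}
    (h0 : 0 ≤ η) (h1 : η ≤ 1) (hρ : M.IsRDPOutput η ρ) : M.IsRobustPolicy η ρ := by
  intro ψ
  obtain ⟨M₁, hM₁, hle⟩ := M.exists_valueToGo_le_rdpV h0 h1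
  -- The infimum of a real family that is not bounded below has the default value `0`, so
  -- boundedness is needed before `ciInf_le` applies.
  have lower : ∀ φ : ℕ → S → A, ∀ M' : {M' : MDP S A N H // IsPerturbation η M M'}, ∀ n s,
      0 ≤ M'.1.valueToGo φ n s := by
    intro φ M' n
    induction n with
    | zero => intro s; exact le_rfl
    | succ n ih =>
      intro s
      exact add_nonneg (M'.1.R_mem _ _ _).1
        (Finset.sum_nonneg fun s' _ => mul_nonneg (M'.1.prob_nonneg _ _ _ _) (ih s'))
  have bdd : BddBelow (Set.range fun M' : {M' : MDP S A N H // IsPerturbation η M M'} =>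
      M'.1.value ψ) := ⟨0, by
    rintro _ ⟨M', rfl⟩
    exact Finset.sum_nonneg fun i _ => mul_nonneg ENNReal.toReal_nonneg (lower ψ M' H _)⟩
  have : Nonempty {M' : MDP S A N H // IsPerturbation η M M'} := ⟨⟨M₁, hM₁⟩⟩
  refine (ciInf_le bdd ⟨M₁, hM₁⟩).trans (le_ciInf fun M' => ?_)
  unfold value
  rw [hM₁.1, hM₁.2.1, M'.2.1, M'.2.2.1]
  refine Finset.sum_le_sum fun i _ => mul_le_mul_of_nonneg_left ?_ ENNReal.toReal_nonneg
  exact (hle ψ H le_rfl _).trans (rdpV_le_valueToGo M'.2 hρ H le_rfl _)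

end MDP

end

noncomputable section

/-! ### Resampling coordinates of a product measure -/

section Resample

variable {ι : Type*} {X : ι → Type*} [∀ i, MeasurableSpace (X i)] [DecidableEq ι]

/-- A fresh draw of one coordinate does not change the joint law. This replaces conditional
expectations throughout: an integrand whose other ingredients ignore coordinate `i` sees it as an
independent variable. -/
theorem measurePreserving_update (μ : (i : ι) → Measure (X i)) [∀ i, IsProbabilityMeasure (μ i)]
    (i : ι) :
    MeasurePreserving (fun p : ((j : ι) → X j) × X i => Function.update p.1 i p.2)
      ((Measure.infinitePi μ).prod (μ i)) (Measure.infinitePi μ) := by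
  have hm : Measurable (fun p : ((j : ι) → X j) × X i => Function.update p.1 i p.2) := by
    refine measurable_pi_lambda _ fun j => ?_
    by_cases h : j = i
    · subst h; simpa using measurable_snd
    · simp only [Function.update_of_ne h]; fun_prop
  refine ⟨hm, Measure.eq_infinitePi _ fun s t ht => ?_⟩
  rw [Measure.map_apply hm (MeasurableSet.pi s.countable_toSet fun j _ => ht j)]
  have hpre : (fun p : ((j : ι) → X j) × X i => Function.update p.1 i p.2) ⁻¹' Set.pi s t =
      (Set.pi (s.erase i : Finset ι) t) ×ˢ (if i ∈ s then t i else Set.univ) := by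
    ext p
    simp only [Set.mem_preimage, Set.mem_pi, Set.mem_prod, Finset.mem_coe, Finset.mem_erase]
    constructor
    · intro h
      refine ⟨fun j hj => by simpa [Function.update_of_ne hj.1] using h j hj.2, ?_⟩
      split_ifs with hi
      · simpa using h i hi
      · trivial
    · rintro ⟨h1, h2⟩ j hj
      by_cases hji : j = i
      · subst hji; simpa [hj] using h2
      · simpa [Function.update_of_ne hji] using h1 j ⟨hji, hj⟩
  rw [hpre, Measure.prod_prod, Measure.infinitePi_pi _ fun j _ => ht j]
  split_ifs with hi
  · exact Finset.prod_erase_mul _ _ hi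
  · rw [Finset.erase_eq_of_notMem hi, measure_univ, mul_one]

/-- The inequality suffices and asks for no measurability of `f`. It is applied to integrands built
from the iterated integrals `badProb`, whose measurability is never established. -/
theorem lintegral_infinitePi_le_update (μ : (i : ι) → Measure (X i))
    [∀ i, IsProbabilityMeasure (μ i)] (i : ι) (f : ((j : ι) → X j) → ℝ≥0∞) :
    ∫⁻ ω, f ω ∂Measure.infinitePi μ ≤
      ∫⁻ ω, ∫⁻ x, f (Function.update ω i x) ∂μ i ∂Measure.infinitePi μ := by
  conv_lhs => rw [← (measurePreserving_update μ i).map_eq]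
  exact (lintegral_map_le _ _).trans (lintegral_prod_le _)

end Resample

/-- Joining the first `n` terms of a sequence with a second sequence preserves product measure. -/
theorem measurePreserving_splice {Y : Type*} [MeasurableSpace Y] (ν : Measure Y)
    [IsProbabilityMeasure ν] (n : ℕ) :
    MeasurePreserving
      (fun p : (ℕ → Y) × (ℕ → Y) => fun k => if k < n then p.1 k else p.2 (k - n))
      ((Measure.infinitePi fun _ => ν).prod (Measure.infinitePi fun _ => ν))
      (Measure.infinitePi fun _ : ℕ => ν) := by
  have hm : Measurable
      (fun p : (ℕ → Y) × (ℕ → Y) => fun k => if k < n then p.1 k else p.2 (k - n)) := by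
    refine measurable_pi_lambda _ fun j => ?_
    by_cases h : j < n
    · simp only [if_pos h]; fun_prop
    · simp only [if_neg h]; fun_prop
  refine ⟨hm, Measure.eq_infinitePi _ fun s t ht => ?_⟩
  rw [Measure.map_apply hm (MeasurableSet.pi s.countable_toSet fun j _ => ht j)]
  have hpre : (fun p : (ℕ → Y) × (ℕ → Y) => fun k => if k < n then p.1 k else p.2 (k - n)) ⁻¹'
      Set.pi s t = (Set.pi (s.filter (· < n) : Finset ℕ) t) ×ˢ
        (Set.pi ((s.filter (¬ · < n)).image (· - n) : Finset ℕ) fun k => t (k + n)) := by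
    ext p
    simp only [Set.mem_preimage, Set.mem_pi, Set.mem_prod, Finset.mem_coe, Finset.mem_filter,
      Finset.mem_image]
    constructor
    · intro h
      refine ⟨fun j hj => by simpa [hj.2] using h j hj.1, ?_⟩
      rintro _ ⟨j, hj, rfl⟩
      have := h j hj.1
      rw [if_neg hj.2] at this
      rwa [Nat.sub_add_cancel (not_lt.1 hj.2)]
    · rintro ⟨h1, h2⟩ j hj
      by_cases hjn : j < n
      · simpa [hjn] using h1 j ⟨hj, hjn⟩
      · have := h2 (j - n) ⟨j, ⟨hj, hjn⟩, rfl⟩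
        rw [Nat.sub_add_cancel (not_lt.1 hjn)] at this
        simpa [hjn] using this
  rw [hpre, Measure.prod_prod, Measure.infinitePi_pi _ fun j _ => ht j,
    Measure.infinitePi_pi _ fun j _ => ht _, Finset.prod_image]
  · rw [← Finset.prod_filter_mul_prod_filter_not s (· < n)]
    congr 1
    refine Finset.prod_congr rfl fun j hj => ?_
    rw [Nat.sub_add_cancel (not_lt.1 (Finset.mem_filter.1 hj).2)]
  · intro a ha b hb hab
    have := (Finset.mem_filter.1 ha).2
    have := (Finset.mem_filter.1 hb).2
    simp only at hab
    omega

theorem lintegral_pmf {α : Type*} [Fintype α] [MeasurableSpace α] [MeasurableSingletonClass α]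
    (p : PMF α) (f : α → ℝ≥0∞) : ∫⁻ a, f a ∂p.toMeasure = ∑ a, p a * f a := by
  rw [lintegral_fintype]
  refine Finset.sum_congr rfl fun a _ => ?_
  rw [PMF.toMeasure_apply_singleton _ _ (measurableSet_singleton a), mul_comm]

/-! ### Measure-preserving resampling maps on product spaces -/

section ProdMaps

variable {W Y Z : Type*} [MeasurableSpace W] [MeasurableSpace Y] [MeasurableSpace Z]

/-- Together with the left-hand version this carries the resampling of one factor through the nested
product that makes up a `Seed`. -/
theorem measurePreserving_prod_right (κ : Measure W) (μ : Measure Y) (ν : Measure Z) [SFinite κ]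
    [SFinite μ] [SFinite ν] {g : Y × Z → Y} (hg : MeasurePreserving g (μ.prod ν) μ) :
    MeasurePreserving (fun p : (W × Y) × Z => (p.1.1, g (p.1.2, p.2))) ((κ.prod μ).prod ν)
      (κ.prod μ) :=
  ((MeasurePreserving.id κ).prod hg).comp (measurePreserving_prodAssoc κ μ ν)

theorem measurePreserving_prod_left (κ : Measure W) (μ : Measure Y) (ν : Measure Z) [SFinite κ]
    [SFinite μ] [SFinite ν] {g : Y × Z → Y} (hg : MeasurePreserving g (μ.prod ν) μ) :
    MeasurePreserving (fun p : (Y × W) × Z => (g (p.1.1, p.2), p.1.2)) ((μ.prod κ).prod ν)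
      (μ.prod κ) :=
  (Measure.measurePreserving_swap.comp (measurePreserving_prod_right κ μ ν hg)).comp
    (Measure.measurePreserving_swap.prod (MeasurePreserving.id ν))

theorem lintegral_resample {μ : Measure Y} {ν : Measure Z} [SFinite μ] [SFinite ν] {g : Y × Z → Y}
    (hg : MeasurePreserving g (μ.prod ν) μ) {f : Y → ℝ≥0∞} (hf : Measurable f) :
    ∫⁻ y, f y ∂μ = ∫⁻ y, ∫⁻ z, f (g (y, z)) ∂ν ∂μ := by
  rw [← hg.lintegral_comp hf]
  exact lintegral_prod _ (hf.comp hg.measurable).aemeasurable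

end ProdMaps

/-- Evaluation of a measurable family of functions at a measurable point of a countable type. -/
theorem measurable_eval {Ω Y Z : Type*} [MeasurableSpace Ω] [MeasurableSpace Y]
    [MeasurableSpace Z] [Countable Y] [MeasurableSingletonClass Y] {f : Ω → Y → Z} {g : Ω → Y}
    (hf : ∀ y, Measurable fun w => f w y) (hg : Measurable g) : Measurable fun w => f w (g w) := by
  have h : Measurable fun p : Ω × Y => f p.1 p.2 :=
    measurable_from_prod_countable_left fun y => hf y
  exact h.comp (measurable_id.prodMk hg)

end

noncomputable section

/-! ### Resampling the randomness of an episode -/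

namespace Seed

variable {S A X : Type*} {N : ℕ}

/-- Replace the emissions of step `t`. -/
def setEmit (w : Seed S A X N) (t : ℕ) (e : S → X) : Seed S A X N :=
  (w.1, Function.update w.2.1 t e, w.2.2)

/-- Replace the transitions of step `t`. -/
def setTrans (w : Seed S A X N) (t : ℕ) (r : S → A → S) : Seed S A X N :=
  (w.1, w.2.1, Function.update w.2.2.1 t r, w.2.2.2)

/-- Replace the random action. -/
def setAct (w : Seed S A X N) (a : A) : Seed S A X N :=
  (w.1, w.2.1, w.2.2.1, a, w.2.2.2.2)

variable [MeasurableSpace S] [MeasurableSpace A] [MeasurableSpace X]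

@[fun_prop]
theorem measurable_idx : Measurable (idx : Seed S A X N → Fin N) := measurable_fst

@[fun_prop]
theorem measurable_act : Measurable (act : Seed S A X N → A) := by unfold act; fun_prop

@[fun_prop]
theorem measurable_coin : Measurable (coin : Seed S A X N → Bool) := by unfold coin; fun_prop

theorem measurable_emit (t : ℕ) (s : S) : Measurable fun w : Seed S A X N => w.emit t s := by
  unfold emit; fun_prop

theorem measurable_trans (t : ℕ) (s : S) (a : A) :
    Measurable fun w : Seed S A X N => w.trans t s a := by
  unfold trans; fun_prop

end Seed

namespace BlockMDP

variable {S A X : Type*} {N H : ℕ} [Fintype S] [MeasurableSpace S] [MeasurableSingletonClass S]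
  [Fintype A] [Nonempty A] [MeasurableSpace A] [MeasurableSingletonClass A] [MeasurableSpace X]

theorem measurePreserving_setEmit (B : BlockMDP S A X N H) (t : ℕ) :
    MeasurePreserving (fun p : Seed S A X N × (S → X) => p.1.setEmit t p.2)
      (B.seedLaw.prod (Measure.pi fun s : S => (B.q s : Measure X))) B.seedLaw :=
  measurePreserving_prod_right _ _ _ <| measurePreserving_prod_left _ _ _ <|
    measurePreserving_update (fun _ : ℕ => Measure.pi fun s : S => (B.q s : Measure X)) t

theorem measurePreserving_setTrans (B : BlockMDP S A X N H) (t : ℕ) :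
    MeasurePreserving (fun p : Seed S A X N × (S → A → S) => p.1.setTrans t p.2)
      (B.seedLaw.prod
        (Measure.pi fun s : S => Measure.pi fun a : A => (B.latent.T t s a).toMeasure))
      B.seedLaw :=
  measurePreserving_prod_right _ _ _ <| measurePreserving_prod_right _ _ _ <|
    measurePreserving_prod_left _ _ _ <| measurePreserving_update (fun h : ℕ =>
      Measure.pi fun s : S => Measure.pi fun a : A => (B.latent.T h s a).toMeasure) t

theorem measurePreserving_setAct (B : BlockMDP S A X N H) :
    MeasurePreserving (fun p : Seed S A X N × A => p.1.setAct p.2)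
      (B.seedLaw.prod (PMF.uniformOfFintype A).toMeasure) B.seedLaw :=
  measurePreserving_prod_right _ _ _ <| measurePreserving_prod_right _ _ _ <|
    measurePreserving_prod_right _ _ _ <| measurePreserving_prod_left _ _ _ measurePreserving_snd

theorem measurePreserving_emit (B : BlockMDP S A X N H) (t : ℕ) (s : S) :
    MeasurePreserving (fun w : Seed S A X N => w.emit t s) B.seedLaw (B.q s : Measure X) :=
  (measurePreserving_eval (fun s : S => (B.q s : Measure X)) s).comp <|
    (measurePreserving_eval_infinitePi
      (fun _ : ℕ => Measure.pi fun s : S => (B.q s : Measure X)) t).comp <|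
    measurePreserving_fst.comp measurePreserving_snd

theorem measurePreserving_trans (B : BlockMDP S A X N H) (t : ℕ) (s : S) (a : A) :
    MeasurePreserving (fun w : Seed S A X N => w.trans t s a) B.seedLaw
      (B.latent.T t s a).toMeasure :=
  (measurePreserving_eval (fun a : A => (B.latent.T t s a).toMeasure) a).comp <|
    (measurePreserving_eval
      (fun s : S => Measure.pi fun a : A => (B.latent.T t s a).toMeasure) s).comp <|
    (measurePreserving_eval_infinitePi (fun h : ℕ => Measure.pi fun s : S =>
      Measure.pi fun a : A => (B.latent.T h s a).toMeasure) t).comp <|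
    measurePreserving_fst.comp <| measurePreserving_snd.comp measurePreserving_snd

theorem measurePreserving_idx (B : BlockMDP S A X N H) :
    MeasurePreserving (fun w : Seed S A X N => w.idx) B.seedLaw B.latent.μ.toMeasure :=
  measurePreserving_fst

theorem ae_pmf_ne_zero {α : Type*} [Countable α] [MeasurableSpace α] [MeasurableSingletonClass α]
    (p : PMF α) : ∀ᵐ a ∂p.toMeasure, p a ≠ 0 := by
  rw [ae_iff_of_countable]
  intro a ha h
  rw [PMF.toMeasure_apply_singleton _ _ (measurableSet_singleton a)] at ha
  exact ha h

theorem ae_trans (B : BlockMDP S A X N H) :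
    ∀ᵐ w ∂B.seedLaw, ∀ t s a, B.latent.T t s a (w.trans t s a) ≠ 0 := by
  rw [ae_all_iff]; intro t
  rw [ae_all_iff]; intro s
  rw [ae_all_iff]; intro a
  exact (B.measurePreserving_trans t s a).quasiMeasurePreserving.ae (ae_pmf_ne_zero _)

theorem ae_idx (B : BlockMDP S A X N H) : ∀ᵐ w ∂B.seedLaw, B.latent.μ w.idx ≠ 0 :=
  B.measurePreserving_idx.quasiMeasurePreserving.ae (ae_pmf_ne_zero _)

theorem ae_emit (B : BlockMDP S A X N H) {P : S → X → Prop}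
    (hP : ∀ s, ∀ᵐ x ∂(B.q s : Measure X), P s x) :
    ∀ᵐ w ∂B.seedLaw, ∀ t s, P s (w.emit t s) := by
  rw [ae_all_iff]; intro t
  rw [ae_all_iff]; intro s
  exact (B.measurePreserving_emit t s).quasiMeasurePreserving.ae (hP s)

theorem ae_dec (B : BlockMDP S A X N H) (s : S) : ∀ᵐ x ∂(B.q s : Measure X), B.dec x = s :=
  (prob_compl_eq_zero_iff (B.dec_meas (measurableSet_singleton s))).2 (B.dec_spec s)

theorem ae_dec_emit (B : BlockMDP S A X N H) :
    ∀ᵐ w ∂B.seedLaw, ∀ t s, B.dec (w.emit t s) = s :=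
  B.ae_emit B.ae_dec

/-! ### One step of an episode -/

/-- The expectation of a function of the next state and of the next observation, given a past that
does not depend on the transitions of step `t` and the emissions of step `t + 1`. -/
theorem lintegral_step (B : BlockMDP S A X N H) (t : ℕ) {D : Seed S A X N → S}
    {a : Seed S A X N → A} {G : Seed S A X N → S → X → ℝ≥0∞} (hD : Measurable D)
    (ha : Measurable a) (hG : ∀ s', Measurable fun p : Seed S A X N × X => G p.1 s' p.2)
    (hDe : ∀ w r e, D ((w.setTrans t r).setEmit (t + 1) e) = D w)
    (hae : ∀ w r e, a ((w.setTrans t r).setEmit (t + 1) e) = a w)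
    (hGe : ∀ w r e, G ((w.setTrans t r).setEmit (t + 1) e) = G w) :
    ∫⁻ w, G w (w.trans t (D w) (a w)) (w.emit (t + 1) (w.trans t (D w) (a w))) ∂B.seedLaw =
      ∫⁻ w, ∑ s', B.latent.T t (D w) (a w) s' * ∫⁻ x, G w s' x ∂(B.q s' : Measure X)
        ∂B.seedLaw := by
  have htr : Measurable fun w : Seed S A X N => w.trans t (D w) (a w) := by
    refine measurable_eval (f := fun w : Seed S A X N => fun b => w.trans t (D w) b) (fun b => ?_) ha
    exact measurable_eval (f := fun w : Seed S A X N => fun s => w.trans t s b)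
      (fun s => Seed.measurable_trans t s b) hD
  have hem : Measurable fun w : Seed S A X N => w.emit (t + 1) (w.trans t (D w) (a w)) :=
    measurable_eval (f := fun w : Seed S A X N => fun s => w.emit (t + 1) s)
      (fun s => Seed.measurable_emit _ s) htr
  have hF : Measurable fun w : Seed S A X N =>
      G w (w.trans t (D w) (a w)) (w.emit (t + 1) (w.trans t (D w) (a w))) :=
    measurable_eval (f := fun w : Seed S A X N => fun s =>
      G w s (w.emit (t + 1) (w.trans t (D w) (a w))))
      (fun s => (hG s).comp (measurable_id.prodMk hem)) htr
  -- Fresh transitions of step `t` and fresh emissions of step `t + 1` are substituted. As `D`, `a`,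
  -- `G` do not notice, the next state is one coordinate of a product of the laws `T`, and the next
  -- observation one coordinate of a product of the laws `q`.
  refine (lintegral_resample (B.measurePreserving_setEmit (t + 1)) hF).trans <|
    (lintegral_resample (B.measurePreserving_setTrans t)
      (Measurable.lintegral_prod_right'
        (hF.comp (B.measurePreserving_setEmit (t + 1)).measurable))).trans <|
    lintegral_congr fun w => ?_
  simp only [Function.comp]
  have h1 : ∀ r e, (fun w : Seed S A X N => w.trans t (D w) (a w))
      ((w.setTrans t r).setEmit (t + 1) e) = r (D w) (a w) := fun r e => by
    simp only [hDe, hae]; simp [Seed.setTrans, Seed.setEmit, Seed.trans]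
  have h2 : ∀ r e s, ((w.setTrans t r).setEmit (t + 1) e).emit (t + 1) s = e s := fun r e s => by
    simp [Seed.setTrans, Seed.setEmit, Seed.emit]
  simp only at h1
  simp only [h1, h2, hGe]
  have hGw : ∀ s', Measurable (G w s') := fun s' => (hG s').comp measurable_prodMk_left
  have h3 : ∀ s', ∫⁻ e, G w s' (e s') ∂(Measure.pi fun s : S => (B.q s : Measure X)) =
      ∫⁻ x, G w s' x ∂(B.q s' : Measure X) := fun s' =>
    (measurePreserving_eval (fun s : S => (B.q s : Measure X)) s').lintegral_comp (hGw s')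
  simp only [h3]
  rw [← lintegral_pmf]
  exact ((measurePreserving_eval (fun b : A => (B.latent.T t (D w) b).toMeasure) (a w)).comp
    (measurePreserving_eval (fun s : S => Measure.pi fun b : A => (B.latent.T t s b).toMeasure)
      (D w))).lintegral_comp
    (f := fun s' => ∫⁻ x, G w s' x ∂(B.q s' : Measure X)) (measurable_of_countable _)

/-- The random action of an episode is uniform and independent of everything else. -/
theorem lintegral_act (B : BlockMDP S A X N H) {F : Seed S A X N → A → ℝ≥0∞}
    (hF : ∀ u, Measurable fun w => F w u) (hFe : ∀ w u, F (w.setAct u) = F w) :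
    ∫⁻ w, F w w.act ∂B.seedLaw = ∫⁻ w, ∑ u, (Fintype.card A : ℝ≥0∞)⁻¹ * F w u ∂B.seedLaw := by
  rw [lintegral_resample B.measurePreserving_setAct
    (measurable_eval (f := F) hF Seed.measurable_act)]
  refine lintegral_congr fun w => ?_
  rw [lintegral_pmf]
  simp only [hFe, PMF.uniformOfFintype_apply]
  rfl

/-! ### Measurability of trajectories -/

/-- A family of policies that is jointly measurable in the parameter. -/
def MeasurableFamily {Θ : Type*} [MeasurableSpace Θ] (π : Θ → Policy X A) : Prop :=
  ∀ t, Measurable fun p : Θ × (Fin (t + 1) → X) × A => π p.1 t p.2.1 p.2.2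

section Measurability

variable {Θ : Type*} [MeasurableSpace Θ] {π : Θ → Policy X A}

theorem traj_obs_succ (B : BlockMDP S A X N H) (π : Policy X A) (w : Seed S A X N) (t : ℕ)
    (i : Fin (t + 1)) : (B.traj π w (t + 1)).2 i.castSucc = (B.traj π w t).2 i := by
  simp [traj]

theorem obs_eq_emit (B : BlockMDP S A X N H) (π : Policy X A) (w : Seed S A X N) (t : ℕ) :
    B.obs π w t = w.emit t (B.traj π w t).1 := by
  cases t with
  | zero => rfl
  | succ t => simp [obs, traj]

theorem measurable_traj (B : BlockMDP S A X N H) (hπ : MeasurableFamily π) (t : ℕ) :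
    Measurable fun p : Θ × Seed S A X N => B.traj (π p.1) p.2 t := by
  have hemit : ∀ t s, Measurable fun p : Θ × Seed S A X N => p.2.emit t s := fun t s =>
    (Seed.measurable_emit t s).comp measurable_snd
  induction t with
  | zero =>
    have h0 : Measurable fun p : Θ × Seed S A X N => B.latent.start p.2.idx :=
      (measurable_of_countable B.latent.start).comp (Seed.measurable_idx.comp measurable_snd)
    exact h0.prodMk (measurable_pi_lambda _ fun _ => measurable_eval (hemit 0) h0)
  | succ t ih =>
    have ha : Measurable fun p : Θ × Seed S A X N =>
        π p.1 t (B.traj (π p.1) p.2 t).2 p.2.act :=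
      (hπ t).comp (measurable_fst.prodMk ((measurable_snd.comp ih).prodMk
        (Seed.measurable_act.comp measurable_snd)))
    have hs : Measurable fun p : Θ × Seed S A X N => (B.traj (π p.1) p.2 (t + 1)).1 := by
      refine measurable_eval (f := fun p : Θ × Seed S A X N => fun b =>
        p.2.trans t (B.traj (π p.1) p.2 t).1 b) (fun b => ?_) ha
      exact measurable_eval (f := fun p : Θ × Seed S A X N => fun s => p.2.trans t s b)
        (fun s => (Seed.measurable_trans t s b).comp measurable_snd) (measurable_fst.comp ih)
    have hx : ∀ i, Measurable fun p : Θ × Seed S A X N =>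
        (B.traj (π p.1) p.2 (t + 1)).2 i := by
      intro i
      induction i using Fin.lastCases with
      | last =>
        have : (fun p : Θ × Seed S A X N => (B.traj (π p.1) p.2 (t + 1)).2 (Fin.last (t + 1))) =
            fun p => p.2.emit (t + 1) (B.traj (π p.1) p.2 (t + 1)).1 := by
          funext p; exact B.obs_eq_emit _ _ _
        rw [this]
        exact measurable_eval (hemit (t + 1)) hs
      | cast i =>
        simp only [traj_obs_succ]
        exact (measurable_pi_apply i).comp (measurable_snd.comp ih)
    exact hs.prodMk (measurable_pi_lambda _ hx)

theorem measurable_obs (B : BlockMDP S A X N H) (hπ : MeasurableFamily π) (t : ℕ) :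
    Measurable fun p : Θ × Seed S A X N => B.obs (π p.1) p.2 t :=
  (measurable_pi_apply _).comp (measurable_snd.comp (B.measurable_traj hπ t))

theorem measurable_action (B : BlockMDP S A X N H) (hπ : MeasurableFamily π) (t : ℕ) :
    Measurable fun p : Θ × Seed S A X N => B.action (π p.1) p.2 t :=
  (hπ t).comp (measurable_fst.prodMk ((measurable_snd.comp (B.measurable_traj hπ t)).prodMk
    (Seed.measurable_act.comp measurable_snd)))

theorem measurable_ret (B : BlockMDP S A X N H) (hπ : MeasurableFamily π) :
    Measurable fun p : Θ × Seed S A X N => B.ret (π p.1) p.2 := by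
  refine Finset.measurable_sum _ fun t _ => ?_
  exact (measurable_of_countable fun p : S × A => B.latent.R t p.1 p.2).comp
    ((measurable_fst.comp (B.measurable_traj hπ t)).prodMk (B.measurable_action hπ t))

theorem measurable_obs₀ (B : BlockMDP S A X N H) : Measurable (B.obs₀ (A := A)) :=
  measurable_eval (f := fun w : Seed S A X N => fun s => w.emit 0 s)
    (fun s => Seed.measurable_emit 0 s)
    ((measurable_of_countable B.latent.start).comp Seed.measurable_idx)

end Measurability

end BlockMDP

end

noncomputable section

/-! ### Measurability of the memory of the algorithm -/

section ListSpace

variable {X A : Type*} [MeasurableSpace X] [MeasurableSpace A]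

instance : MeasurableSpace (Episode X A) :=
  MeasurableSpace.comap (fun e => (e.obs, e.act, e.ret)) inferInstance

theorem Episode.measurable_data : Measurable fun e : Episode X A => (e.obs, e.act, e.ret) :=
  comap_measurable _

theorem Episode.measurable_obs (t : ℕ) : Measurable fun e : Episode X A => e.obs t :=
  (measurable_pi_apply t).comp (measurable_fst.comp Episode.measurable_data)

theorem Episode.measurable_act (t : ℕ) : Measurable fun e : Episode X A => e.act t :=
  (measurable_pi_apply t).comp
    (measurable_fst.comp (measurable_snd.comp Episode.measurable_data))

theorem Episode.measurable_ret : Measurable fun e : Episode X A => e.ret :=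
  measurable_snd.comp (measurable_snd.comp Episode.measurable_data)

variable [Nonempty X] [Nonempty A]

/-- Length and padded entries are all that the algorithm ever reads from a memory, so they may
generate the σ-algebra. -/
instance : MeasurableSpace (List (Episode X A)) :=
  MeasurableSpace.comap (fun m => (m.length, fun k : ℕ => m.getD k default)) inferInstance

theorem measurable_length : Measurable (List.length : List (Episode X A) → ℕ) :=
  measurable_fst.comp (comap_measurable fun m : List (Episode X A) =>
    (m.length, fun k : ℕ => m.getD k default))

theorem measurable_getD (k : ℕ) :
    Measurable fun m : List (Episode X A) => m.getD k default :=
  (measurable_pi_apply k).comp (measurable_snd.comp (comap_measurable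
    fun m : List (Episode X A) => (m.length, fun k : ℕ => m.getD k default)))

theorem measurable_append_singleton {Ω : Type*} [MeasurableSpace Ω]
    {f : Ω → List (Episode X A)} {g : Ω → Episode X A} (hf : Measurable f) (hg : Measurable g) :
    Measurable fun ω => f ω ++ [g ω] := by
  refine measurable_comap_iff.2 (Measurable.prodMk ?_ (measurable_pi_lambda _ fun k => ?_))
  · have : (fun ω => (f ω ++ [g ω]).length) = fun ω => (f ω).length + 1 := by
      funext ω; simp
    exact this ▸ (measurable_of_countable (· + 1)).comp (measurable_length.comp hf)
  · have h : (fun ω => (f ω ++ [g ω]).getD k default) = fun ω =>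
        if k < (f ω).length then (f ω).getD k default
        else if k = (f ω).length then g ω else default := by
      funext ω
      split_ifs with h1 h2
      · exact List.getD_append _ _ _ _ h1
      · rw [List.getD_append_right _ _ _ _ (by omega), h2]; simp
      · rw [List.getD_append_right _ _ _ _ (by omega)]
        have : k - (f ω).length = (k - (f ω).length - 1) + 1 := by omega
        rw [this]; simp
    change Measurable fun ω => (f ω ++ [g ω]).getD k default
    rw [h]
    have hl : Measurable fun ω => (f ω).length := measurable_length.comp hf
    exact Measurable.ite (hl (measurableSet_Ioi (a := k)))
      ((measurable_getD k).comp hf)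
      (Measurable.ite (by simpa [eq_comm, Set.preimage] using hl (measurableSet_singleton k)) hg
        measurable_const)

end ListSpace

theorem measurable_episode {S A X : Type*} {N H : ℕ} [Fintype S] [MeasurableSpace S]
    [MeasurableSingletonClass S] [Fintype A] [Nonempty A] [MeasurableSpace A]
    [MeasurableSingletonClass A] [MeasurableSpace X] {Θ : Type*} [MeasurableSpace Θ]
    {π : Θ → Policy X A} (B : BlockMDP S A X N H) (hπ : BlockMDP.MeasurableFamily π) :
    Measurable fun p : Θ × Seed S A X N => B.episode (π p.1) p.2 :=
  measurable_comap_iff.2 <|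
    (measurable_pi_lambda _ fun t => B.measurable_obs hπ t).prodMk <|
      (measurable_pi_lambda _ fun t => B.measurable_action hπ t).prodMk (B.measurable_ret hπ)

namespace Learner

variable {S A X ι : Type*} {N : ℕ}

/-- The classes, oracles and tie-breaking rules of the learner are measurable. -/
structure IsMeasurable [MeasurableSpace X] [MeasurableSpace A] (L : Learner S A X ι N) : Prop where
  F : ∀ j a, Measurable fun p : X × X => L.F j p.1 p.2 a
  mle : ∀ n j, MeasurableSet (L.mle n ⁻¹' {j})
  selA : ∀ a, MeasurableSet (L.selA ⁻¹' {a})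
  selN : ∀ i, MeasurableSet (L.selN ⁻¹' {i})

/-- The member of the class fitted to the `h`-th batch of learning episodes. -/
def index (L : Learner S A X ι N) (rec : ℕ → Episode X A) (h : ℕ) : ι :=
  L.mle L.nD fun r : Fin L.nD =>
    ((rec (h * L.nD + r)).obs h, (rec (h * L.nD + r)).act h, (rec (h * L.nD + r)).obs (h + 1))

/-- The action decoder given by the members `J h` of the class. -/
def decoder (L : Learner S A X ι N) (J : ℕ → ι) (h : ℕ) (x x' : X) : A :=
  L.selA (L.F (J h) x x')

/-- The policy that imitates `ρ` from initial state `j` with action decoder `J`. -/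
def imitate (L : Learner S A X ι N) (J : ℕ → ι) (j : Fin N) : Policy X A :=
  fun t x _ => L.ρ t (L.decode (L.decoder J) (L.start j) t x)

/-- The policy that imitates `ρ` before step `h` and then takes the random action. -/
def probe (L : Learner S A X ι N) (J : ℕ → ι) (j : Fin N) (h : ℕ) : Policy X A :=
  fun t x u => if t < h then L.imitate J j t x u else u

section Measurability

variable [Finite S] [MeasurableSpace S] [MeasurableSingletonClass S] [Finite A]
  [MeasurableSpace A] [MeasurableSingletonClass A] [MeasurableSpace X] [Finite ι]
  {L : Learner S A X ι N} {Θ : Type*} [MeasurableSpace Θ]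

theorem measurable_decode {α : Θ → ℕ → X → X → A}
    (hα : ∀ h, Measurable fun p : Θ × X × X => α p.1 h p.2.1 p.2.2) (s : S) (t : ℕ) :
    Measurable fun p : Θ × (Fin (t + 1) → X) => L.decode (α p.1) s t p.2 := by
  induction t with
  | zero => exact measurable_const
  | succ t ih =>
    refine (measurable_of_countable fun p : S × A => L.next t p.1 p.2).comp
      (Measurable.prodMk ?_ ?_)
    · exact ih.comp (measurable_fst.prodMk
        (measurable_pi_lambda _ fun i => (measurable_pi_apply _).comp measurable_snd))
    · have hx : ∀ i, Measurable fun p : Θ × (Fin (t + 1 + 1) → X) => p.2 i := fun i =>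
        (measurable_pi_apply i).comp measurable_snd
      exact (hα t).comp (measurable_fst.prodMk ((hx _).prodMk (hx _)))

theorem measurableSet_index (hL : L.IsMeasurable) {rec : Θ → ℕ → Episode X A}
    (hr : ∀ k, Measurable fun θ => rec θ k) (h : ℕ) (j : ι) :
    MeasurableSet {θ | L.index (rec θ) h = j} := by
  have hd : Measurable fun θ => fun r : Fin L.nD => ((rec θ (h * L.nD + r)).obs h,
      (rec θ (h * L.nD + r)).act h, (rec θ (h * L.nD + r)).obs (h + 1)) :=
    measurable_pi_lambda _ fun r => ((Episode.measurable_obs h).comp (hr _)).prodMk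
      (((Episode.measurable_act h).comp (hr _)).prodMk ((Episode.measurable_obs _).comp (hr _)))
  exact hd (hL.mle _ j)

theorem measurable_selA_F (hL : L.IsMeasurable) (j : ι) :
    Measurable fun p : X × X => L.selA (L.F j p.1 p.2) := by
  have h1 : Measurable L.selA := measurable_to_countable' hL.selA
  exact h1.comp (measurable_pi_lambda _ fun a => hL.F j a)

theorem measurable_shadow (hL : L.IsMeasurable) {rec : Θ → ℕ → Episode X A}
    (hr : ∀ k, Measurable fun θ => rec θ k) (h : ℕ) :
    Measurable fun p : Θ × X × X => L.shadow (rec p.1) h p.2.1 p.2.2 := by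
  let : MeasurableSpace ι := ⊤
  have hi : Measurable fun p : Θ × X × X => L.index (rec p.1) h :=
    (measurable_to_countable' (measurableSet_index hL hr h)).comp measurable_fst
  exact measurable_eval (f := fun (p : Θ × X × X) j => L.selA (L.F j p.2.1 p.2.2))
    (fun j => (measurable_selA_F hL j).comp measurable_snd) hi

theorem measurableFamily_learned (hL : L.IsMeasurable) {rec : Θ → ℕ → Episode X A}
    (hr : ∀ k, Measurable fun θ => rec θ k) (j : Fin N) :
    BlockMDP.MeasurableFamily fun θ => L.learned (rec θ) j := fun t =>
  (measurable_of_countable (L.ρ t)).comp <|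
    (measurable_decode (α := fun θ => L.shadow (rec θ)) (measurable_shadow hL hr)
      (L.start j) t).comp (measurable_fst.prodMk (measurable_fst.comp measurable_snd))

theorem measurableFamily_explore (hL : L.IsMeasurable) {rec : Θ → ℕ → Episode X A}
    (hr : ∀ k, Measurable fun θ => rec θ k) (j : Fin N) (h : ℕ) :
    BlockMDP.MeasurableFamily fun θ => L.explore (rec θ) j h := by
  intro t
  by_cases ht : t < h
  · simpa only [explore, if_pos ht] using measurableFamily_learned hL hr j t
  · simp only [explore, if_neg ht]; fun_prop

theorem measurableFamily_imitate (hL : L.IsMeasurable) (J : ℕ → ι) (j : Fin N) :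
    BlockMDP.MeasurableFamily fun _ : Θ => L.imitate J j := fun t =>
  (measurable_of_countable (L.ρ t)).comp <|
    (measurable_decode (α := fun _ : Θ => L.decoder J)
      (fun h => (measurable_selA_F hL (J h)).comp measurable_snd) (L.start j) t).comp
      (measurable_fst.prodMk (measurable_fst.comp measurable_snd))

theorem measurableFamily_probe (hL : L.IsMeasurable) (J : ℕ → ι) (j : Fin N) (h : ℕ) :
    BlockMDP.MeasurableFamily fun _ : Θ => L.probe J j h := by
  intro t
  by_cases ht : t < h
  · simpa only [probe, if_pos ht] using measurableFamily_imitate hL J j t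
  · simp only [probe, if_neg ht]; fun_prop

variable [Nonempty X] [Nonempty A]

theorem measurable_block (L : Learner S A X ι N) (j : Fin N) (k : ℕ) :
    Measurable fun m : List (Episode X A) => L.block m j k :=
  measurable_getD _

theorem measurable_testValue (L : Learner S A X ι N) (j : Fin N) :
    Measurable fun m : List (Episode X A) => L.testValue m j :=
  (Finset.measurable_sum _ fun k _ =>
    Episode.measurable_ret.comp (L.measurable_block j (L.nl + k))).div_const _

/-- The policy that follows `n` episodes, with the data in `m`. -/
def policyAt (L : Learner S A X ι N) (m : List (Episode X A)) (n : ℕ) : Policy X A :=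
  if hk : n / (L.nl + L.nt) < N then
    let j : Fin N := ⟨n / (L.nl + L.nt), hk⟩
    let r := n % (L.nl + L.nt)
    if r < L.nl then L.explore (L.block m j) j (r / L.nD) else L.learned (L.block m j) j
  else
    let j := L.selN (L.testValue m)
    L.learned (L.block m j) j

theorem measurableFamily_policyAt (hL : L.IsMeasurable) (n : ℕ) :
    BlockMDP.MeasurableFamily fun m : List (Episode X A) => L.policyAt m n := by
  intro t
  have hb := L.measurable_block (X := X) (A := A)
  unfold policyAt
  by_cases hk : n / (L.nl + L.nt) < N
  · simp only [dif_pos hk]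
    by_cases hr : n % (L.nl + L.nt) < L.nl
    · simpa only [if_pos hr] using measurableFamily_explore hL (hb _) _ _ t
    · simpa only [if_neg hr] using measurableFamily_learned hL (hb _) _ t
  · simp only [dif_neg hk]
    have hs : Measurable fun m : List (Episode X A) => L.selN (L.testValue m) :=
      (measurable_to_countable' hL.selN).comp
        (measurable_pi_lambda _ fun j => L.measurable_testValue j)
    exact measurable_eval (f := fun (p : List (Episode X A) × (Fin (t + 1) → X) × A) j =>
      L.learned (L.block p.1 j) j t p.2.1 p.2.2)
      (fun j => measurableFamily_learned hL (hb j) j t) (hs.comp measurable_fst)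

/-- For a fixed number `n` of past episodes the schedule in `policyAt` is a constant; the length of
the memory is substituted for `n` only afterwards, as a measurable point of a countable type. -/
theorem measurableFamily_policy (hL : L.IsMeasurable) :
    BlockMDP.MeasurableFamily fun m : List (Episode X A) => L.policy m := by
  intro t
  have h : ∀ m : List (Episode X A), L.policy m = L.policyAt m m.length := fun _ => rfl
  simp only [h]
  have hn : ∀ n : ℕ, Measurable fun p : List (Episode X A) × (Fin (t + 1) → X) × A =>
      (fun n => L.policyAt p.1 n t p.2.1 p.2.2) n := fun n => measurableFamily_policyAt hL n t
  have key := measurable_eval hn (measurable_length.comp measurable_fst)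
  exact key

end Measurability

/-! ### Bad events in the adaptive memory of a cluster -/

section Memory

variable [Fintype S] [MeasurableSpace S] [MeasurableSingletonClass S] [Fintype A]
  [MeasurableSpace A] [MeasurableSingletonClass A] [MeasurableSpace X] [Finite ι]
  [Nonempty X] [Nonempty A] {L : Learner S A X ι N} {H : ℕ}

theorem memory_succ (L : Learner S A X ι N) (B : BlockMDP S A X N H) (φ : X → Fin N)
    (ω : ℕ → Seed S A X N) (e : ℕ) (i : Fin N) :
    L.memory B φ ω (e + 1) i = if φ (B.obs₀ (ω e)) = i then
      L.memory B φ ω e i ++ [B.episode (L.policy (L.memory B φ ω e i)) (ω e)]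
    else L.memory B φ ω e i := by
  simp only [memory]
  split_ifs with h
  · subst h; simp
  · rw [Function.update_of_ne (Ne.symm h)]

/-- Episode `e` is still unused when its policy is chosen, which is what allows its seed to be
redrawn. -/
theorem memory_congr (L : Learner S A X ι N) (B : BlockMDP S A X N H) (φ : X → Fin N)
    {ω ω' : ℕ → Seed S A X N} (e : ℕ) (h : ∀ k < e, ω k = ω' k) :
    L.memory B φ ω e = L.memory B φ ω' e := by
  induction e with
  | zero => rfl
  | succ e ih =>
    funext i
    rw [memory_succ, memory_succ, ih fun k hk => h k (by omega), h e (by omega)]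

theorem measurable_memory (hL : L.IsMeasurable) (B : BlockMDP S A X N H) {φ : X → Fin N}
    (hφ : Measurable φ) (e : ℕ) (i : Fin N) :
    Measurable fun ω => L.memory B φ ω e i := by
  induction e generalizing i with
  | zero => exact measurable_const
  | succ e ih =>
    simp only [memory_succ]
    refine Measurable.ite ?_ ?_ (ih i)
    · exact (hφ.comp (B.measurable_obs₀.comp (measurable_pi_apply e)))
        (measurableSet_singleton i)
    · exact measurable_append_singleton (ih i)
        ((measurable_episode B (measurableFamily_policy hL)).comp
          ((ih i).prodMk (measurable_pi_apply e)))

/-- The probability that the memory of a cluster gets into `Bad` with `n` more episodes, drawn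
independently from `ν`. -/
def badProb (L : Learner S A X ι N) (B : BlockMDP S A X N H) (ν : Measure (Seed S A X N))
    (Bad : Set (List (Episode X A))) : ℕ → List (Episode X A) → ℝ≥0∞
  | 0, m => Bad.indicator 1 m
  | n + 1, m => ∫⁻ w, badProb L B ν Bad n (m ++ [B.episode (L.policy m) w]) ∂ν

/-- A null event conditions to the zero measure, so total mass at most one is all that holds in
general; with this convention the supermartingale argument needs no positivity of the cluster. -/
theorem lintegral_cond_le {Ω : Type*} [MeasurableSpace Ω] (P : Measure Ω) (C : Set Ω)
    (c : ℝ≥0∞) : ∫⁻ _, c ∂P[|C] ≤ c := by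
  rw [lintegral_const]
  calc c * P[|C] Set.univ ≤ c * 1 := by
        gcongr
        rw [ProbabilityTheory.cond, Measure.smul_apply, Measure.restrict_apply_univ]
        exact ENNReal.inv_mul_le_one _
    _ = c := mul_one c

theorem setLIntegral_eq_cond {Ω : Type*} [MeasurableSpace Ω] (P : Measure Ω) [IsFiniteMeasure P]
    (C : Set Ω) (f : Ω → ℝ≥0∞) : ∫⁻ w in C, f w ∂P = P C * ∫⁻ w, f w ∂P[|C] := by
  by_cases h0 : P C = 0
  · rw [h0, zero_mul, Measure.restrict_eq_zero.2 h0, lintegral_zero_measure]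
  · rw [ProbabilityTheory.cond, lintegral_smul_measure, smul_eq_mul, ← mul_assoc,
      ENNReal.mul_inv_cancel h0 (measure_ne_top _ _), one_mul]

variable (L) in
-- A bound that is uniform in the first `a` episodes survives averaging over them. Each batch can
-- thus be analysed with everything before it frozen.
theorem badProb_add_le (B : BlockMDP S A X N H) {P : Measure (Seed S A X N)}
    {C : Set (Seed S A X N)} {Bad : Set (List (Episode X A))} {a b : ℕ} {c : ℝ≥0∞}
    (h : ∀ m, m.length = a → L.badProb B P[|C] Bad b m ≤ c) :
    L.badProb B P[|C] Bad (a + b) [] ≤ c := by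
  have key : ∀ k m, m.length + k = a → L.badProb B P[|C] Bad (k + b) m ≤ c := by
    intro k
    induction k with
    | zero => intro m hm; rw [zero_add]; exact h m (by simpa using hm)
    | succ k ih =>
      intro m hm
      rw [Nat.add_right_comm]
      simp only [badProb]
      refine (lintegral_mono fun w => ih _ ?_).trans (lintegral_cond_le P C c)
      simp; omega
  exact key a [] (by simp)

variable (L) in
-- The common Chernoff argument for fits and tests, with a union bound over `s`. The products of `ψ
-- f` dominate the indicator of `Bad`, and integrating out one episode at a time, the last one
-- first, replaces each factor by `c f`. The predicate `good` holds almost surely and carries what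
-- the domination needs.
theorem badProb_le_sum_pow (B : BlockMDP S A X N H) {ν : Measure (Seed S A X N)}
    {Bad : Set (List (Episode X A))} {b : ℕ} (m : List (Episode X A)) {ζ : Type*} (s : Finset ζ)
    (ψ : ζ → Episode X A → ℝ≥0∞) (good : Episode X A → Prop) (c : ζ → ℝ≥0∞)
    (hbad : ∀ l : List (Episode X A), l.length = b → (∀ x ∈ l, good x) → m ++ l ∈ Bad →
      1 ≤ ∑ f ∈ s, (l.map (ψ f)).prod)
    (hgood : ∀ l : List (Episode X A), l.length < b →
      ∀ᵐ w ∂ν, good (B.episode (L.policy (m ++ l)) w))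
    (hm : ∀ l : List (Episode X A), l.length < b → ∀ f ∈ s,
      Measurable fun w => ψ f (B.episode (L.policy (m ++ l)) w))
    (hψ : ∀ l : List (Episode X A), l.length < b → ∀ f ∈ s,
      ∫⁻ w, ψ f (B.episode (L.policy (m ++ l)) w) ∂ν ≤ c f) :
    L.badProb B ν Bad b m ≤ ∑ f ∈ s, c f ^ b := by
  have key : ∀ k (l : List (Episode X A)), l.length + k = b → (∀ x ∈ l, good x) →
      L.badProb B ν Bad k (m ++ l) ≤ ∑ f ∈ s, (l.map (ψ f)).prod * c f ^ k := by
    intro k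
    induction k with
    | zero =>
      intro l hl hg
      simp only [badProb, pow_zero, mul_one]
      by_cases hmem : m ++ l ∈ Bad
      · rw [Set.indicator_of_mem hmem]; exact hbad l (by simpa using hl) hg hmem
      · rw [Set.indicator_of_notMem hmem]; exact zero_le
    | succ k ih =>
      intro l hl hg
      have hlt : l.length < b := by omega
      calc L.badProb B ν Bad (k + 1) (m ++ l)
          = ∫⁻ w, L.badProb B ν Bad k (m ++ (l ++ [B.episode (L.policy (m ++ l)) w])) ∂ν := by
            simp only [badProb, List.append_assoc]
        _ ≤ ∫⁻ w, ∑ f ∈ s, (l.map (ψ f)).prod * c f ^ k *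
              ψ f (B.episode (L.policy (m ++ l)) w) ∂ν := by
            refine lintegral_mono_ae ?_
            filter_upwards [hgood l hlt] with w hw
            refine (ih _ (by simp; omega) ?_).trans_eq ?_
            · intro x hx
              rcases List.mem_append.1 hx with h | h
              · exact hg x h
              · rw [List.mem_singleton.1 h]; exact hw
            · refine Finset.sum_congr rfl fun f _ => ?_
              simp; ring
        _ = ∑ f ∈ s, (l.map (ψ f)).prod * c f ^ k *
              ∫⁻ w, ψ f (B.episode (L.policy (m ++ l)) w) ∂ν := by
            rw [lintegral_finsetSum' _ fun f hf => ((hm l hlt f hf).const_mul _).aemeasurable]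
            exact Finset.sum_congr rfl fun f hf => lintegral_const_mul _ (hm l hlt f hf)
        _ ≤ ∑ f ∈ s, (l.map (ψ f)).prod * c f ^ (k + 1) := by
            refine Finset.sum_le_sum fun f hf => ?_
            rw [pow_succ, ← mul_assoc]
            gcongr
            exact hψ l hlt f hf
  simpa using key b [] (by simp) (by simp)

/-- The probability that the memory of a cluster gets into `Bad` after at least `n` episodes of the
cluster is at most the probability for `n` independent episodes of the cluster. -/
theorem measure_exists_bad_le (hL : L.IsMeasurable) (B : BlockMDP S A X N H) {φ : X → Fin N}
    (hφ : Measurable φ) (i : Fin N) {Bad : Set (List (Episode X A))} (hBad : MeasurableSet Bad)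
    (n : ℕ) (hstable : ∀ m x, n ≤ m.length → (m ++ [x] ∈ Bad ↔ m ∈ Bad)) :
    B.runLaw {ω | ∃ e, n ≤ (L.memory B φ ω e i).length ∧ L.memory B φ ω e i ∈ Bad} ≤
      L.badProb B B.seedLaw[|{w | φ (B.obs₀ w) = i}] Bad n [] := by
  set C : Set (Seed S A X N) := {w | φ (B.obs₀ w) = i}
  have hC : MeasurableSet C := (hφ.comp B.measurable_obs₀) (measurableSet_singleton i)
  set ν := B.seedLaw[|C]
  -- The potential of a memory: the probability of ending up in `Bad` once the cluster has `n`
  -- episodes, and the plain indicator from then on.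
  set U : List (Episode X A) → ℝ≥0∞ := fun m =>
    if m.length ≤ n then L.badProb B ν Bad (n - m.length) m else Bad.indicator 1 m with hU
  have hUge : ∀ m, n ≤ m.length → U m = Bad.indicator 1 m := by
    intro m hm
    rcases hm.eq_or_lt with h | h
    · simp [hU, h, badProb]
    · simp only [hU, not_le.2 h, if_false]
  -- The potential does not increase on average with an episode of the cluster: before time `n` this
  -- is the recursion of `badProb`, afterwards stability makes it constant.
  have hstep : ∀ m, ∫⁻ w, U (m ++ [B.episode (L.policy m) w]) ∂ν ≤ U m := by
    intro m
    by_cases hm : m.length < n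
    · have h1 : n - m.length = (n - (m.length + 1)) + 1 := by omega
      have h2 : m.length + 1 ≤ n := hm
      simp only [hU, hm.le, if_true, List.length_append, List.length_singleton, h2]
      rw [h1]
      exact le_rfl
    · rw [not_lt] at hm
      have h1 : ∀ x, U (m ++ [x]) = U m := by
        intro x
        rw [hUge m hm, hUge _ (by simp; omega)]
        have := hstable m x hm
        by_cases h : m ∈ Bad
        · rw [Set.indicator_of_mem h, Set.indicator_of_mem (this.2 h)]; rfl
        · rw [Set.indicator_of_notMem h, Set.indicator_of_notMem (mt this.1 h)]
      simp only [h1]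
      exact lintegral_cond_le _ _ _
  have hint : ∀ e, ∫⁻ ω, U (L.memory B φ ω e i) ∂B.runLaw ≤ L.badProb B ν Bad n [] := by
    intro e
    induction e with
    | zero =>
      have : IsProbabilityMeasure B.runLaw := by unfold BlockMDP.runLaw; infer_instance
      simp [memory, hU]
    | succ e ih =>
      refine (lintegral_infinitePi_le_update (fun _ : ℕ => B.seedLaw) e _).trans
        (le_trans (lintegral_mono fun ω => ?_) ih)
      have hmem : ∀ w, L.memory B φ (Function.update ω e w) e = L.memory B φ ω e := fun w =>
        memory_congr L B φ e fun k hk => Function.update_of_ne (by omega) _ _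
      simp only [memory_succ, hmem, Function.update_self]
      set m := L.memory B φ ω e i
      -- Episodes of other clusters leave the memory as it is; those of the cluster follow the
      -- conditional law.
      rw [← lintegral_add_compl _ hC]
      calc _ = ∫⁻ w in C, U (m ++ [B.episode (L.policy m) w]) ∂B.seedLaw +
            ∫⁻ w in Cᶜ, U m ∂B.seedLaw := by
            congr 1
            · exact setLIntegral_congr_fun hC fun w hw => by
                simp only [show φ (B.obs₀ w) = i from hw, if_true]
            · exact setLIntegral_congr_fun hC.compl fun w hw => by
                simp only [show ¬ φ (B.obs₀ w) = i from hw, if_false]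
        _ ≤ B.seedLaw C * U m + U m * B.seedLaw Cᶜ := by
            rw [setLIntegral_eq_cond, setLIntegral_const]
            gcongr
            exact hstep m
        _ = U m := by
            rw [mul_comm, ← mul_add, measure_add_measure_compl hC, measure_univ, mul_one]
  have hsets : {ω | ∃ e, n ≤ (L.memory B φ ω e i).length ∧ L.memory B φ ω e i ∈ Bad} =
      ⋃ e, {ω | n ≤ (L.memory B φ ω e i).length ∧ L.memory B φ ω e i ∈ Bad} := by
    ext ω; simp
  -- By stability a bad memory of length at least `n` stays bad. The events therefore increase with
  -- `e`, and their union costs a supremum instead of a sum.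
  have hmono : Monotone fun e =>
      {ω | n ≤ (L.memory B φ ω e i).length ∧ L.memory B φ ω e i ∈ Bad} := by
    refine monotone_nat_of_le_succ fun e ω hω => ?_
    simp only [Set.mem_ofPred_eq, memory_succ] at hω ⊢
    split_ifs
    · refine ⟨by simp; omega, (hstable _ _ hω.1).2 hω.2⟩
    · exact hω
  rw [hsets, hmono.measure_iUnion]
  refine iSup_le fun e => le_trans ?_ (hint e)
  have hme := measurable_memory hL B hφ e i
  have hms : MeasurableSet {ω | n ≤ (L.memory B φ ω e i).length ∧ L.memory B φ ω e i ∈ Bad} :=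
    ((measurable_length.comp hme) (measurableSet_Ici (a := n))).inter (hme hBad)
  rw [← lintegral_indicator_one hms]
  refine lintegral_mono fun ω => ?_
  by_cases h : ω ∈ {ω | n ≤ (L.memory B φ ω e i).length ∧ L.memory B φ ω e i ∈ Bad}
  · rw [Set.indicator_of_mem h, hUge _ h.1, Set.indicator_of_mem h.2]; rfl
  · rw [Set.indicator_of_notMem h]; exact zero_le

end Memory

end Learner

end

noncomputable section

/-! ### Deterministic simulators and their perturbations -/

namespace MDP

variable {S A : Type*} {N H : ℕ}

theorem IsDeterministic.T_nextState [Fintype S] {M : MDP S A N H} (hM : M.IsDeterministic) {h : ℕ}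
    (hh : h < H) (s : S) (a : A) : M.T h s a (M.nextState h s a) = 1 := by
  have e : ∃ s', M.T h s a s' = 1 := by
    by_contra hne
    push Not at hne
    have h0 : ∀ s', M.T h s a s' = 0 := fun s' => (hM h hh s a s').resolve_right (hne s')
    simpa [h0] using sum_pmf (M.T h s a)
  rw [nextState, dif_pos e]
  exact e.choose_spec

theorem IsDeterministic.prob_eq_zero [Fintype S] {M : MDP S A N H} (hM : M.IsDeterministic)
    {h : ℕ} (hh : h < H) {s s' : S} {a : A} (hne : M.nextState h s a ≠ s') :
    M.prob h s a s' = 0 := by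
  classical
  have h1 := hM.T_nextState hh s a
  have hsum := sum_pmf (M.T h s a)
  rw [← Finset.add_sum_erase _ _ (Finset.mem_univ (M.nextState h s a)), h1] at hsum
  have h2 : ∑ x ∈ Finset.univ.erase (M.nextState h s a), M.T h s a x = 0 :=
    (ENNReal.add_right_inj ENNReal.one_ne_top).1 (hsum.trans (add_zero 1).symm)
  have h3 := (Finset.sum_eq_zero_iff.1 h2) s' (Finset.mem_erase.2 ⟨hne.symm, Finset.mem_univ _⟩)
  rw [prob, h3, ENNReal.toReal_zero]

theorem IsDeterministic.prob_nextState [Fintype S] {M : MDP S A N H} (hM : M.IsDeterministic)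
    {h : ℕ} (hh : h < H) (s : S) (a : A) : M.prob h s a (M.nextState h s a) = 1 := by
  rw [prob, hM.T_nextState hh, ENNReal.toReal_one]

variable [Fintype S] [Fintype A] {M M' : MDP S A N H} {η : ℝ}

theorem IsPerturbation.le_prob (hp : IsPerturbation η M M') (hM : M.IsDeterministic) {h : ℕ}
    (hh : h < H) {s s' : S} {a : A} (ha : M.nextState h s a = s') : 1 - η ≤ M'.prob h s a s' := by
  obtain ⟨-, -, ξ, hξ⟩ := hp
  obtain ⟨h1, h2, -⟩ := hξ h hh s a
  rw [h2]
  refine h1.trans ?_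
  have := Finset.single_le_sum (f := fun a' => M.prob h s a' s' * (ξ h s a a').toReal)
    (fun a' _ => mul_nonneg (M.prob_nonneg _ _ _ _) ENNReal.toReal_nonneg) (Finset.mem_univ a)
  refine le_trans ?_ this
  subst ha
  simp [hM.prob_nextState hh]

/-- The undistorted successor already takes mass `1 - η`, which leaves at most `η` for any other
state. With `le_prob` this is the margin `1 - 2 * η` between consistent and inconsistent actions. -/
theorem IsPerturbation.prob_le (hp : IsPerturbation η M M') (hM : M.IsDeterministic) {h : ℕ}
    (hh : h < H) {s s' : S} {a : A} (ha : M.nextState h s a ≠ s') : M'.prob h s a s' ≤ η := by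
  have h1 := hp.le_prob hM hh (s := s) (a := a) rfl
  have h2 := M'.sum_prob h s a
  classical
  have h3 : M'.prob h s a (M.nextState h s a) + M'.prob h s a s' ≤ 1 := by
    rw [← h2, ← Finset.sum_pair (f := M'.prob h s a) ha]
    exact Finset.sum_le_sum_of_subset_of_nonneg (Finset.subset_univ _)
      fun i _ _ => M'.prob_nonneg _ _ _ _
  linarith

/-- Noise only exchanges actions, so whatever occurs in the perturbed MDP is explained by some
action of the simulator. Otherwise there would be no right answer for the action decoder. -/
theorem IsPerturbation.exists_nextState (hp : IsPerturbation η M M') (hM : M.IsDeterministic)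
    {h : ℕ} (hh : h < H) {s s' : S} (he : ∃ a, M'.T h s a s' ≠ 0) :
    ∃ a, M.nextState h s a = s' := by
  obtain ⟨a, ha⟩ := he
  by_contra hne
  push Not at hne
  obtain ⟨-, -, ξ, hξ⟩ := hp
  obtain ⟨-, h2, -⟩ := hξ h hh s a
  have h0 := h2 s'
  simp only [fun a' => hM.prob_eq_zero hh (hne a'), zero_mul, Finset.sum_const_zero] at h0
  rcases (ENNReal.toReal_eq_zero_iff _).1 h0 with h' | h'
  · exact ha h'
  · exact (M'.T h s a).apply_ne_top s' h'

end MDP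

/-! ### Affinity of inverse dynamics models -/

/-- Two pairs in opposite order cannot be close: the right side is at least half the square of `(u -
v) + (q - p)`, a sum of two nonnegative numbers. -/
theorem sq_sub_le_of_le {p q u v : ℝ} (hpq : p ≤ q) (hvu : v ≤ u) :
    (u - v) ^ 2 / 2 ≤ (p - u) ^ 2 + (q - v) ^ 2 := by
  nlinarith [sq_nonneg (p - u + (q - v)), mul_nonneg (sub_nonneg.2 hpq) (sub_nonneg.2 hvu),
    sq_nonneg (q - p)]

/-- The worst case is `p = 1 - η`, `q = η`. There `1 - 2 * η` factors as difference times sum of the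
two roots, and the square of the sum is at most `2`. -/
theorem sq_margin_le {η p q : ℝ} (h0 : 0 ≤ η) (h1 : η < 1 / 2) (hp : 1 - η ≤ p)
    (hq : q ≤ η) : (1 - 2 * η) ^ 2 / 2 ≤ (√p - √q) ^ 2 := by
  have hsp : √(1 - η) ≤ √p := Real.sqrt_le_sqrt hp
  have hsq : √q ≤ √η := Real.sqrt_le_sqrt hq
  have hlt : √η ≤ √(1 - η) := Real.sqrt_le_sqrt (by linarith)
  have e1 := Real.sq_sqrt (show (0 : ℝ) ≤ 1 - η by linarith)
  have e2 := Real.sq_sqrt h0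
  set a := √(1 - η)
  set b := √η
  have hb : 0 ≤ b := Real.sqrt_nonneg _
  have h2 : (a - b) ^ 2 ≤ (√p - √q) ^ 2 := by
    apply pow_le_pow_left₀ <;> linarith
  refine le_trans ?_ h2
  have h3 : 1 - 2 * η = (a - b) * (a + b) := by nlinarith
  have h4 : (a + b) ^ 2 ≤ 2 := by nlinarith [sq_nonneg (a - b)]
  rw [h3, mul_pow]
  nlinarith [sq_nonneg (a - b)]

/-- The affinity between `f` and the posterior `p / Z` of the action is bounded away from `Z` if
the action `b` preferred by `f` is not one of the likely ones. -/
theorem sum_mul_sqrt_add_le {A : Type*} [Fintype A] {η : ℝ} (h0 : 0 ≤ η) (h1 : η < 1 / 2)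
    {p f : A → ℝ} (hp : ∀ a, 0 ≤ p a) (hf : ∀ a, 0 ≤ f a) (hf1 : ∑ a, f a = 1)
    (hZ : 0 < ∑ a, p a) {b : A} (hb : ∀ a, f a ≤ f b) {e : Prop} [Decidable e]
    (he : e → p b ≤ η ∧ ∃ a, 1 - η ≤ p a) :
    ∑ a, p a * √(f a / (p a / ∑ a', p a')) + (if e then (1 - 2 * η) ^ 2 / 8 else 0) ≤
      ∑ a, p a := by
  set Z := ∑ a, p a with hZdef
  have hterm : ∀ a, p a * √(f a / (p a / Z)) = √Z * (√(f a) * √(p a)) := by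
    intro a
    rcases (hp a).eq_or_lt with h | h
    · simp [← h]
    · rw [div_div_eq_mul_div, Real.sqrt_div (by have := hf a; positivity),
        Real.sqrt_mul (hf a)]
      have := Real.sq_sqrt (hp a)
      have h2 : √(p a) ≠ 0 := (Real.sqrt_pos.2 h).ne'
      field_simp
      rw [this, mul_comm]
  -- Completing the square: the affinity falls short of `Z` by half the squared distance between the
  -- vectors with entries `√(Z f)` and `√p`.
  have hsq : ∀ a, √Z * (√(f a) * √(p a)) =
      (Z * f a + p a) / 2 - (√Z * √(f a) - √(p a)) ^ 2 / 2 := by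
    intro a
    have e1 := Real.sq_sqrt (hp a)
    have e2 := Real.sq_sqrt (hf a)
    have e3 := Real.sq_sqrt hZ.le
    have : (√Z * √(f a) - √(p a)) ^ 2 = √Z ^ 2 * √(f a) ^ 2 + √(p a) ^ 2 -
      2 * (√Z * (√(f a) * √(p a))) := by ring
    rw [this, e1, e2, e3]; ring
  have hsum : ∑ a, p a * √(f a / (p a / Z)) =
      Z - (∑ a, (√Z * √(f a) - √(p a)) ^ 2) / 2 := by
    simp only [hterm, hsq, Finset.sum_sub_distrib, ← Finset.sum_div, Finset.sum_add_distrib,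
      ← Finset.mul_sum, hf1, ← hZdef]
    ring
  rw [hsum]
  have hnn : ∀ a, 0 ≤ (√Z * √(f a) - √(p a)) ^ 2 := fun a => sq_nonneg _
  split_ifs with hE
  -- The model ranks `b` at least as high as the consistent action `a`, the true weights rank them
  -- the other way round by the margin. These two coordinates alone contribute the loss; three
  -- halvings give the constant `8`.
  · obtain ⟨hpb, a, hpa⟩ := he hE
    have hab : a ≠ b := by rintro rfl; linarith
    classical
    have h2 : (√Z * √(f a) - √(p a)) ^ 2 + (√Z * √(f b) - √(p b)) ^ 2 ≤
        ∑ a, (√Z * √(f a) - √(p a)) ^ 2 := by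
      rw [← Finset.sum_pair (f := fun a => (√Z * √(f a) - √(p a)) ^ 2) hab]
      exact Finset.sum_le_sum_of_subset_of_nonneg (Finset.subset_univ _) fun i _ _ => hnn i
    have h3 := sq_sub_le_of_le (p := √Z * √(f a)) (q := √Z * √(f b)) (u := √(p a)) (v := √(p b))
      (mul_le_mul_of_nonneg_left (Real.sqrt_le_sqrt (hb a)) (Real.sqrt_nonneg _))
      (Real.sqrt_le_sqrt (by linarith))
    have h4 := sq_margin_le h0 h1 hpa hpb
    linarith
  · have := Finset.sum_nonneg fun a (_ : a ∈ Finset.univ) => hnn a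
    linarith

/-! ### One step of an episode of a cluster -/

namespace BlockMDP

variable {S A X : Type*} {N H : ℕ} [Fintype S] [MeasurableSpace S] [MeasurableSingletonClass S]
  [Fintype A] [Nonempty A] [MeasurableSpace A] [MeasurableSingletonClass A] [MeasurableSpace X]

/-- The episodes whose initial observation is put into cluster `i`. -/
def clusterEvent (B : BlockMDP S A X N H) (φ : X → Fin N) (i : Fin N) : Set (Seed S A X N) :=
  {w | φ (B.obs₀ w) = i}

theorem measurableSet_clusterEvent (B : BlockMDP S A X N H) {φ : X → Fin N} (hφ : Measurable φ)
    (i : Fin N) : MeasurableSet (B.clusterEvent (A := A) φ i) :=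
  (hφ.comp B.measurable_obs₀) (measurableSet_singleton i)

theorem lintegral_cond_eq {Ω : Type*} [MeasurableSpace Ω] (P : Measure Ω) {C : Set Ω}
    (hC : MeasurableSet C) (f : Ω → ℝ≥0∞) :
    ∫⁻ w, f w ∂P[|C] = (P C)⁻¹ * ∫⁻ w, C.indicator f w ∂P := by
  rw [ProbabilityTheory.cond, lintegral_smul_measure, lintegral_indicator hC, smul_eq_mul]

/-- The event `C` lies in the past of the step, so its indicator can be absorbed into `G` and the
unconditional formula applies. -/
theorem lintegral_cond_step (B : BlockMDP S A X N H) (t : ℕ) {C : Set (Seed S A X N)}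
    (hC : MeasurableSet C)
    (hCe : ∀ w r e, (w.setTrans t r).setEmit (t + 1) e ∈ C ↔ w ∈ C) {D : Seed S A X N → S}
    {a : Seed S A X N → A} {G : Seed S A X N → S → X → ℝ≥0∞} (hD : Measurable D)
    (ha : Measurable a) (hG : ∀ s', Measurable fun p : Seed S A X N × X => G p.1 s' p.2)
    (hDe : ∀ w r e, D ((w.setTrans t r).setEmit (t + 1) e) = D w)
    (hae : ∀ w r e, a ((w.setTrans t r).setEmit (t + 1) e) = a w)
    (hGe : ∀ w r e, G ((w.setTrans t r).setEmit (t + 1) e) = G w) :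
    ∫⁻ w, G w (w.trans t (D w) (a w)) (w.emit (t + 1) (w.trans t (D w) (a w))) ∂B.seedLaw[|C] =
      ∫⁻ w, ∑ s', B.latent.T t (D w) (a w) s' * ∫⁻ x, G w s' x ∂(B.q s' : Measure X)
        ∂B.seedLaw[|C] := by
  classical
  rw [lintegral_cond_eq _ hC, lintegral_cond_eq _ hC]
  congr 1
  have h := B.lintegral_step t (G := fun w s' x => if w ∈ C then G w s' x else 0) hD ha
    (fun s' => Measurable.ite (measurable_fst hC) (hG s') measurable_const) hDe hae
    (fun w r e => by simp only [hCe, hGe])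
  simp only [Set.indicator]
  refine h.trans (lintegral_congr fun w => ?_)
  split_ifs <;> simp

theorem lintegral_cond_act (B : BlockMDP S A X N H) {C : Set (Seed S A X N)}
    (hC : MeasurableSet C) (hCe : ∀ (w : Seed S A X N) u, w.setAct u ∈ C ↔ w ∈ C)
    {F : Seed S A X N → A → ℝ≥0∞}
    (hF : ∀ u, Measurable fun w => F w u) (hFe : ∀ w u, F (w.setAct u) = F w) :
    ∫⁻ w, F w w.act ∂B.seedLaw[|C] =
      ∫⁻ w, ∑ u, (Fintype.card A : ℝ≥0∞)⁻¹ * F w u ∂B.seedLaw[|C] := by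
  classical
  rw [lintegral_cond_eq _ hC, lintegral_cond_eq _ hC]
  congr 1
  have h := B.lintegral_act (F := fun w u => if w ∈ C then F w u else 0)
    (fun u => Measurable.ite hC (hF u) measurable_const) (fun w u => by simp only [hCe, hFe])
  simp only [Set.indicator]
  refine h.trans (lintegral_congr fun w => ?_)
  split_ifs <;> simp

theorem lintegral_cond_act_step (B : BlockMDP S A X N H) (t : ℕ) {C : Set (Seed S A X N)}
    (hC : MeasurableSet C)
    (hCe : ∀ w r e, (w.setTrans t r).setEmit (t + 1) e ∈ C ↔ w ∈ C)
    (hCa : ∀ (w : Seed S A X N) u, w.setAct u ∈ C ↔ w ∈ C) {D : Seed S A X N → S}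
    {G : Seed S A X N → A → S → X → ℝ≥0∞} (hD : Measurable D)
    (hG : ∀ u s', Measurable fun p : Seed S A X N × X => G p.1 u s' p.2)
    (hDe : ∀ w r e, D ((w.setTrans t r).setEmit (t + 1) e) = D w)
    (hGe : ∀ w r e, G ((w.setTrans t r).setEmit (t + 1) e) = G w)
    (hDa : ∀ (w : Seed S A X N) u, D (w.setAct u) = D w)
    (hGa : ∀ (w : Seed S A X N) u, G (w.setAct u) = G w) :
    ∫⁻ w, G w w.act (w.trans t (D w) w.act) (w.emit (t + 1) (w.trans t (D w) w.act))
        ∂B.seedLaw[|C] =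
      ∫⁻ w, ∑ u, (Fintype.card A : ℝ≥0∞)⁻¹ * ∑ s', B.latent.T t (D w) u s' *
        ∫⁻ x, G w u s' x ∂(B.q s' : Measure X) ∂B.seedLaw[|C] := by
  rw [B.lintegral_cond_step t (G := fun w s' x => G w w.act s' x) hC hCe hD Seed.measurable_act
    (fun s' => measurable_eval (f := fun (p : Seed S A X N × X) u => G p.1 u s' p.2)
      (fun u => hG u s') (Seed.measurable_act.comp measurable_fst)) hDe (fun _ _ _ => rfl)
    (fun w r e => by simp only [hGe]; rfl)]
  refine B.lintegral_cond_act (F := fun w u => ∑ s', B.latent.T t (D w) u s' *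
    ∫⁻ x, G w u s' x ∂(B.q s' : Measure X)) hC hCa (fun u => ?_)
    (fun w u => by simp only [hDa, hGa])
  refine Finset.measurable_sum _ fun s' _ => Measurable.mul ?_ ?_
  · exact (measurable_of_countable fun s => B.latent.T t s u s').comp hD
  · exact (hG u s').lintegral_prod_right'

/-! ### Dependence of trajectories on the randomness -/

theorem traj_congr (B : BlockMDP S A X N H) {π π' : Policy X A} {w w' : Seed S A X N} (t : ℕ)
    (hi : w.idx = w'.idx) (he : ∀ k ≤ t, w.emit k = w'.emit k)
    (hr : ∀ k < t, w.trans k = w'.trans k)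
    (hπ : ∀ k < t, ∀ x, π k x w.act = π' k x w'.act) : B.traj π w t = B.traj π' w' t := by
  induction t with
  | zero => simp only [traj, hi, he 0 le_rfl]
  | succ t ih =>
    have h := ih (fun k hk => he k (by omega)) (fun k hk => hr k (by omega))
      (fun k hk => hπ k (by omega))
    simp only [traj, h, hr t (by omega), he (t + 1) le_rfl, hπ t (by omega)]

theorem traj_congr_policy (B : BlockMDP S A X N H) {π π' : Policy X A} (w : Seed S A X N) (t : ℕ)
    (hπ : ∀ k < t, π k = π' k) : B.traj π w t = B.traj π' w t :=
  B.traj_congr t rfl (fun _ _ => rfl) (fun _ _ => rfl) fun k hk x => by rw [hπ k hk]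

theorem ret_congr (B : BlockMDP S A X N H) {π π' : Policy X A} (hπ : ∀ k < H, π k = π' k)
    (w : Seed S A X N) : B.ret π w = B.ret π' w := by
  refine Finset.sum_congr rfl fun t ht => ?_
  have htH := Finset.mem_range.1 ht
  have h := B.traj_congr_policy w t fun k hk => hπ k (hk.trans htH)
  simp only [action, h, hπ t htH]

theorem clusterValue_congr (B : BlockMDP S A X N H) {π π' : Policy X A}
    (hπ : ∀ k < H, π k = π' k) (φ : X → Fin N) (i : Fin N) :
    B.clusterValue φ i π = B.clusterValue φ i π' := by
  unfold clusterValue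
  simp only [B.ret_congr hπ]

theorem traj_resample (B : BlockMDP S A X N H) (π : Policy X A) (w : Seed S A X N) (t : ℕ)
    (r : S → A → S) (e : S → X) :
    B.traj π ((w.setTrans t r).setEmit (t + 1) e) t = B.traj π w t := by
  refine B.traj_congr t rfl (fun k hk => ?_) (fun k hk => ?_) fun _ _ _ => rfl
  · exact Function.update_of_ne (by omega) _ _
  · exact Function.update_of_ne (by omega) _ _

theorem clusterEvent_resample (B : BlockMDP S A X N H) (φ : X → Fin N) (i : Fin N)
    (w : Seed S A X N) (t : ℕ) (r : S → A → S) (e : S → X) :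
    (w.setTrans t r).setEmit (t + 1) e ∈ B.clusterEvent φ i ↔ w ∈ B.clusterEvent φ i := by
  have : B.obs₀ ((w.setTrans t r).setEmit (t + 1) e) = B.obs₀ w := by
    unfold obs₀ Seed.emit Seed.setEmit Seed.setTrans Seed.idx
    simp
  simp only [clusterEvent, Set.mem_ofPred_eq, this]

theorem clusterEvent_setAct (B : BlockMDP S A X N H) (φ : X → Fin N) (i : Fin N)
    (w : Seed S A X N) (u : A) : w.setAct u ∈ B.clusterEvent φ i ↔ w ∈ B.clusterEvent φ i :=
  Iff.rfl

theorem traj_succ_fst (B : BlockMDP S A X N H) (π : Policy X A) (w : Seed S A X N) (t : ℕ) :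
    (B.traj π w (t + 1)).1 = w.trans t (B.traj π w t).1 (B.action π w t) := rfl

theorem ae_reach (B : BlockMDP S A X N H) (π : Policy X A) :
    ∀ᵐ w ∂B.seedLaw, ∀ t, (B.traj π w t).1 ∈ B.latent.Reach t := by
  filter_upwards [B.ae_idx, B.ae_trans] with w h1 h2 t
  induction t with
  | zero => exact ⟨w.idx, h1, rfl⟩
  | succ t ih => exact ⟨_, ih, _, h2 t _ _⟩

end BlockMDP

end

/-! ### Decoding errors, likelihood ratios and comparison with the benchmark -/

noncomputable section

namespace BlockMDP

variable {S A X : Type*} {N H : ℕ} [Fintype S] [MeasurableSpace S] [MeasurableSingletonClass S]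
  [Fintype A] [Nonempty A] [MeasurableSpace A] [MeasurableSingletonClass A] [MeasurableSpace X]

open Classical in
/-- The mass of the possible next observations at which the action decoder `α` is inconsistent with
the simulator. -/
def errMass (B : BlockMDP S A X N H) (M : MDP S A N H) (h : ℕ) (α : X → X → A) (s : S) (x : X) :
    ℝ≥0∞ :=
  ∑ s', if ∃ a, B.latent.T h s a s' ≠ 0 then
    (B.q s' : Measure X) {x' | M.nextState h s (α x x') ≠ s'} else 0

variable {B : BlockMDP S A X N H} {M : MDP S A N H} {α : X → X → A}

theorem measurableSet_err (hα : Measurable fun p : X × X => α p.1 p.2) (h : ℕ) (s s' : S) :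
    MeasurableSet {p : X × X | M.nextState h s (α p.1 p.2) ≠ s'} :=
  ((measurable_of_countable (M.nextState h s)).comp hα) (measurableSet_singleton s').compl

theorem measurable_errMass (hα : Measurable fun p : X × X => α p.1 p.2) (h : ℕ) :
    Measurable fun p : S × X => B.errMass M h α p.1 p.2 := by
  refine measurable_eval (f := fun (p : S × X) s => B.errMass M h α s p.2) (fun s => ?_)
    measurable_fst
  refine Finset.measurable_sum _ fun s' _ => ?_
  split_ifs
  · exact (measurable_measure_prodMk_left (measurableSet_err hα h s s')).comp measurable_snd
  · exact measurable_const

theorem measurable_errMass_comp {Ω : Type*} [MeasurableSpace Ω]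
    (hα : Measurable fun p : X × X => α p.1 p.2) (h : ℕ) {f : Ω → S} {g : Ω → X}
    (hf : Measurable f) (hg : Measurable g) : Measurable fun w => B.errMass M h α (f w) (g w) := by
  have key := (measurable_errMass (B := B) (M := M) hα h).comp (hf.prodMk hg)
  exact key

/-- The observations at which the inverse dynamics model `f` agrees with the true one. -/
def RealizedAt (B : BlockMDP S A X N H) (f : X → X → A → ℝ) (h : ℕ) (s : S) (x : X) : Prop :=
  ∀ s', (∃ a, B.latent.T h s a s' ≠ 0) → ∀ᵐ x' ∂(B.q s' : Measure X), ∀ a,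
    f x x' a = B.latent.prob h s a s' / ∑ a', B.latent.prob h s a' s'

theorem T_eq_ofReal (B : BlockMDP S A X N H) (h : ℕ) (s : S) (a : A) (s' : S) :
    B.latent.T h s a s' = ENNReal.ofReal (B.latent.prob h s a s') :=
  (ENNReal.ofReal_toReal ((B.latent.T h s a).apply_ne_top s')).symm

/-- For each possible successor, `sum_mul_sqrt_add_le` is integrated over its observations; summing
then uses that transition probabilities add up to one. `errMass` carries no transition weights, so
what is learned under uniform actions transfers to the actions of the learned policy. The price is
the factor `|A|` in the denominator. -/
theorem affinity_add_errMass_le {η : ℝ} (h0 : 0 ≤ η) (h1 : η < 1 / 2) (hM : M.IsDeterministic)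
    (hp : MDP.IsPerturbation η M B.latent) {h : ℕ} (hh : h < H) {f f' : X → X → A → ℝ}
    (hfm : ∀ x a, Measurable fun x' => f x x' a) (hfm' : ∀ x a, Measurable fun x' => f' x x' a)
    (hf : ∀ x x' a, 0 ≤ f x x' a) (hf1 : ∀ x x', ∑ a, f x x' a = 1)
    (hα : Measurable fun p : X × X => α p.1 p.2) (hαf : ∀ x x' a, f x x' a ≤ f x x' (α x x'))
    {s : S} {x : X} (hr : B.RealizedAt f' h s x) :
    ∑ u, (Fintype.card A : ℝ≥0∞)⁻¹ * ∑ s', B.latent.T h s u s' *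
        ∫⁻ x', ENNReal.ofReal √(f x x' u / f' x x' u) ∂(B.q s' : Measure X) +
      ENNReal.ofReal ((1 - 2 * η) ^ 2 / (8 * Fintype.card A)) * B.errMass M h α s x ≤ 1 := by
  classical
  have hA : (0 : ℝ) < Fintype.card A := by exact_mod_cast Fintype.card_pos
  have hinv : (Fintype.card A : ℝ≥0∞)⁻¹ = ENNReal.ofReal (Fintype.card A : ℝ)⁻¹ := by
    rw [ENNReal.ofReal_inv_of_pos hA, ENNReal.ofReal_natCast]
  have hme : ∀ s', MeasurableSet {x' | M.nextState h s (α x x') ≠ s'} := fun s' =>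
    measurable_prodMk_left (measurableSet_err hα h s s')
  have hms : ∀ u, Measurable fun x' => ENNReal.ofReal √(f x x' u / f' x x' u) := fun u =>
    ENNReal.measurable_ofReal.comp (Real.continuous_sqrt.measurable.comp
      ((hfm x u).div (hfm' x u)))
  -- The contribution of one successor `s'`. If no action reaches it, both sides vanish; otherwise
  -- the normalizer `Z` is positive.
  have key : ∀ s', ∑ u, (Fintype.card A : ℝ≥0∞)⁻¹ * (B.latent.T h s u s' *
        ∫⁻ x', ENNReal.ofReal √(f x x' u / f' x x' u) ∂(B.q s' : Measure X)) +
      ENNReal.ofReal ((1 - 2 * η) ^ 2 / (8 * Fintype.card A)) *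
        (if ∃ a, B.latent.T h s a s' ≠ 0 then
          (B.q s' : Measure X) {x' | M.nextState h s (α x x') ≠ s'} else 0) ≤
      ENNReal.ofReal ((Fintype.card A : ℝ)⁻¹ * ∑ u, B.latent.prob h s u s') := by
    intro s'
    split_ifs with hex
    swap
    · push Not at hex
      simp [hex]
    set p : A → ℝ := fun a => B.latent.prob h s a s' with hpdef
    have hp0 : ∀ a, 0 ≤ p a := fun a => B.latent.prob_nonneg _ _ _ _
    have hZ : 0 < ∑ a, p a := by
      obtain ⟨a, ha⟩ := hex
      exact Finset.sum_pos' (fun a _ => hp0 a) ⟨a, Finset.mem_univ _,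
        ENNReal.toReal_pos ha ((B.latent.T h s a).apply_ne_top s')⟩
    have hind : (B.q s' : Measure X) {x' | M.nextState h s (α x x') ≠ s'} =
        ∫⁻ x', (if M.nextState h s (α x x') ≠ s' then 1 else 0) ∂(B.q s' : Measure X) := by
      rw [← lintegral_indicator_one (hme s')]
      exact lintegral_congr fun x' => by simp [Set.indicator]
    have hmi : Measurable fun x' =>
        (if M.nextState h s (α x x') ≠ s' then (1 : ℝ≥0∞) else 0) :=
      Measurable.ite (hme s') measurable_const measurable_const
    rw [hind, ← lintegral_const_mul _ hmi]
    simp only [← mul_assoc]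
    simp only [← lintegral_const_mul _ (hms _)]
    rw [← lintegral_finsetSum _ fun u _ => (hms u).const_mul _,
      ← lintegral_add_right _ (hmi.const_mul _)]
    calc _ ≤ ∫⁻ _, ENNReal.ofReal ((Fintype.card A : ℝ)⁻¹ * ∑ u, p u) ∂(B.q s' : Measure X) := by
          refine lintegral_mono_ae ?_
          filter_upwards [hr s' hex] with x' hx'
          have hineq := sum_mul_sqrt_add_le h0 h1 hp0 (hf x x') (hf1 x x') hZ (hαf x x')
            (e := M.nextState h s (α x x') ≠ s') fun he =>
              ⟨hp.prob_le hM hh he, (hp.exists_nextState hM hh hex).imp fun a ha =>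
                hp.le_prob hM hh ha⟩
          have e1 : ∀ u, (Fintype.card A : ℝ≥0∞)⁻¹ * B.latent.T h s u s' *
              ENNReal.ofReal √(f x x' u / f' x x' u) = ENNReal.ofReal ((Fintype.card A : ℝ)⁻¹ *
                (p u * √(f x x' u / (p u / ∑ a', p a')))) := by
            intro u
            rw [hinv, B.T_eq_ofReal, ← ENNReal.ofReal_mul (by positivity),
              ← ENNReal.ofReal_mul (mul_nonneg (by positivity) (hp0 u)), hx' u, mul_assoc]
          have e2 : ENNReal.ofReal ((1 - 2 * η) ^ 2 / (8 * Fintype.card A)) *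
              (if M.nextState h s (α x x') ≠ s' then 1 else 0) =
              ENNReal.ofReal ((Fintype.card A : ℝ)⁻¹ *
                (if M.nextState h s (α x x') ≠ s' then (1 - 2 * η) ^ 2 / 8 else 0)) := by
            split_ifs
            · rw [mul_one]; congr 1; field_simp
            · simp
          have hnn : 0 ≤ (if M.nextState h s (α x x') ≠ s' then (1 - 2 * η) ^ 2 / 8 else 0) := by
            positivity
          simp only [e1, e2]
          rw [← ENNReal.ofReal_sum_of_nonneg fun u _ => mul_nonneg (by positivity)
            (mul_nonneg (hp0 u) (Real.sqrt_nonneg _)), ← Finset.mul_sum,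
            ← ENNReal.ofReal_add
              (mul_nonneg (by positivity) (Finset.sum_nonneg fun u _ =>
                mul_nonneg (hp0 u) (Real.sqrt_nonneg _))) (by positivity), ← mul_add]
          exact ENNReal.ofReal_le_ofReal (mul_le_mul_of_nonneg_left hineq (by positivity))
      _ = _ := by simp [hpdef]
  calc _ = ∑ s', (∑ u, (Fintype.card A : ℝ≥0∞)⁻¹ * (B.latent.T h s u s' *
        ∫⁻ x', ENNReal.ofReal √(f x x' u / f' x x' u) ∂(B.q s' : Measure X)) +
      ENNReal.ofReal ((1 - 2 * η) ^ 2 / (8 * Fintype.card A)) *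
        (if ∃ a, B.latent.T h s a s' ≠ 0 then
          (B.q s' : Measure X) {x' | M.nextState h s (α x x') ≠ s'} else 0)) := by
        rw [Finset.sum_add_distrib, errMass, Finset.mul_sum, Finset.sum_comm]
        simp only [Finset.mul_sum]
    _ ≤ ∑ s', ENNReal.ofReal ((Fintype.card A : ℝ)⁻¹ * ∑ u, B.latent.prob h s u s') :=
        Finset.sum_le_sum fun s' _ => key s'
    _ = 1 := by
        rw [← ENNReal.ofReal_sum_of_nonneg fun s' _ => mul_nonneg (by positivity)
          (Finset.sum_nonneg fun u _ => B.latent.prob_nonneg _ _ _ _), ← Finset.mul_sum,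
          Finset.sum_comm]
        simp only [MDP.sum_prob]
        simp [hA.ne']

theorem measurable_traj_of_policy (B : BlockMDP S A X N H) {π : Policy X A}
    (hπ : MeasurableFamily fun _ : Unit => π) (t : ℕ) : Measurable fun w => B.traj π w t :=
  (B.measurable_traj hπ t).comp (measurable_prodMk_left (x := ()))

theorem measurable_obs_of_policy (B : BlockMDP S A X N H) {π : Policy X A}
    (hπ : MeasurableFamily fun _ : Unit => π) (t : ℕ) : Measurable fun w => B.obs π w t :=
  (measurable_pi_apply _).comp (measurable_snd.comp (B.measurable_traj_of_policy hπ t))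

theorem measurable_action_of_policy (B : BlockMDP S A X N H) {π : Policy X A}
    (hπ : MeasurableFamily fun _ : Unit => π) (t : ℕ) : Measurable fun w => B.action π w t :=
  (B.measurable_action hπ t).comp (measurable_prodMk_left (x := ()))

theorem measurable_ret_of_policy (B : BlockMDP S A X N H) {π : Policy X A}
    (hπ : MeasurableFamily fun _ : Unit => π) : Measurable fun w => B.ret π w :=
  (B.measurable_ret hπ).comp (measurable_prodMk_left (x := ()))

theorem measurable_episode_of_policy (B : BlockMDP S A X N H) {π : Policy X A}
    (hπ : MeasurableFamily fun _ : Unit => π) : Measurable fun w => B.episode π w :=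
  (measurable_episode B hπ).comp (measurable_prodMk_left (x := ()))

theorem ret_mem (B : BlockMDP S A X N H) (π : Policy X A) (w : Seed S A X N) :
    B.ret π w ∈ Set.Icc (0 : ℝ) H := by
  constructor
  · exact Finset.sum_nonneg fun t _ => (B.latent.R_mem _ _ _).1
  · calc B.ret π w ≤ ∑ t ∈ Finset.range H, (1 : ℝ) :=
        Finset.sum_le_sum fun t _ => (B.latent.R_mem _ _ _).2
      _ = H := by simp

/-- An exceptional null set for every state separately is enough, because a seed contains the
emissions of all states and almost surely all of them are typical at once. -/
theorem ae_realizedAt (B : BlockMDP S A X N H) {f : X → X → A → ℝ} {h : ℕ}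
    (hf : ∀ s ∈ B.latent.Reach h, ∀ s', (∃ a, B.latent.T h s a s' ≠ 0) →
      ∀ᵐ x ∂(B.q s : Measure X), ∀ᵐ x' ∂(B.q s' : Measure X), ∀ a,
        f x x' a = B.latent.prob h s a s' / ∑ a', B.latent.prob h s a' s') (π : Policy X A) :
    ∀ᵐ w ∂B.seedLaw, B.RealizedAt f h (B.traj π w h).1 (B.obs π w h) := by
  have h1 : ∀ s, ∀ᵐ x ∂(B.q s : Measure X), s ∈ B.latent.Reach h → B.RealizedAt f h s x := by
    intro s
    by_cases hs : s ∈ B.latent.Reach h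
    · have : ∀ᵐ x ∂(B.q s : Measure X), ∀ s', (∃ a, B.latent.T h s a s' ≠ 0) →
          ∀ᵐ x' ∂(B.q s' : Measure X), ∀ a,
            f x x' a = B.latent.prob h s a s' / ∑ a', B.latent.prob h s a' s' := by
        rw [ae_all_iff]; intro s'
        by_cases he : ∃ a, B.latent.T h s a s' ≠ 0
        · filter_upwards [hf s hs s' he] with x hx _ using hx
        · exact Filter.Eventually.of_forall fun x h' => absurd h' he
      filter_upwards [this] with x hx _ using hx
    · exact Filter.Eventually.of_forall fun x h' => absurd h' hs
  filter_upwards [B.ae_emit h1, B.ae_reach π] with w h2 h3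
  rw [obs_eq_emit]
  exact h2 h _ (h3 h)

theorem ae_cond {P : Measure (Seed S A X N)} (C : Set (Seed S A X N))
    {p : Seed S A X N → Prop} (h : ∀ᵐ w ∂P, p w) : ∀ᵐ w ∂P[|C], p w :=
  cond_absolutelyContinuous.ae_le h

/-- The probability of a decoding error is at most the expected mass of such errors. -/
theorem cond_err_le (hα : Measurable fun p : X × X => α p.1 p.2) {π : Policy X A}
    (hπ : MeasurableFamily fun _ : Unit => π) (hπa : ∀ t x u u', π t x u = π t x u')
    {φ : X → Fin N} (hφ : Measurable φ) (i : Fin N) (h : ℕ) :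
    B.seedLaw[|B.clusterEvent φ i] {w | M.nextState h (B.traj π w h).1
        (α (B.obs π w h) (B.obs π w (h + 1))) ≠ (B.traj π w (h + 1)).1} ≤
      ∫⁻ w, B.errMass M h α (B.traj π w h).1 (B.obs π w h) ∂B.seedLaw[|B.clusterEvent φ i] := by
  classical
  have hT := B.measurable_traj_of_policy hπ
  have hO := B.measurable_obs_of_policy hπ
  have hset : MeasurableSet {w | M.nextState h (B.traj π w h).1
        (α (B.obs π w h) (B.obs π w (h + 1))) ≠ (B.traj π w (h + 1)).1} := by
    refine (measurableSet_eq_fun ?_ (measurable_fst.comp (hT (h + 1)))).compl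
    exact (measurable_of_countable fun p : S × A => M.nextState h p.1 p.2).comp
      ((measurable_fst.comp (hT h)).prodMk (hα.comp ((hO h).prodMk (hO (h + 1)))))
  have hG : ∀ s', Measurable fun p : Seed S A X N × X =>
      (if M.nextState h (B.traj π p.1 h).1 (α (B.obs π p.1 h) p.2) ≠ s' then (1 : ℝ≥0∞) else 0) :=
    fun s' => Measurable.ite
      (measurableSet_eq_fun ((measurable_of_countable fun p : S × A => M.nextState h p.1 p.2).comp
        ((measurable_fst.comp ((hT h).comp measurable_fst)).prodMk
          (hα.comp (((hO h).comp measurable_fst).prodMk measurable_snd))))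
        measurable_const).compl measurable_const measurable_const
  have hobs : ∀ w r e, B.obs π ((w.setTrans h r).setEmit (h + 1) e) h = B.obs π w h :=
    fun w r e => by unfold obs; rw [traj_resample]
  have hstep := B.lintegral_cond_step h (C := B.clusterEvent φ i)
    (B.measurableSet_clusterEvent hφ i) (fun w r e => B.clusterEvent_resample φ i w h r e)
    (D := fun w => (B.traj π w h).1) (a := fun w => B.action π w h)
    (G := fun w s' x' => if M.nextState h (B.traj π w h).1 (α (B.obs π w h) x') ≠ s' then 1 else 0)
    (measurable_fst.comp (hT h)) (B.measurable_action_of_policy hπ h) hG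
    (fun w r e => by simp only [traj_resample])
    (fun w r e => by unfold action; rw [traj_resample]; exact hπa _ _ _ _)
    (fun w r e => by simp only [traj_resample, hobs])
  rw [← lintegral_indicator_one hset]
  calc _ = _ := lintegral_congr fun w => by
        simp only [Set.indicator, Set.mem_ofPred_eq, Pi.one_apply]
        rw [B.obs_eq_emit π w (h + 1), traj_succ_fst]
    _ = _ := hstep
    _ ≤ _ := by
        refine lintegral_mono fun w => Finset.sum_le_sum fun s' _ => ?_
        split_ifs with he
        -- The transition weight is at most one and is dropped; in the other case it is zero.
        · calc _ ≤ 1 * ∫⁻ x, (if M.nextState h (B.traj π w h).1 (α (B.obs π w h) x) ≠ s' then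
                  (1 : ℝ≥0∞) else 0) ∂(B.q s' : Measure X) := by
                gcongr
                exact PMF.coe_le_one _ _
            _ = _ := by
                have hm : MeasurableSet
                    {x' | M.nextState h (B.traj π w h).1 (α (B.obs π w h) x') ≠ s'} :=
                  measurable_prodMk_left (measurableSet_err hα h _ s')
                rw [one_mul, ← lintegral_indicator_one hm]
                exact lintegral_congr fun x' => by simp [Set.indicator]
        · push Not at he
          simp [he]

end BlockMDP

namespace Learner

variable {S A X ι : Type*} {N H : ℕ} [Fintype S] [MeasurableSpace S] [MeasurableSingletonClass S]
  [Fintype A] [Nonempty A] [MeasurableSpace A] [MeasurableSingletonClass A] [MeasurableSpace X]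
  [Finite ι] {L : Learner S A X ι N} {B : BlockMDP S A X N H} {M : MDP S A N H}

theorem traj_probe (J : ℕ → ι) (j : Fin N) (h : ℕ) (w : Seed S A X N) :
    B.traj (L.probe J j h) w h = B.traj (L.imitate J j) w h :=
  B.traj_congr_policy w h fun k hk => by funext x u; simp [probe, hk]

theorem action_probe (J : ℕ → ι) (j : Fin N) (h : ℕ) (w : Seed S A X N) :
    B.action (L.probe J j h) w h = w.act := by
  simp [BlockMDP.action, probe]

theorem traj_imitate_setAct (J : ℕ → ι) (j : Fin N) (h : ℕ) (w : Seed S A X N) (u : A) :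
    B.traj (L.imitate J j) (w.setAct u) h = B.traj (L.imitate J j) w h :=
  B.traj_congr h rfl (fun _ _ => rfl) (fun _ _ => rfl) fun _ _ _ => rfl

/-- The expectation of a function of the transition recorded by the exploring policy of step
`h`. -/
theorem lintegral_probe (hL : L.IsMeasurable) (J : ℕ → ι) (j : Fin N) (h : ℕ) {φ : X → Fin N}
    (hφ : Measurable φ) (i : Fin N) {Ψ : X → A → X → ℝ≥0∞}
    (hΨ : ∀ u, Measurable fun p : X × X => Ψ p.1 u p.2) :
    ∫⁻ w, Ψ (B.obs (L.probe J j h) w h) (B.action (L.probe J j h) w h)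
        (B.obs (L.probe J j h) w (h + 1)) ∂B.seedLaw[|B.clusterEvent φ i] =
      ∫⁻ w, ∑ u, (Fintype.card A : ℝ≥0∞)⁻¹ * ∑ s', B.latent.T h (B.traj (L.imitate J j) w h).1 u s' *
        ∫⁻ x', Ψ (B.obs (L.imitate J j) w h) u x' ∂(B.q s' : Measure X)
          ∂B.seedLaw[|B.clusterEvent φ i] := by
  have hπ := measurableFamily_imitate (Θ := Unit) hL J j
  have hobs : ∀ w r e, B.obs (L.imitate J j) ((w.setTrans h r).setEmit (h + 1) e) h =
      B.obs (L.imitate J j) w h := fun w r e => by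
    unfold BlockMDP.obs; rw [BlockMDP.traj_resample]
  have hobsa : ∀ (w : Seed S A X N) u, B.obs (L.imitate J j) (w.setAct u) h =
      B.obs (L.imitate J j) w h := fun w u => by
    unfold BlockMDP.obs; rw [traj_imitate_setAct]
  rw [← B.lintegral_cond_act_step h (C := B.clusterEvent φ i) (B.measurableSet_clusterEvent hφ i)
    (fun w r e => B.clusterEvent_resample φ i w h r e) (fun w u => B.clusterEvent_setAct φ i w u)
    (D := fun w => (B.traj (L.imitate J j) w h).1)
    (G := fun w u _ x' => Ψ (B.obs (L.imitate J j) w h) u x')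
    (measurable_fst.comp (B.measurable_traj_of_policy hπ h))
    (fun u s' => (hΨ u).comp (((B.measurable_obs_of_policy hπ h).comp measurable_fst).prodMk
      measurable_snd))
    (fun w r e => by simp only [BlockMDP.traj_resample]) (fun w r e => by simp only [hobs])
    (fun w u => by simp only [traj_imitate_setAct]) (fun w u => by simp only [hobsa])]
  refine lintegral_congr fun w => ?_
  rw [B.obs_eq_emit _ w (h + 1), BlockMDP.traj_succ_fst, action_probe, traj_probe]
  have : B.obs (L.probe J j h) w h = B.obs (L.imitate J j) w h := by
    unfold BlockMDP.obs; rw [traj_probe]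
  rw [this]

/-- The expected mass of decoding errors of step `h` in cluster `i`, if the class member `f` is
used at step `h` and the members `J` are used before. -/
def clusterErr (L : Learner S A X ι N) (B : BlockMDP S A X N H) (M : MDP S A N H) (φ : X → Fin N)
    (i : Fin N) (J : ℕ → ι) (j : Fin N) (h : ℕ) (f : ι) : ℝ≥0∞ :=
  ∫⁻ w, B.errMass M h (fun x x' => L.selA (L.F f x x')) (B.traj (L.imitate J j) w h).1
    (B.obs (L.imitate J j) w h) ∂B.seedLaw[|B.clusterEvent φ i]

/-- The likelihood ratio of the recorded transition of step `h`, to the power `1 / 2`. -/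
def rootRatio (L : Learner S A X ι N) (f f' : ι) (h : ℕ) (e : Episode X A) : ℝ≥0∞ :=
  ENNReal.ofReal √(L.F f (e.obs h) (e.obs (h + 1)) (e.act h) /
    L.F f' (e.obs h) (e.obs (h + 1)) (e.act h))

theorem measurable_rootRatio_aux (hL : L.IsMeasurable) (f f' : ι) (u : A) :
    Measurable fun p : X × X => ENNReal.ofReal √(L.F f p.1 p.2 u / L.F f' p.1 p.2 u) :=
  ENNReal.measurable_ofReal.comp (Real.continuous_sqrt.measurable.comp
    ((hL.F f u).div (hL.F f' u)))

theorem measurable_rootRatio (hL : L.IsMeasurable) (f f' : ι) (h : ℕ) :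
    Measurable (L.rootRatio f f' h) :=
  measurable_eval (f := fun (e : Episode X A) u => ENNReal.ofReal
      √(L.F f (e.obs h) (e.obs (h + 1)) u / L.F f' (e.obs h) (e.obs (h + 1)) u))
    (fun u => (measurable_rootRatio_aux hL f f' u).comp
      ((Episode.measurable_obs h).prodMk (Episode.measurable_obs (h + 1))))
    (Episode.measurable_act h)

section Realizable

variable {η : ℝ} {f' : ι} {h : ℕ}

/-- The pointwise affinity bound at the true latent state and observation, averaged over the
cluster. No purity of the cluster and no correctness of the earlier decoders `J` enters. -/
theorem lintegral_rootRatio_add_le (hL : L.IsMeasurable) (h0 : 0 ≤ η) (h1 : η < 1 / 2)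
    (hM : M.IsDeterministic) (hp : MDP.IsPerturbation η M B.latent) (hh : h < H)
    (hF0 : ∀ j x x' a, 0 ≤ L.F j x x' a) (hF1 : ∀ j x x', ∑ a, L.F j x x' a = 1)
    (hsel : ∀ (v : A → ℝ) (a : A), v a ≤ v (L.selA v))
    (hf : ∀ s ∈ B.latent.Reach h, ∀ s', (∃ a, B.latent.T h s a s' ≠ 0) →
      ∀ᵐ x ∂(B.q s : Measure X), ∀ᵐ x' ∂(B.q s' : Measure X), ∀ a,
        L.F f' x x' a = B.latent.prob h s a s' / ∑ a', B.latent.prob h s a' s')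
    {φ : X → Fin N} (hφ : Measurable φ) (i : Fin N) (J : ℕ → ι) (j : Fin N) (f : ι) :
    ∫⁻ w, L.rootRatio f f' h (B.episode (L.probe J j h) w) ∂B.seedLaw[|B.clusterEvent φ i] +
      ENNReal.ofReal ((1 - 2 * η) ^ 2 / (8 * Fintype.card A)) * L.clusterErr B M φ i J j h f
        ≤ 1 := by
  have hα := measurable_selA_F hL f
  have hπ := measurableFamily_imitate (Θ := Unit) hL J j
  have hE : Measurable fun w : Seed S A X N => B.errMass M h (fun x x' => L.selA (L.F f x x'))
      (B.traj (L.imitate J j) w h).1 (B.obs (L.imitate J j) w h) :=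
    BlockMDP.measurable_errMass_comp (α := fun x x' => L.selA (L.F f x x')) hα h
      (measurable_fst.comp (B.measurable_traj_of_policy hπ h)) (B.measurable_obs_of_policy hπ h)
  have e1 := lintegral_probe (B := B) hL J j h hφ i
    (Ψ := fun x u x' => ENNReal.ofReal √(L.F f x x' u / L.F f' x x' u))
    (measurable_rootRatio_aux hL f f')
  unfold clusterErr
  rw [← lintegral_const_mul _ hE]
  change ∫⁻ w, (fun x u x' => ENNReal.ofReal √(L.F f x x' u / L.F f' x x' u))
    (B.obs (L.probe J j h) w h) (B.action (L.probe J j h) w h)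
    (B.obs (L.probe J j h) w (h + 1)) ∂B.seedLaw[|B.clusterEvent φ i] + _ ≤ 1
  rw [e1, ← lintegral_add_right _ (hE.const_mul _)]
  refine (lintegral_mono_ae ?_).trans (lintegral_cond_le B.seedLaw _ 1)
  filter_upwards [BlockMDP.ae_cond _ (B.ae_realizedAt hf (L.imitate J j))] with w hw
  exact BlockMDP.affinity_add_errMass_le (α := fun x x' => L.selA (L.F f x x')) h0 h1 hM hp hh
    (fun x a => (hL.F f a).comp measurable_prodMk_left)
    (fun x a => (hL.F f' a).comp measurable_prodMk_left) (hF0 f) (hF1 f) hα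
    (fun x x' a => hsel _ _) hw

/-- Division by zero is `0` here, so a vanishing true likelihood would spoil the ratio. It does not
occur: an action that produced the observed transition has positive posterior. -/
theorem ae_probe_pos (hL : L.IsMeasurable)
    (hf : ∀ s ∈ B.latent.Reach h, ∀ s', (∃ a, B.latent.T h s a s' ≠ 0) →
      ∀ᵐ x ∂(B.q s : Measure X), ∀ᵐ x' ∂(B.q s' : Measure X), ∀ a,
        L.F f' x x' a = B.latent.prob h s a s' / ∑ a', B.latent.prob h s a' s')
    {φ : X → Fin N} (hφ : Measurable φ) (i : Fin N) (J : ℕ → ι) (j : Fin N) :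
    ∀ᵐ w ∂B.seedLaw[|B.clusterEvent φ i], 0 < L.F f' (B.obs (L.probe J j h) w h)
      (B.obs (L.probe J j h) w (h + 1)) (B.action (L.probe J j h) w h) := by
  classical
  have hms : ∀ u, MeasurableSet {p : X × X | ¬ 0 < L.F f' p.1 p.2 u} := fun u =>
    ((hL.F f' u) measurableSet_Ioi).compl
  have hΨ : ∀ u, Measurable fun p : X × X =>
      (if ¬ 0 < L.F f' p.1 p.2 u then (1 : ℝ≥0∞) else 0) := fun u =>
    Measurable.ite (hms u) measurable_const measurable_const
  have e1 := lintegral_probe (B := B) hL J j h hφ i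
    (Ψ := fun x u x' => if ¬ 0 < L.F f' x x' u then 1 else 0) hΨ
  have hzero : ∫⁻ w, ∑ u, (Fintype.card A : ℝ≥0∞)⁻¹ *
      ∑ s', B.latent.T h (B.traj (L.imitate J j) w h).1 u s' *
        ∫⁻ x', (if ¬ 0 < L.F f' (B.obs (L.imitate J j) w h) x' u then 1 else 0)
          ∂(B.q s' : Measure X) ∂B.seedLaw[|B.clusterEvent φ i] = 0 := by
    rw [lintegral_eq_zero_of_ae_eq_zero]
    filter_upwards [BlockMDP.ae_cond _ (B.ae_realizedAt hf (L.imitate J j))] with w hw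
    refine Finset.sum_eq_zero fun u _ => ?_
    rw [Finset.sum_eq_zero, mul_zero]
    intro s' _
    by_cases hT : B.latent.T h (B.traj (L.imitate J j) w h).1 u s' = 0
    · rw [hT, zero_mul]
    · rw [lintegral_eq_zero_of_ae_eq_zero, mul_zero]
      filter_upwards [hw s' ⟨u, hT⟩] with x' hx'
      have hpos : 0 < B.latent.prob h (B.traj (L.imitate J j) w h).1 u s' :=
        ENNReal.toReal_pos hT (PMF.apply_ne_top _ _)
      have hpos' : 0 < L.F f' (B.obs (L.imitate J j) w h) x' u := by
        rw [hx' u]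
        refine div_pos hpos (Finset.sum_pos' (fun a _ => B.latent.prob_nonneg _ _ _ _)
          ⟨u, Finset.mem_univ _, hpos⟩)
      simp [hpos']
  rw [hzero] at e1
  have hπ := measurableFamily_probe (Θ := Unit) hL J j h
  have hm : Measurable fun w : Seed S A X N => (if ¬ 0 < L.F f' (B.obs (L.probe J j h) w h)
      (B.obs (L.probe J j h) w (h + 1)) (B.action (L.probe J j h) w h) then (1 : ℝ≥0∞) else 0) :=
    measurable_eval (f := fun (w : Seed S A X N) u => if ¬ 0 < L.F f' (B.obs (L.probe J j h) w h)
      (B.obs (L.probe J j h) w (h + 1)) u then (1 : ℝ≥0∞) else 0)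
      (fun u => (hΨ u).comp ((B.measurable_obs_of_policy hπ h).prodMk
        (B.measurable_obs_of_policy hπ (h + 1)))) (B.measurable_action_of_policy hπ h)
  rw [lintegral_eq_zero_iff hm] at e1
  filter_upwards [e1] with w hw
  by_contra hne
  simp [hne] at hw

end Realizable

/-! ### Comparison with the benchmark policy -/

/-- If the initial state is the hypothesized one and no decoding error occurs, the learned policy
acts like the benchmark. -/
theorem ret_imitate_eq (hstart : L.start = B.latent.start) (hnext : L.next = M.nextState)
    (J : ℕ → ι) (j : Fin N) {w : Seed S A X N} (hdec : ∀ t s, B.dec (w.emit t s) = s)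
    (hj : w.idx = j)
    (herr : ∀ h, h + 1 < H → M.nextState h (B.traj (L.imitate J j) w h).1
      (L.decoder J h (B.obs (L.imitate J j) w h) (B.obs (L.imitate J j) w (h + 1))) =
        (B.traj (L.imitate J j) w (h + 1)).1) :
    B.ret (L.imitate J j) w = B.ret (B.lift L.ρ) w := by
  have hdecode : ∀ t, t < H → L.decode (L.decoder J) (L.start j) t
      (B.traj (L.imitate J j) w t).2 = (B.traj (L.imitate J j) w t).1 := by
    intro t
    induction t with
    | zero => intro _; simp [decode, BlockMDP.traj, hstart, hj]
    | succ t ih =>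
      intro ht
      rw [← herr t ht, ← ih (by omega)]
      simp only [decode, hnext]
      congr 1
      · congr 1
        funext i
        exact B.traj_obs_succ _ w t i
      · congr 1
        exact B.traj_obs_succ _ w t (Fin.last t)
  have hact : ∀ t, t < H → ∀ π, B.traj π w t = B.traj (L.imitate J j) w t →
      L.imitate J j t (B.traj π w t).2 w.act = B.lift L.ρ t (B.traj π w t).2 w.act := by
    intro t ht π hπ
    have h1 : (B.traj π w t).2 (Fin.last t) = w.emit t (B.traj π w t).1 := B.obs_eq_emit π w t
    simp only [imitate, BlockMDP.lift, h1, hdec]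
    rw [hπ, hdecode t ht]
  have htraj : ∀ t, t < H → B.traj (B.lift L.ρ) w t = B.traj (L.imitate J j) w t := by
    intro t
    induction t with
    | zero => intro _; rfl
    | succ t ih =>
      intro ht
      have h1 := ih (by omega)
      have h2 := hact t (by omega) _ h1
      simp only [BlockMDP.traj, ← h2]
      rw [h1]
  refine Finset.sum_congr rfl fun t ht => ?_
  have htH := Finset.mem_range.1 ht
  have h1 := htraj t htH
  have h2 := hact t htH _ h1
  simp only [BlockMDP.action, ← h2]
  rw [h1]

/-- Both policies are run on the same seed. Their returns agree outside an event of mass at most `2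
* ε / H`, made up of a wrong initial state and at most `H` decoding errors of mass `ε / H ^ 2` each;
on that event they differ by at most `H`. -/
theorem le_clusterValue_imitate (hL : L.IsMeasurable) (hstart : L.start = B.latent.start)
    (hnext : L.next = M.nextState) (hH : 1 ≤ H) {φ : X → Fin N} (hφ : Measurable φ) (i : Fin N)
    (J : ℕ → ι) (j : Fin N) {ε : ℝ} (hε : 0 < ε)
    (hj : B.seedLaw[|B.clusterEvent φ i] {w | w.idx ≠ j} ≤ ENNReal.ofReal (ε / H))
    (herr : ∀ h, h + 1 < H → L.clusterErr B M φ i J j h (J h) ≤ ENNReal.ofReal (ε / H ^ 2)) :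
    B.clusterValue φ i (B.lift L.ρ) - 2 * ε ≤ B.clusterValue φ i (L.imitate J j) := by
  have hH' : (0 : ℝ) < H := by exact_mod_cast hH
  have hπ := measurableFamily_imitate (Θ := Unit) hL J j
  have hlift : BlockMDP.MeasurableFamily fun _ : Unit => B.lift (X := X) L.ρ := fun t =>
    (measurable_of_countable (L.ρ t)).comp (B.dec_meas.comp ((measurable_pi_apply _).comp
      (measurable_fst.comp measurable_snd)))
  set ν := B.seedLaw[|B.clusterEvent φ i] with hν
  have hνle : ν Set.univ ≤ 1 := by
    have := lintegral_cond_le B.seedLaw (B.clusterEvent φ i) 1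
    simpa using this
  have : IsFiniteMeasure ν := ⟨hνle.trans_lt ENNReal.one_lt_top⟩
  set E : ℕ → Set (Seed S A X N) := fun h => {w | M.nextState h (B.traj (L.imitate J j) w h).1
      (L.decoder J h (B.obs (L.imitate J j) w h) (B.obs (L.imitate J j) w (h + 1))) ≠
        (B.traj (L.imitate J j) w (h + 1)).1} with hE
  -- The last action is taken at step `H - 1`, so only the `H - 1` transitions before it have to be
  -- decoded.
  set bad : Set (Seed S A X N) := {w | w.idx ≠ j} ∪ ⋃ h ∈ Finset.range (H - 1), E h with hbad
  have hbadν : ν bad ≤ ENNReal.ofReal (2 * ε / H) := by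
    calc ν bad ≤ ν {w | w.idx ≠ j} + ∑ h ∈ Finset.range (H - 1), ν (E h) :=
          (measure_union_le _ _).trans (by gcongr; exact measure_biUnion_finset_le _ _)
      _ ≤ ENNReal.ofReal (ε / H) +
          ∑ h ∈ Finset.range (H - 1), ENNReal.ofReal (ε / H ^ 2) := by
          gcongr with h hh
          have hh' := Finset.mem_range.1 hh
          exact (BlockMDP.cond_err_le (α := L.decoder J h) (measurable_selA_F hL (J h)) hπ (fun _ _ _ _ => rfl) hφ i
            h).trans (herr h (by omega))
      _ ≤ ENNReal.ofReal (2 * ε / H) := by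
          rw [← ENNReal.ofReal_sum_of_nonneg fun _ _ => by positivity,
            ← ENNReal.ofReal_add (by positivity) (by positivity)]
          refine ENNReal.ofReal_le_ofReal ?_
          rw [Finset.sum_const, Finset.card_range, nsmul_eq_mul, Nat.cast_sub hH]
          have : ((H : ℝ) - (1 : ℕ)) * (ε / H ^ 2) ≤ H * (ε / H ^ 2) := by
            gcongr; simp
          have h2 : H * (ε / (H : ℝ) ^ 2) = ε / H := by field_simp
          have h3 : 2 * ε / H = ε / H + ε / H := by ring
          linarith
  have hint : ∀ π : Policy X A, BlockMDP.MeasurableFamily (fun _ : Unit => π) →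
      Integrable (fun w => B.ret π w) ν := fun π h =>
    Integrable.of_mem_Icc 0 (H : ℝ) (B.measurable_ret_of_policy h).aemeasurable
      (Filter.Eventually.of_forall fun w => B.ret_mem π w)
  have hbadm : MeasurableSet bad := by
    refine MeasurableSet.union ?_ (Finset.measurableSet_biUnion _ fun h _ => ?_)
    · exact (Seed.measurable_idx (measurableSet_singleton j)).compl
    · have hT := B.measurable_traj_of_policy hπ
      have hO := B.measurable_obs_of_policy hπ
      refine (measurableSet_eq_fun ?_ (measurable_fst.comp (hT (h + 1)))).compl
      exact (measurable_of_countable fun p : S × A => M.nextState h p.1 p.2).comp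
        ((measurable_fst.comp (hT h)).prodMk
          ((measurable_selA_F hL (J h)).comp ((hO h).prodMk (hO (h + 1)))))
  have hpt : ∀ᵐ w ∂ν, B.ret (B.lift L.ρ) w ≤
      B.ret (L.imitate J j) w + bad.indicator (fun _ => (H : ℝ)) w := by
    filter_upwards [BlockMDP.ae_cond _ B.ae_dec_emit] with w hw
    by_cases hwb : w ∈ bad
    · rw [Set.indicator_of_mem hwb]
      linarith [(B.ret_mem (B.lift L.ρ) w).2, (B.ret_mem (L.imitate J j) w).1]
    · rw [Set.indicator_of_notMem hwb, add_zero]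
      simp only [hbad, hE, Set.mem_union, Set.mem_iUnion, Finset.mem_range, not_or, not_exists,
        Set.mem_ofPred_eq, not_not] at hwb
      exact (ret_imitate_eq hstart hnext J j hw hwb.1 fun h hh => hwb.2 h (by omega)).ge
  have hindI : Integrable (bad.indicator fun _ => (H : ℝ)) ν :=
    (integrable_const _).indicator hbadm
  have h1 : B.clusterValue φ i (B.lift L.ρ) ≤
      B.clusterValue φ i (L.imitate J j) + ∫ w, bad.indicator (fun _ => (H : ℝ)) w ∂ν := by
    have e : B.clusterValue φ i (L.imitate J j) = ∫ w, B.ret (L.imitate J j) w ∂ν := rfl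
    rw [e, ← integral_add (hint _ hπ) hindI]
    exact integral_mono_ae (hint _ hlift) ((hint _ hπ).add hindI) hpt
  have h2 : ∫ w, bad.indicator (fun _ => (H : ℝ)) w ∂ν ≤ 2 * ε := by
    rw [integral_indicator_const _ hbadm, smul_eq_mul]
    have : ν.real bad ≤ 2 * ε / H := ENNReal.toReal_le_of_le_ofReal (by positivity) hbadν
    calc ν.real bad * H ≤ 2 * ε / H * H := by gcongr
      _ = 2 * ε := by field_simp
  linarith

end Learner

end

/-! ### High-probability guarantees for fits and tests in one cluster -/

noncomputable section

namespace Learner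

variable {S A X ι : Type*} {N H : ℕ}

section Congr

variable {L : Learner S A X ι N}

theorem decode_congr {α α' : ℕ → X → X → A} (s : S) (t : ℕ) (h : ∀ k < t, α k = α' k) :
    L.decode α s t = L.decode α' s t := by
  induction t with
  | zero => rfl
  | succ t ih =>
    funext x
    simp only [decode, ih fun k hk => h k (by omega), h t (by omega)]

theorem imitate_congr {J J' : ℕ → ι} (j : Fin N) (t : ℕ) (h : ∀ k < t, J k = J' k) :
    L.imitate J j t = L.imitate J' j t := by
  funext x u
  simp only [imitate]
  rw [decode_congr (α' := L.decoder J') _ _ fun k hk => by funext x x'; simp [decoder, h k hk]]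

theorem probe_congr {J J' : ℕ → ι} (j : Fin N) (h : ℕ) (hJ : ∀ k < h, J k = J' k) :
    L.probe J j h = L.probe J' j h := by
  funext t x u
  simp only [probe]
  split_ifs with ht
  · rw [imitate_congr j t fun k hk => hJ k (hk.trans ht)]
  · rfl

variable [Nonempty X] [Nonempty A]

theorem block_append (L : Learner S A X ι N) (m l : List (Episode X A)) (j : Fin N) {k : ℕ}
    (h : j * (L.nl + L.nt) + k < m.length) : L.block (m ++ l) j k = L.block m j k :=
  List.getD_append _ _ _ _ h

theorem block_append_right (L : Learner S A X ι N) (m l : List (Episode X A)) (j : Fin N)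
    {k r : ℕ} (h : j * (L.nl + L.nt) + k = m.length + r) :
    L.block (m ++ l) j k = l.getD r default := by
  unfold block
  rw [h, List.getD_append_right _ _ _ _ (by omega)]
  congr 1
  omega

theorem index_append (L : Learner S A X ι N) (m l : List (Episode X A)) (j : Fin N) {h : ℕ}
    (hm : j * (L.nl + L.nt) + (h + 1) * L.nD ≤ m.length) :
    L.index (L.block (m ++ l) j) h = L.index (L.block m j) h := by
  unfold index
  have hb : ∀ r : Fin L.nD, L.block (m ++ l) j (h * L.nD + r) = L.block m j (h * L.nD + r) :=
    fun r => L.block_append m l j (by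
      have := r.2
      rw [add_one_mul] at hm
      omega)
  simp only [hb]

theorem testValue_append (L : Learner S A X ι N) (m l : List (Episode X A)) (j : Fin N)
    (hm : (j + 1) * (L.nl + L.nt) ≤ m.length) :
    L.testValue (m ++ l) j = L.testValue m j := by
  unfold testValue
  congr 1
  refine Finset.sum_congr rfl fun k hk => ?_
  have := Finset.mem_range.1 hk
  rw [L.block_append m l j (by rw [add_one_mul] at hm; omega)]

/-- Division with remainder recovers hypothesis, batch and position. From `h` on, `index` reads an
unfinished or absent batch filled with default episodes; this is harmless because `probe` consults
only the fits before step `h`. -/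
theorem policy_of_learning (L : Learner S A X ι N) {m : List (Episode X A)} (j : Fin N) {h k : ℕ}
    (hh : h < L.H) (hk : k < L.nD) (hm : m.length = j * (L.nl + L.nt) + h * L.nD + k) :
    L.policy m = L.probe (L.index (L.block m j)) j h := by
  have h1 : h * L.nD + k < L.nl := by
    have : (h + 1) * L.nD ≤ L.H * L.nD := Nat.mul_le_mul_right _ hh
    rw [add_one_mul] at this
    unfold nl
    omega
  obtain ⟨hdiv, hmod⟩ := (Nat.div_mod_unique (a := m.length) (b := L.nl + L.nt) (d := (j : ℕ))
    (c := h * L.nD + k) (by omega)).2 ⟨by rw [hm]; ring, by omega⟩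
  obtain ⟨hdiv', -⟩ := (Nat.div_mod_unique (a := h * L.nD + k) (b := L.nD) (d := h)
    (c := k) (by omega)).2 ⟨by ring, hk⟩
  have hj : m.length / (L.nl + L.nt) < N := hdiv ▸ j.2
  have hjj : (⟨m.length / (L.nl + L.nt), hj⟩ : Fin N) = j := Fin.ext hdiv
  unfold policy
  rw [dif_pos hj]
  simp only [hjj, hmod, h1, if_true, hdiv']
  rfl

theorem policy_of_testing (L : Learner S A X ι N) {m : List (Episode X A)} (j : Fin N) {k : ℕ}
    (hk : k < L.nt) (hm : m.length = j * (L.nl + L.nt) + L.nl + k) :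
    L.policy m = L.imitate (L.index (L.block m j)) j := by
  obtain ⟨hdiv, hmod⟩ := (Nat.div_mod_unique (a := m.length) (b := L.nl + L.nt) (d := (j : ℕ))
    (c := L.nl + k) (by omega)).2 ⟨by rw [hm]; ring, by omega⟩
  have hj : m.length / (L.nl + L.nt) < N := hdiv ▸ j.2
  have hjj : (⟨m.length / (L.nl + L.nt), hj⟩ : Fin N) = j := Fin.ext hdiv
  have h1 : ¬ L.nl + k < L.nl := by omega
  unfold policy
  rw [dif_pos hj]
  simp only [hjj, hmod, h1, if_false]
  rfl

theorem policy_of_complete (L : Learner S A X ι N) {m : List (Episode X A)}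
    (hq : 0 < L.nl + L.nt) (hm : N * (L.nl + L.nt) ≤ m.length) :
    L.policy m = L.imitate (L.index (L.block m (L.selN (L.testValue m))))
      (L.selN (L.testValue m)) := by
  have h1 : ¬ m.length / (L.nl + L.nt) < N := not_lt.2 ((Nat.le_div_iff_mul_le hq).2 hm)
  unfold policy
  rw [dif_neg h1]
  rfl

end Congr

section Measurability

variable [Finite S] [MeasurableSpace S] [MeasurableSingletonClass S] [Finite A]
  [MeasurableSpace A] [MeasurableSingletonClass A] [MeasurableSpace X] [Finite ι]
  [Nonempty X] [Nonempty A] {L : Learner S A X ι N}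

/-- Only the first `n` fits matter and the class is finite, so the set is a finite union over their
possible values. Measurability of `P` in its second argument is not needed. -/
theorem measurableSet_of_index (hL : L.IsMeasurable) (j : Fin N) (n : ℕ)
    {P : List (Episode X A) → (ℕ → ι) → Prop} (hP : ∀ J, MeasurableSet {m | P m J})
    (hcongr : ∀ m J J', (∀ k < n, J k = J' k) → (P m J ↔ P m J')) :
    MeasurableSet {m | P m (L.index (L.block m j))} := by
  have : Nonempty ι := ⟨L.index (L.block [] j) 0⟩
  -- The values from `n` on are padding, irrelevant by `hcongr`.
  set ext : (Fin n → ι) → ℕ → ι := fun T k =>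
    if hk : k < n then T ⟨k, hk⟩ else Classical.arbitrary ι with hext
  have heq : {m | P m (L.index (L.block m j))} =
      ⋃ T : Fin n → ι, (⋂ k : Fin n, {m | L.index (L.block m j) k = T k}) ∩ {m | P m (ext T)} := by
    ext m
    simp only [Set.mem_ofPred_eq, Set.mem_iUnion, Set.mem_inter_iff, Set.mem_iInter]
    constructor
    · intro hm
      refine ⟨fun k => L.index (L.block m j) k, fun _ => rfl, ?_⟩
      refine (hcongr m _ _ fun k hk => ?_).1 hm
      simp [hext, hk]
    · rintro ⟨T, hT, hm⟩
      refine (hcongr m _ _ fun k hk => ?_).2 hm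
      simp only [hext, hk, dif_pos]
      exact hT ⟨k, hk⟩
  rw [heq]
  exact MeasurableSet.iUnion fun T => (MeasurableSet.iInter fun k : Fin n =>
    measurableSet_index hL (L.measurable_block j) k (T k)).inter (hP _)

end Measurability

variable [Fintype S] [MeasurableSpace S] [MeasurableSingletonClass S]
  [Fintype A] [Nonempty A] [MeasurableSpace A] [MeasurableSingletonClass A] [MeasurableSpace X]
  [Nonempty X] [Fintype ι] {L : Learner S A X ι N} {B : BlockMDP S A X N H} {M : MDP S A N H}

theorem clusterErr_congr (φ : X → Fin N) (i : Fin N) {J J' : ℕ → ι} (j : Fin N) (h : ℕ) (f : ι)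
    (hJ : ∀ k < h, J k = J' k) :
    L.clusterErr B M φ i J j h f = L.clusterErr B M φ i J' j h f := by
  unfold clusterErr
  have ht : ∀ w, B.traj (L.imitate J j) w h = B.traj (L.imitate J' j) w h := fun w =>
    B.traj_congr_policy w h fun k hk => imitate_congr j k fun k' hk' => hJ k' (hk'.trans hk)
  simp only [BlockMDP.obs, ht]

theorem list_eq_ofFn {E : Type*} [Inhabited E] {n : ℕ} {l : List E} (hl : l.length = n) :
    l = List.ofFn fun r : Fin n => l.getD r default := by
  subst hl
  refine List.ext_getElem (by simp) fun k h1 h2 => ?_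
  simp

/-- The memories in which the class member fitted to the batch of step `h` has a large decoding
error. -/
def badFit (L : Learner S A X ι N) (B : BlockMDP S A X N H) (M : MDP S A N H) (φ : X → Fin N)
    (i j : Fin N) (h : ℕ) (r : ℝ) : Set (List (Episode X A)) :=
  {m | ENNReal.ofReal r < L.clusterErr B M φ i (L.index (L.block m j)) j h
    (L.index (L.block m j) h)}

/-- A fitted model has at least the likelihood of the true one; dividing by the latter, which is
positive, and taking roots factor by factor gives the claim. -/
theorem one_le_prod_rootRatio {n : ℕ} (h : ℕ) (d : Fin n → Episode X A)
    {f f' : ι} (hF0 : ∀ j x x' a, 0 ≤ L.F j x x' a)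
    (hpos : ∀ r, 0 < L.F f' ((d r).obs h) ((d r).obs (h + 1)) ((d r).act h))
    (hle : ∏ r, L.F f' ((d r).obs h) ((d r).obs (h + 1)) ((d r).act h) ≤
      ∏ r, L.F f ((d r).obs h) ((d r).obs (h + 1)) ((d r).act h)) :
    1 ≤ ((List.ofFn d).map (L.rootRatio f f' h)).prod := by
  rw [List.map_ofFn, List.prod_ofFn]
  simp only [Function.comp, rootRatio]
  rw [← ENNReal.ofReal_prod_of_nonneg fun _ _ => Real.sqrt_nonneg _, ENNReal.one_le_ofReal]
  set y := ∏ r, √(L.F f ((d r).obs h) ((d r).obs (h + 1)) ((d r).act h) /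
    L.F f' ((d r).obs h) ((d r).obs (h + 1)) ((d r).act h)) with hy
  have hy0 : 0 ≤ y := Finset.prod_nonneg fun _ _ => Real.sqrt_nonneg _
  have hy2 : 1 ≤ y ^ 2 := by
    rw [hy, ← Finset.prod_pow]
    simp only [Real.sq_sqrt (div_nonneg (hF0 f _ _ _) (hF0 f' _ _ _))]
    rw [Finset.prod_div_distrib, one_le_div (Finset.prod_pos fun r _ => hpos r)]
    exact hle
  nlinarith

/-- With everything before the batch frozen, the exploring policy is fixed and a candidate with
error mass above `r` has affinity at most `1 - κ * r`. It can beat the true model on `nD` samples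
only with probability `exp (-nD * κ * r)`. The union is over the class. -/
theorem measure_badFit_le (hL : L.IsMeasurable) {η : ℝ} (h0 : 0 ≤ η) (h1 : η < 1 / 2)
    (hM : M.IsDeterministic) (hp : MDP.IsPerturbation η M B.latent) (hLH : L.H = H)
    (hF0 : ∀ j x x' a, 0 ≤ L.F j x x' a) (hF1 : ∀ j x x', ∑ a, L.F j x x' a = 1)
    (hsel : ∀ (v : A → ℝ) (a : A), v a ≤ v (L.selA v)) (hmle : IsMLE L.F L.mle)
    (hreal : B.RealizableInverse L.F) {φ : X → Fin N} (hφ : Measurable φ) (i j : Fin N) {h : ℕ}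
    (hh : h + 1 < H) {r c : ℝ} (hr : 0 ≤ r)
    (hc : Fintype.card ι * Real.exp (-(L.nD * ((1 - 2 * η) ^ 2 / (8 * Fintype.card A) * r))) ≤ c) :
    B.runLaw {ω | ∃ e, j * (L.nl + L.nt) + (h + 1) * L.nD ≤ (L.memory B φ ω e i).length ∧
        L.memory B φ ω e i ∈ L.badFit B M φ i j h r} ≤ ENNReal.ofReal c := by
  classical
  obtain ⟨f', hf'⟩ := hreal h hh
  set κ := (1 - 2 * η) ^ 2 / (8 * Fintype.card A) with hκ
  have hκ0 : 0 ≤ κ := by positivity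
  have hn : j * (L.nl + L.nt) + (h + 1) * L.nD =
      (j * (L.nl + L.nt) + h * L.nD) + L.nD := by ring
  refine (measure_exists_bad_le hL B hφ i ?_ _ ?_).trans ?_
  · refine measurableSet_of_index hL j (h + 1) (P := fun _ J =>
      ENNReal.ofReal r < L.clusterErr B M φ i J j h (J h)) (fun J => MeasurableSet.const _) ?_
    intro _ J J' hJ
    rw [hJ h (by omega), clusterErr_congr φ i j h _ fun k hk => hJ k (by omega)]
  · intro m x hm
    have hidx : ∀ k ≤ h, L.index (L.block (m ++ [x]) j) k = L.index (L.block m j) k :=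
      fun k hk => L.index_append m [x] j (le_trans (by gcongr) hm)
    simp only [badFit, Set.mem_ofPred_eq]
    rw [hidx h le_rfl, clusterErr_congr φ i j h _ fun k hk => hidx k hk.le]
  · rw [hn]
    refine badProb_add_le L B fun m hm => ?_
    set J := L.index (L.block m j) with hJ
    have hidx : ∀ l : List (Episode X A), ∀ k < h, L.index (L.block (m ++ l) j) k = J k :=
      fun l k hk => L.index_append m l j (by
        rw [hm]; gcongr; omega)
    -- The candidates to be excluded depend on the earlier fits only, hence are determined before
    -- the batch starts.
    set s : Finset ι := Finset.univ.filter fun f =>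
      ENNReal.ofReal r < L.clusterErr B M φ i J j h f
    have hpol : ∀ l : List (Episode X A), l.length < L.nD →
        L.policy (m ++ l) = L.probe J j h := by
      intro l hl
      rw [L.policy_of_learning j (h := h) (k := l.length) (by omega) hl (by simp [hm])]
      exact probe_congr j h (hidx l)
    have hψ : ∀ f ∈ s, ∫⁻ w, L.rootRatio f f' h (B.episode (L.probe J j h) w)
        ∂B.seedLaw[|B.clusterEvent φ i] ≤ ENNReal.ofReal (1 - κ * r) := by
      intro f hf
      have hf2 := (Finset.mem_filter.1 hf).2
      have hle := lintegral_rootRatio_add_le (B := B) (M := M) hL h0 h1 hM hp (by omega) hF0 hF1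
        hsel hf' hφ i J j f
      rw [ENNReal.ofReal_sub _ (by positivity), ENNReal.ofReal_one]
      refine ENNReal.le_sub_of_add_le_right ENNReal.ofReal_ne_top (le_trans ?_ hle)
      rw [ENNReal.ofReal_mul hκ0]
      gcongr
    refine (badProb_le_sum_pow L B m s (fun f => L.rootRatio f f' h)
      (fun e => 0 < L.F f' (e.obs h) (e.obs (h + 1)) (e.act h))
      (fun _ => ENNReal.ofReal (1 - κ * r)) ?_ ?_ ?_ ?_).trans ?_
    · intro l hl hgood hbad
      have hblock : ∀ k : Fin L.nD, L.block (m ++ l) j (h * L.nD + k) = l.getD k default :=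
        fun k => L.block_append_right m l j (by rw [hm]; ring)
      set d : Fin L.nD → Episode X A := fun k => l.getD k default with hd
      have hld : l = List.ofFn d := list_eq_ofFn hl
      set f := L.index (L.block (m ++ l) j) h with hf
      have hfdef : f = L.mle L.nD fun k : Fin L.nD =>
          ((d k).obs h, (d k).act h, (d k).obs (h + 1)) := by
        rw [hf]
        unfold index
        simp only [hblock, hd]
      have hfs : f ∈ s := by
        refine Finset.mem_filter.2 ⟨Finset.mem_univ _, ?_⟩
        rw [← clusterErr_congr φ i j h f (hidx l)]
        exact hbad
      have hpos : ∀ k, 0 < L.F f' ((d k).obs h) ((d k).obs (h + 1)) ((d k).act h) := fun k =>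
        hgood _ (hld ▸ List.mem_ofFn.2 ⟨k, rfl⟩)
      have hlik := hmle.1 L.nD (fun k => ((d k).obs h, (d k).act h, (d k).obs (h + 1))) f'
      rw [← hfdef] at hlik
      have h3 := one_le_prod_rootRatio (L := L) h d hF0 hpos hlik
      rw [← hld] at h3
      exact h3.trans (Finset.single_le_sum (f := fun f => (l.map (L.rootRatio f f' h)).prod)
        (fun _ _ => zero_le) hfs)
    · intro l hl
      rw [hpol l hl]
      exact ae_probe_pos hL hf' hφ i J j
    · intro l hl f _
      rw [hpol l hl]
      exact (measurable_rootRatio hL f f' h).comp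
        (B.measurable_episode_of_policy (measurableFamily_probe hL J j h))
    · intro l hl f hf
      rw [hpol l hl]
      exact hψ f hf
    · rw [Finset.sum_const, nsmul_eq_mul, ← ENNReal.ofReal_natCast]
      refine le_trans ?_ (ENNReal.ofReal_le_ofReal hc)
      rw [ENNReal.ofReal_mul (by positivity)]
      gcongr
      · exact Finset.card_le_univ s
      · calc ENNReal.ofReal (1 - κ * r) ^ L.nD ≤ ENNReal.ofReal (Real.exp (-(κ * r))) ^ L.nD := by
              gcongr
              linarith [Real.add_one_le_exp (-(κ * r))]
          _ = _ := by
              rw [← ENNReal.ofReal_pow (Real.exp_nonneg _), ← Real.exp_nat_mul]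
              congr 2; ring

/-- The memories in which the average return of the test episodes of hypothesis `j` deviates in
direction `σ` from the value of the learned policy. -/
def badTest (L : Learner S A X ι N) (B : BlockMDP S A X N H) (φ : X → Fin N)
    (i j : Fin N) (σ ε : ℝ) : Set (List (Episode X A)) :=
  {m | ε ≤ σ * (L.testValue m j - B.clusterValue φ i (L.imitate (L.index (L.block m j)) j))}

/-- Hoeffding's lemma for returns in `[0, H]`. The cluster must have positive probability, so that
`clusterValue` is a genuine mean. -/
theorem lintegral_exp_ret_le {π : Policy X A} (hπ : BlockMDP.MeasurableFamily fun _ : Unit => π)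
    (φ : X → Fin N) (i : Fin N) (t c : ℝ)
    (hC : B.seedLaw (B.clusterEvent φ i) ≠ 0) :
    ∫⁻ w, ENNReal.ofReal (Real.exp (t * (B.ret π w - B.clusterValue φ i π) - c))
      ∂B.seedLaw[|B.clusterEvent φ i] ≤ ENNReal.ofReal (Real.exp (H ^ 2 * t ^ 2 / 8 - c)) := by
  have : IsProbabilityMeasure (B.seedLaw[|B.clusterEvent φ i]) := cond_isProbabilityMeasure hC
  have hsub := hasSubgaussianMGF_of_mem_Icc (μ := B.seedLaw[|B.clusterEvent φ i])
    (X := fun w => B.ret π w) (a := 0) (b := (H : ℝ))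
    (B.measurable_ret_of_policy hπ).aemeasurable
    (Filter.Eventually.of_forall fun w => B.ret_mem π w)
  have hV : ∫ w, B.ret π w ∂B.seedLaw[|B.clusterEvent φ i] = B.clusterValue φ i π := rfl
  rw [hV] at hsub
  have h1 := hsub.mgf_le t
  have h2 := hsub.integrable_exp_mul t
  unfold mgf at h1
  have e1 : ∀ w, Real.exp (t * (B.ret π w - B.clusterValue φ i π) - c) =
      Real.exp (-c) * Real.exp (t * (B.ret π w - B.clusterValue φ i π)) := fun w => by
    rw [← Real.exp_add]; congr 1; ring
  simp only [e1]
  rw [← ofReal_integral_eq_lintegral_ofReal (h2.const_mul _)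
    (Filter.Eventually.of_forall fun w => by positivity), integral_const_mul]
  refine ENNReal.ofReal_le_ofReal ?_
  have e2 : (H : ℝ) ^ 2 * t ^ 2 / 8 - c =
      -c + (((‖(H : ℝ) - 0‖₊ / 2) ^ 2 : NNReal) : ℝ) * t ^ 2 / 2 := by
    simp; ring
  rw [e2, Real.exp_add]
  gcongr

/-- Once the learning episodes are frozen, the tested policy is fixed and the test returns are
independent with mean its cluster value. The Chernoff argument runs over a one-element class; `σ =
±1` selects the side of the deviation. -/
theorem measure_badTest_le (hL : L.IsMeasurable) (hLH : L.H = H) {φ : X → Fin N}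
    (hφ : Measurable φ) (i j : Fin N) (hC : B.seedLaw (B.clusterEvent φ i) ≠ 0) (hH : 1 ≤ H)
    {σ ε c : ℝ} (hσ : σ ^ 2 = 1) (hε : 0 < ε) (hnt : 0 < L.nt)
    (hc : Real.exp (-(L.nt * (2 * ε ^ 2 / H ^ 2))) ≤ c) :
    B.runLaw {ω | ∃ e, (j + 1) * (L.nl + L.nt) ≤ (L.memory B φ ω e i).length ∧
        L.memory B φ ω e i ∈ L.badTest B φ i j σ ε} ≤ ENNReal.ofReal c := by
  have hH' : (0 : ℝ) < H := by exact_mod_cast hH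
  have hVcongr : ∀ J J' : ℕ → ι, (∀ k < H, J k = J' k) →
      B.clusterValue φ i (L.imitate J j) = B.clusterValue φ i (L.imitate J' j) := fun J J' h =>
    B.clusterValue_congr (fun t ht => imitate_congr j t fun k hk => h k (hk.trans ht)) φ i
  have hn : (j + 1) * (L.nl + L.nt) = (j * (L.nl + L.nt) + L.nl) + L.nt := by ring
  have hnl : ∀ k < H, (k + 1) * L.nD ≤ L.nl := fun k hk => by
    unfold nl; rw [hLH]; gcongr; omega
  refine (measure_exists_bad_le hL B hφ i ?_ _ ?_).trans ?_
  · refine measurableSet_of_index hL j H (P := fun m J =>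
      ε ≤ σ * (L.testValue m j - B.clusterValue φ i (L.imitate J j))) (fun J => ?_) ?_
    · exact measurableSet_le measurable_const
        (((L.measurable_testValue j).sub_const _).const_mul σ)
    · intro _ J J' hJ
      rw [hVcongr J J' hJ]
  · intro m x hm
    have hidx : ∀ k < H, L.index (L.block (m ++ [x]) j) k = L.index (L.block m j) k :=
      fun k hk => L.index_append m [x] j (by have := hnl k hk; omega)
    simp only [badTest, Set.mem_ofPred_eq]
    rw [L.testValue_append m [x] j hm, hVcongr _ _ hidx]
  · rw [hn]
    refine badProb_add_le L B fun m hm => ?_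
    set J := L.index (L.block m j) with hJ
    have hidx : ∀ l : List (Episode X A), ∀ k < H, L.index (L.block (m ++ l) j) k = J k :=
      fun l k hk => L.index_append m l j (by have := hnl k hk; omega)
    set V := B.clusterValue φ i (L.imitate J j) with hV
    -- The minimizer of `H ^ 2 * lam ^ 2 / 8 - lam * ε`, with minimum `-(2 * ε ^ 2 / H ^ 2)`.
    set lam : ℝ := 4 * ε / H ^ 2 with hlam
    have hlam0 : 0 < lam := by positivity
    have hret : ∀ l : List (Episode X A), l.length < L.nt → ∀ w,
        (B.episode (L.policy (m ++ l)) w).ret = B.ret (L.imitate J j) w := by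
      intro l hl w
      rw [L.policy_of_testing j hl (by simp [hm])]
      exact B.ret_congr (fun t ht => imitate_congr j t fun k hk => hidx l k (hk.trans ht)) w
    have hfam := measurableFamily_imitate (Θ := Unit) hL J j
    refine (badProb_le_sum_pow L B m (Finset.univ : Finset Unit)
      (fun _ e => ENNReal.ofReal (Real.exp (lam * σ * (e.ret - V) - lam * ε)))
      (fun _ => True)
      (fun _ => ENNReal.ofReal (Real.exp (-(2 * ε ^ 2 / H ^ 2)))) ?_ ?_ ?_ ?_).trans ?_
    · intro l hl _ hbad
      have hblock : ∀ k, L.block (m ++ l) j (L.nl + k) = l.getD k default :=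
        fun k => L.block_append_right m l j (by rw [hm]; ring)
      set d : Fin L.nt → Episode X A := fun k => l.getD k default with hd
      have hld : l = List.ofFn d := list_eq_ofFn hl
      have htest : L.testValue (m ++ l) j = (∑ k, (d k).ret) / L.nt := by
        unfold testValue
        rw [Finset.sum_range]
        simp only [hblock, hd]
      have hbad' : ε ≤ σ * ((∑ k, (d k).ret) / L.nt - V) := by
        have hb : ε ≤ σ * (L.testValue (m ++ l) j -
          B.clusterValue φ i (L.imitate (L.index (L.block (m ++ l) j)) j)) := hbad
        rwa [hVcongr _ _ (hidx l), htest] at hb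
      simp only [Finset.univ_unique, Finset.sum_singleton]
      rw [hld, List.map_ofFn, List.prod_ofFn]
      simp only [Function.comp]
      rw [← ENNReal.ofReal_prod_of_nonneg fun _ _ => Real.exp_nonneg _, ← Real.exp_sum,
        ENNReal.one_le_ofReal, Real.one_le_exp_iff]
      have hnt' : (0 : ℝ) < L.nt := by exact_mod_cast hnt
      have e1 : ∑ k, (lam * σ * ((d k).ret - V) - lam * ε) =
          lam * L.nt * (σ * ((∑ k, (d k).ret) / L.nt - V) - ε) := by
        rw [Finset.sum_sub_distrib, ← Finset.mul_sum, Finset.sum_sub_distrib]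
        simp only [Finset.sum_const, Finset.card_univ, Fintype.card_fin, nsmul_eq_mul]
        field_simp
      rw [e1]
      exact mul_nonneg (by positivity) (sub_nonneg.2 hbad')
    · exact fun _ _ => Filter.Eventually.of_forall fun _ => trivial
    · intro l hl _ _
      simp only [hret l hl]
      have := B.measurable_ret_of_policy hfam
      fun_prop
    · intro l hl _ _
      simp only [hret l hl]
      refine (lintegral_exp_ret_le hfam φ i (lam * σ) (lam * ε) hC).trans_eq ?_
      congr 2
      rw [mul_pow, hσ, hlam]
      field_simp
      ring
    · simp only [Finset.univ_unique, Finset.sum_singleton]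
      rw [← ENNReal.ofReal_pow (Real.exp_nonneg _), ← Real.exp_nat_mul, mul_neg]
      exact ENNReal.ofReal_le_ofReal hc

end Learner

end

/-! ### From one cluster to the whole run -/

noncomputable section

variable {S A X ι κ l : Type*} {N H : ℕ} [Fintype S] [MeasurableSpace S]
  [MeasurableSingletonClass S] [Fintype A] [Nonempty A] [MeasurableSpace A]
  [MeasurableSingletonClass A] [MeasurableSpace X] [Nonempty X] [Fintype ι]

/-- Every cluster has positive probability and consists, up to a fraction `r`, of episodes with
one and the same initial state. -/
def BlockMDP.Separates (B : BlockMDP S A X N H) (φ : X → Fin N) (r : ℝ) : Prop :=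
  ∀ i, B.seedLaw (B.clusterEvent φ i) ≠ 0 ∧
    ∃ j, B.seedLaw[|B.clusterEvent φ i] {w | w.idx ≠ j} ≤ ENNReal.ofReal r

namespace Learner

variable {L : Learner S A X ι N} {B : BlockMDP S A X N H} {M : MDP S A N H}

/-- The selected policy has value above its test average minus `ε`; that average is at least the one
of `j`, which exceeds the value of the policy learned for `j` minus `ε`; and that value is within `2
* ε` of the benchmark. So `j` must not be underrated and the others must not be overrated; only `j`
needs accurate fits. -/
theorem clusterValue_policy_of_not_bad (hL : L.IsMeasurable)
    (hstart : L.start = B.latent.start) (hnext : L.next = M.nextState) (hH : 1 ≤ H)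
    (hselN : ∀ (v : Fin N → ℝ) (i : Fin N), v i ≤ v (L.selN v)) {φ : X → Fin N}
    (hφ : Measurable φ) (i j : Fin N) {ε : ℝ} (hε : 0 < ε)
    (hj : B.seedLaw[|B.clusterEvent φ i] {w | w.idx ≠ j} ≤ ENNReal.ofReal (ε / H))
    (hnt : 0 < L.nt) {m : List (Episode X A)} (hm : N * (L.nl + L.nt) ≤ m.length)
    (hfit : ∀ h, h + 1 < H → m ∉ L.badFit B M φ i j h (ε / H ^ 2))
    (htest : ∀ j', m ∉ L.badTest B φ i j' (if j' = j then -1 else 1) ε) :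
    B.clusterValue φ i (B.lift L.ρ) - 4 * ε ≤ B.clusterValue φ i (L.policy m) := by
  rw [L.policy_of_complete (by omega) hm]
  have h1 := le_clusterValue_imitate (B := B) (M := M) hL hstart hnext hH hφ i
    (L.index (L.block m j)) j hε hj fun h hh => not_lt.1 (hfit h hh)
  have h2 := htest j
  simp only [badTest, Set.mem_ofPred_eq, if_true, not_le] at h2
  have h3 := hselN (L.testValue m) j
  set j' := L.selN (L.testValue m)
  by_cases hjj : j' = j
  · rw [hjj]; linarith
  · have h4 := htest j'
    simp only [badTest, Set.mem_ofPred_eq, if_neg hjj, not_le] at h4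
    linarith

/-- In every cluster the policy that is executed after the tests is nearly as good as the
benchmark, with high probability. -/
theorem measure_exists_bad_policy_le (hL : L.IsMeasurable) {η : ℝ} (h0 : 0 ≤ η) (h1 : η < 1 / 2)
    (hM : M.IsDeterministic) (hp : MDP.IsPerturbation η M B.latent) (hLH : L.H = H)
    (hstart : L.start = B.latent.start) (hnext : L.next = M.nextState) (hH : 1 ≤ H)
    (hF0 : ∀ j x x' a, 0 ≤ L.F j x x' a) (hF1 : ∀ j x x', ∑ a, L.F j x x' a = 1)
    (hsel : ∀ (v : A → ℝ) (a : A), v a ≤ v (L.selA v))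
    (hselN : ∀ (v : Fin N → ℝ) (i : Fin N), v i ≤ v (L.selN v)) (hmle : IsMLE L.F L.mle)
    (hreal : B.RealizableInverse L.F) {φ : X → Fin N} (hφ : Measurable φ) {ε δ : ℝ} (hε : 0 < ε)
    (hδ : 0 < δ) (hsep : B.Separates φ (ε / H)) (hnt : 0 < L.nt) (hN : 0 < N)
    (hfit : Fintype.card ι * Real.exp
      (-(L.nD * ((1 - 2 * η) ^ 2 / (8 * Fintype.card A) * (ε / H ^ 2)))) ≤ δ / (N * H))
    (htest : Real.exp (-(L.nt * (2 * ε ^ 2 / H ^ 2))) ≤ δ / N ^ 2) :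
    B.runLaw {ω | ∃ e i, N * (L.nl + L.nt) ≤ (L.memory B φ ω e i).length ∧
      B.clusterValue φ i (L.policy (L.memory B φ ω e i)) <
        B.clusterValue φ i (B.lift L.ρ) - 4 * ε} ≤ ENNReal.ofReal (2 * δ) := by
  choose hC jj hjj using hsep
  have hH' : (0 : ℝ) < H := by exact_mod_cast hH
  have hN' : (0 : ℝ) < N := by exact_mod_cast hN
  -- Failure budget: fewer than `N * H` fits, those of the dominant hypotheses, at `δ / (N * H)`
  -- each, and `N ^ 2` one-sided tests at `δ / N ^ 2` each.
  set E₁ : Fin N → ℕ → Set (ℕ → Seed S A X N) := fun i h =>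
    {ω | ∃ e, jj i * (L.nl + L.nt) + (h + 1) * L.nD ≤ (L.memory B φ ω e i).length ∧
        L.memory B φ ω e i ∈ L.badFit B M φ i (jj i) h (ε / H ^ 2)}
  set E₂ : Fin N → Fin N → Set (ℕ → Seed S A X N) := fun i j =>
    {ω | ∃ e, (j + 1) * (L.nl + L.nt) ≤ (L.memory B φ ω e i).length ∧
        L.memory B φ ω e i ∈ L.badTest B φ i j (if j = jj i then -1 else 1) ε}
  have hsub : {ω | ∃ e i, N * (L.nl + L.nt) ≤ (L.memory B φ ω e i).length ∧
      B.clusterValue φ i (L.policy (L.memory B φ ω e i)) <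
        B.clusterValue φ i (B.lift L.ρ) - 4 * ε} ⊆
      (⋃ i, ⋃ h ∈ Finset.range (H - 1), E₁ i h) ∪ ⋃ i, ⋃ j, E₂ i j := by
    rintro ω ⟨e, i, hlen, hlt⟩
    by_contra hne
    simp only [Set.mem_union, Set.mem_iUnion, not_or, not_exists] at hne
    refine absurd hlt (not_lt.2 ?_)
    refine clusterValue_policy_of_not_bad (M := M) hL hstart hnext hH hselN hφ i (jj i) hε
      (hjj i) hnt hlen (fun h hh hbad => ?_) (fun j hbad => ?_)
    · refine hne.1 i h (Finset.mem_range.2 (by omega)) ⟨e, le_trans ?_ hlen, hbad⟩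
      have e1 : (jj i + 1) * (L.nl + L.nt) ≤ N * (L.nl + L.nt) := by
        gcongr; exact (jj i).2
      have e2 : (h + 1) * L.nD ≤ L.nl := by
        unfold nl; rw [hLH]; gcongr
      rw [add_one_mul] at e1
      omega
    · refine hne.2 i j ⟨e, le_trans ?_ hlen, hbad⟩
      gcongr
      exact j.2
  calc _ ≤ ∑ i, ∑ h ∈ Finset.range (H - 1), B.runLaw (E₁ i h) +
        ∑ i, ∑ j, B.runLaw (E₂ i j) := by
        refine (measure_mono hsub).trans ((measure_union_le _ _).trans ?_)
        gcongr
        · refine (measure_iUnion_fintype_le _ _).trans (Finset.sum_le_sum fun i _ => ?_)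
          exact measure_biUnion_finset_le _ _
        · refine (measure_iUnion_fintype_le _ _).trans (Finset.sum_le_sum fun i _ => ?_)
          exact measure_iUnion_fintype_le _ _
    _ ≤ ∑ _i : Fin N, ∑ _h ∈ Finset.range (H - 1), ENNReal.ofReal (δ / (N * H)) +
        ∑ _i : Fin N, ∑ _j : Fin N, ENNReal.ofReal (δ / N ^ 2) := by
        gcongr with i _ h hh i _ j
        · have := Finset.mem_range.1 hh
          exact measure_badFit_le hL h0 h1 hM hp hLH hF0 hF1 hsel hmle hreal hφ i (jj i)
            (by omega) (by positivity) hfit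
        · exact measure_badTest_le hL hLH hφ i j (hC i) hH (by split_ifs <;> norm_num) hε hnt htest
    _ ≤ ENNReal.ofReal (2 * δ) := by
        have e1 : 0 ≤ δ / (N * H) := by positivity
        have e2 : 0 ≤ δ / N ^ 2 := by positivity
        simp only [Finset.sum_const, Finset.card_univ, Fintype.card_fin, Finset.card_range,
          nsmul_eq_mul, ← ENNReal.ofReal_natCast]
        rw [← ENNReal.ofReal_mul (by positivity), ← ENNReal.ofReal_mul (by positivity),
          ← ENNReal.ofReal_mul (by positivity), ← ENNReal.ofReal_mul (by positivity),
          ← ENNReal.ofReal_add (by positivity) (by positivity)]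
        refine ENNReal.ofReal_le_ofReal ?_
        have e3 : ((H - 1 : ℕ) : ℝ) ≤ H := by exact_mod_cast Nat.sub_le _ _
        calc (N : ℝ) * (((H - 1 : ℕ) : ℝ) * (δ / (N * H))) + N * (N * (δ / N ^ 2))
            ≤ N * (H * (δ / (N * H))) + N * (N * (δ / N ^ 2)) := by gcongr
          _ = 2 * δ := by field_simp; norm_num

/-- The number of episodes before a cluster has seen `n` episodes. -/
theorem ncard_short_memory_le (L : Learner S A X ι N) (B : BlockMDP S A X N H) (φ : X → Fin N)
    (ω : ℕ → Seed S A X N) (n : ℕ) :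
    {k | (L.memory B φ ω k (φ (B.obs₀ (ω k)))).length < n}.Finite ∧
      {k | (L.memory B φ ω k (φ (B.obs₀ (ω k)))).length < n}.ncard ≤ N * n := by
  set K := {k | (L.memory B φ ω k (φ (B.obs₀ (ω k)))).length < n}
  -- An episode is determined by its cluster and its rank within the cluster; short memory means
  -- rank below `n`.
  set g : ℕ → Fin N × ℕ := fun k =>
    (φ (B.obs₀ (ω k)), (L.memory B φ ω k (φ (B.obs₀ (ω k)))).length) with hg
  set t : Set (Fin N × ℕ) := ↑((Finset.univ : Finset (Fin N)) ×ˢ Finset.range n)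
  have hmono : ∀ i, Monotone fun k => (L.memory B φ ω k i).length := fun i =>
    monotone_nat_of_le_succ fun k => by
      rw [memory_succ]
      split_ifs <;> simp
  have hlt : ∀ k k', k < k' → g k ≠ g k' := by
    intro k k' hk heq
    have h1 : φ (B.obs₀ (ω k)) = φ (B.obs₀ (ω k')) := congrArg Prod.fst heq
    have h2 : (L.memory B φ ω k (φ (B.obs₀ (ω k)))).length =
      (L.memory B φ ω k' (φ (B.obs₀ (ω k')))).length := congrArg Prod.snd heq
    rw [← h1] at h2
    have h3 := hmono (φ (B.obs₀ (ω k))) (Nat.succ_le_of_lt hk)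
    simp only [Nat.succ_eq_add_one, memory_succ, if_true, List.length_append,
      List.length_singleton] at h3
    omega
  have hinj : Set.InjOn g K := by
    intro k _ k' _ heq
    rcases lt_trichotomy k k' with h | h | h
    · exact absurd heq (hlt _ _ h)
    · exact h
    · exact absurd heq.symm (hlt _ _ h)
  have hmaps : Set.MapsTo g K t := fun k hk => by
    simp only [t, Finset.coe_product, Set.mem_prod, Finset.coe_univ, Set.mem_univ, true_and,
      Finset.coe_range, Set.mem_Iio]
    exact hk
  have ht : t.Finite := Finset.finite_toSet _
  refine ⟨Set.Finite.of_injOn hmaps hinj ht, ?_⟩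
  refine (Set.ncard_le_ncard_of_injOn g hmaps hinj ht).trans_eq ?_
  rw [Set.ncard_coe_finset, Finset.card_product, Finset.card_univ, Fintype.card_fin,
    Finset.card_range]

end Learner

/-! ### Independence of the clustering phase from the later episodes -/

section Run

variable {L : Learner S A X ι N} {B : BlockMDP S A X N H} {M : MDP S A N H}
  {Φ : l → X → Fin N} {erm : (n : ℕ) → (Fin n → X × A × X × Bool) → κ × l}

theorem measurableFamily_random :
    BlockMDP.MeasurableFamily fun _ : Unit => (fun _ _ u => u : Policy X A) := fun _ => by
  fun_prop

theorem measurable_clusterData (B : BlockMDP S A X N H) (n : ℕ) :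
    Measurable fun ω : ℕ → Seed S A X N => clusterData B n ω := by
  refine measurable_pi_lambda _ fun k => ?_
  have hw : ∀ e : ℕ, Measurable fun ω : ℕ → Seed S A X N => ω e := measurable_pi_apply
  have hobs := B.measurable_obs_of_policy (measurableFamily_random (X := X) (A := A))
  have hact := B.measurable_action_of_policy (measurableFamily_random (X := X) (A := A))
  have hcoin : Measurable fun ω : ℕ → Seed S A X N => (ω (2 * (k : ℕ))).coin :=
    Seed.measurable_coin.comp (hw _)
  exact ((hobs 0).comp (hw _)).prodMk (((hact 0).comp (hw _)).prodMk
    ((Measurable.ite (hcoin (measurableSet_singleton true)) ((hobs 1).comp (hw _))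
      ((hobs 1).comp (hw _))).prodMk hcoin))

theorem clusterData_congr (B : BlockMDP S A X N H) (n : ℕ) {ω ω' : ℕ → Seed S A X N}
    (h : ∀ k < 2 * n, ω k = ω' k) : clusterData B n ω = clusterData B n ω' := by
  funext k
  have := k.2
  unfold clusterData
  rw [h (2 * k) (by omega), h (2 * k + 1) (by omega)]

/-- If the learned clustering function is good with high probability, and the rest of the run is
good with high probability for every good clustering function, then the whole run is. -/
theorem measure_clustering_le [Finite κ] [Finite l]
    (herm : ∀ n r, MeasurableSet (erm n ⁻¹' {r})) (n : ℕ) (Good : l → Prop)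
    (Fail : l → Set (ℕ → Seed S A X N)) {a b : ℝ≥0∞}
    (hGood : B.runLaw {ω | ¬ Good (erm n (clusterData B n ω)).2} ≤ a)
    (hFail : ∀ p, Good p → B.runLaw (Fail p) ≤ b) :
    B.runLaw {ω | (fun k => ω (2 * n + k)) ∈ Fail (erm n (clusterData B n ω)).2} ≤ a + b := by
  classical
  have hprob : IsProbabilityMeasure B.runLaw := by unfold BlockMDP.runLaw; infer_instance
  set P : (ℕ → Seed S A X N) → l := fun ω => (erm n (clusterData B n ω)).2 with hP
  -- Measurability of the failure events is not available, so they are replaced by measurable hulls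
  -- of the same measure.
  set W : Set (ℕ → Seed S A X N) := ⋃ p : l, {ω | Good p ∧ P ω = p ∧
    (fun k => ω (2 * n + k)) ∈ toMeasurable B.runLaw (Fail p)} with hW
  have hsub : {ω | (fun k => ω (2 * n + k)) ∈ Fail (P ω)} ⊆ {ω | ¬ Good (P ω)} ∪ W := by
    intro ω hω
    by_cases hg : Good (P ω)
    · exact Or.inr (Set.mem_iUnion.2 ⟨P ω, hg, rfl, subset_toMeasurable _ _ hω⟩)
    · exact Or.inl hg
  refine (measure_mono hsub).trans ((measure_union_le _ _).trans (add_le_add hGood ?_))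
  have hPm : ∀ p, MeasurableSet {ω | P ω = p} := by
    intro p
    have : {ω | P ω = p} = ⋃ g : κ, (fun ω => clusterData B n ω) ⁻¹' (erm n ⁻¹' {(g, p)}) := by
      ext ω
      simp only [hP, Set.mem_ofPred_eq, Set.mem_iUnion, Set.mem_preimage, Set.mem_singleton_iff]
      constructor
      · intro h; exact ⟨(erm n (clusterData B n ω)).1, by rw [← h]⟩
      · rintro ⟨g, hg⟩; rw [hg]
    rw [this]
    exact MeasurableSet.iUnion fun g => measurable_clusterData B n (herm n _)
  have hshift : Measurable fun (ω : ℕ → Seed S A X N) (k : ℕ) => ω (2 * n + k) :=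
    measurable_pi_lambda _ fun k => measurable_pi_apply _
  have hWm : MeasurableSet W := by
    refine MeasurableSet.iUnion fun p => ?_
    exact (MeasurableSet.const _).inter ((hPm p).inter (hshift (measurableSet_toMeasurable _ _)))
  -- The run is a prefix of `2 * n` seeds continued by an independent run. The clustering function
  -- depends on the prefix alone, so `hFail` applies with it held fixed.
  have hmp := measurePreserving_splice B.seedLaw (2 * n)
  change MeasurePreserving _ (B.runLaw.prod B.runLaw) B.runLaw at hmp
  rw [← hmp.measure_preimage hWm.nullMeasurableSet,
    Measure.prod_apply (hmp.measurable hWm)]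
  calc _ ≤ ∫⁻ _, b ∂B.runLaw := by
        refine lintegral_mono fun ω => ?_
        have hset : Prod.mk ω ⁻¹' ((fun p : (ℕ → Seed S A X N) × (ℕ → Seed S A X N) =>
            fun k => if k < 2 * n then p.1 k else p.2 (k - 2 * n)) ⁻¹' W) ⊆
            {ω' | Good (P ω) ∧ ω' ∈ toMeasurable B.runLaw (Fail (P ω))} := by
          intro ω' hω'
          simp only [hW, Set.mem_preimage, Set.mem_iUnion, Set.mem_ofPred_eq] at hω'
          obtain ⟨p, hg, hpp, hmem⟩ := hω'
          have e1 : P (fun k => if k < 2 * n then ω k else ω' (k - 2 * n)) = P ω := by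
            simp only [hP]
            rw [clusterData_congr B n (ω' := ω) fun k hk => by simp [hk]]
          rw [e1] at hpp
          subst hpp
          refine ⟨hg, ?_⟩
          simpa using hmem
        refine (measure_mono hset).trans ?_
        by_cases hg : Good (P ω)
        · simp only [hg, true_and]
          exact (measure_toMeasurable _).trans_le (hFail _ hg)
        · simp [hg]
    _ = b := by simp

/-- The mistakes of a run, if the policies executed after the tests are good. -/
theorem mistakes_finite (L : Learner S A X ι N) (B : BlockMDP S A X N H) (Φ : l → X → Fin N)
    (erm : (n : ℕ) → (Fin n → X × A × X × Bool) → κ × l) (n : ℕ) (bench : Policy X A) (gap : ℝ)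
    (ω : ℕ → Seed S A X N) (q : ℕ)
    (hgood : ∀ e i, q ≤ (L.memory B (clustering B Φ erm n ω) (fun k => ω (2 * n + k)) e i).length →
      B.clusterValue (clustering B Φ erm n ω) i bench - gap ≤
        B.clusterValue (clustering B Φ erm n ω) i
          (L.policy (L.memory B (clustering B Φ erm n ω) (fun k => ω (2 * n + k)) e i))) :
    (mistakes B L Φ erm n bench gap ω).Finite ∧
      (mistakes B L Φ erm n bench gap ω).ncard ≤ 2 * n + N * q := by
  set φ := clustering B Φ erm n ω with hφ
  set ω' : ℕ → Seed S A X N := fun k => ω (2 * n + k) with hω'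
  obtain ⟨hfin, hcard⟩ := L.ncard_short_memory_le B φ ω' q
  set K := {k | (L.memory B φ ω' k (φ (B.obs₀ (ω' k)))).length < q}
  have hsub : mistakes B L Φ erm n bench gap ω ⊆ Set.Iio (2 * n) ∪ (fun k => 2 * n + k) '' K := by
    rintro e (he | ⟨k, rfl, hk⟩)
    · exact Or.inl he
    · refine Or.inr ⟨k, ?_, rfl⟩
      by_contra hK
      exact absurd hk (not_lt.2 (hgood k _ (not_lt.1 hK)))
  have hfin' : (Set.Iio (2 * n) ∪ (fun k => 2 * n + k) '' K).Finite :=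
    (Set.finite_Iio _).union (hfin.image _)
  refine ⟨hfin'.subset hsub, (Set.ncard_le_ncard hsub hfin').trans ?_⟩
  refine (Set.ncard_union_le _ _).trans (add_le_add ?_ ((Set.ncard_image_le hfin).trans hcard))
  rw [Set.ncard_eq_toFinset_card']
  simp

end Run

end

noncomputable section

/-! ### Products over independent pairs -/

/-- Sample `k` uses episodes `2 * k` and `2 * k + 1`. Redrawing the last pair, which the earlier
factors do not see, peels off one factor. -/
theorem lintegral_prod_pairs_le {Y : Type*} [MeasurableSpace Y] (ν : Measure Y)
    [IsProbabilityMeasure ν] {ψ : Y → Y → ℝ≥0∞} (hψ : Measurable fun p : Y × Y => ψ p.1 p.2)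
    (n : ℕ) :
    ∫⁻ ω, ∏ k ∈ Finset.range n, ψ (ω (2 * k)) (ω (2 * k + 1))
      ∂(Measure.infinitePi fun _ : ℕ => ν) ≤ (∫⁻ x, ∫⁻ y, ψ x y ∂ν ∂ν) ^ n := by
  induction n with
  | zero => simp
  | succ n ih =>
    simp only [Finset.prod_range_succ]
    have hupd : ∀ (ω : ℕ → Y) (j : ℕ) (y : Y), 2 * n ≤ j →
        ∏ k ∈ Finset.range n, ψ (Function.update ω j y (2 * k))
          (Function.update ω j y (2 * k + 1)) =
        ∏ k ∈ Finset.range n, ψ (ω (2 * k)) (ω (2 * k + 1)) := by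
      intro ω j y hj
      refine Finset.prod_congr rfl fun k hk => ?_
      have := Finset.mem_range.1 hk
      rw [Function.update_of_ne (by omega), Function.update_of_ne (by omega)]
    refine (lintegral_infinitePi_le_update (fun _ : ℕ => ν) (2 * n + 1) _).trans ?_
    simp only [hupd _ (2 * n + 1) _ (by omega), Function.update_self,
      Function.update_of_ne (show 2 * n ≠ 2 * n + 1 by omega)]
    refine (lintegral_infinitePi_le_update (fun _ : ℕ => ν) (2 * n) _).trans ?_
    simp only [hupd _ (2 * n) _ le_rfl, Function.update_self]
    have h1 : ∀ x, Measurable (ψ x) := fun x => hψ.comp measurable_prodMk_left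
    have h2 : Measurable fun x => ∫⁻ y, ψ x y ∂ν := hψ.lintegral_prod_right'
    simp only [lintegral_const_mul _ (h1 _), lintegral_const_mul _ h2]
    have h3 : Measurable fun ω : ℕ → Y =>
        ∏ k ∈ Finset.range n, ψ (ω (2 * k)) (ω (2 * k + 1)) :=
      Finset.measurable_prod _ fun k _ => by
        have key := hψ.comp ((measurable_pi_apply (X := fun _ : ℕ => Y) (2 * k)).prodMk
          (measurable_pi_apply (X := fun _ : ℕ => Y) (2 * k + 1)))
        exact key
    rw [lintegral_mul_const _ h3, pow_succ]
    gcongr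

/-! ### The law of a labelled transition -/

/-- Replace the random bit. -/
def Seed.setCoin {S A X : Type*} {N : ℕ} (w : Seed S A X N) (b : Bool) : Seed S A X N :=
  (w.1, w.2.1, w.2.2.1, w.2.2.2.1, b)

namespace BlockMDP

variable {S A X κ l : Type*} {N H : ℕ} [Fintype S] [MeasurableSpace S] [MeasurableSingletonClass S]
  [Fintype A] [Nonempty A] [MeasurableSpace A] [MeasurableSingletonClass A] [MeasurableSpace X]
  [Nonempty X]

theorem measurePreserving_setCoin (B : BlockMDP S A X N H) :
    MeasurePreserving (fun p : Seed S A X N × Bool => p.1.setCoin p.2)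
      (B.seedLaw.prod (PMF.uniformOfFintype Bool).toMeasure) B.seedLaw :=
  measurePreserving_prod_right _ _ _ <| measurePreserving_prod_right _ _ _ <|
    measurePreserving_prod_right _ _ _ <| measurePreserving_prod_right _ _ _ measurePreserving_snd

theorem lintegral_coin (B : BlockMDP S A X N H) {F : Seed S A X N → Bool → ℝ≥0∞}
    (hF : ∀ b, Measurable fun w => F w b) (hFe : ∀ w b, F (w.setCoin b) = F w) :
    ∫⁻ w, F w w.coin ∂B.seedLaw =
      2⁻¹ * ∫⁻ w, F w true ∂B.seedLaw + 2⁻¹ * ∫⁻ w, F w false ∂B.seedLaw := by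
  rw [lintegral_resample B.measurePreserving_setCoin
    (measurable_eval (f := F) hF Seed.measurable_coin)]
  rw [← lintegral_const_mul _ (hF _), ← lintegral_const_mul _ (hF _),
    ← lintegral_add_left ((hF _).const_mul _)]
  refine lintegral_congr fun w => ?_
  rw [lintegral_pmf]
  simp only [hFe, PMF.uniformOfFintype_apply, Fintype.sum_bool, Fintype.card_bool, Nat.cast_ofNat]
  rfl

/-- The expectation of a function of an initial observation `x` (with the index of the initial
state), a uniform action, and of a state `s'` and an observation `x'` emitted by `s'`, summed
over all `s'`, and halved. -/
def pairSum (B : BlockMDP S A X N H) (K : Fin N → X → A → S → X → ℝ≥0∞) : ℝ≥0∞ :=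
  ∫⁻ w, ∑ u, (Fintype.card A : ℝ≥0∞)⁻¹ * ∑ s', 2⁻¹ *
    ∫⁻ x', K w.idx (B.obs₀ w) u s' x' ∂(B.q s' : Measure X) ∂(B.seedLaw (A := A))

section pairSum

variable (B : BlockMDP S A X N H) {K K' : Fin N → X → A → S → X → ℝ≥0∞}

theorem measurable_pairSum_inner {K : Fin N → X → X → ℝ≥0∞}
    (hK : ∀ i, Measurable fun p : X × X => K i p.1 p.2) (s' : S) :
    Measurable fun w : Seed S A X N => ∫⁻ x', K w.idx (B.obs₀ w) x' ∂(B.q s' : Measure X) := by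
  refine measurable_eval (f := fun (w : Seed S A X N) i =>
    ∫⁻ x', K i (B.obs₀ w) x' ∂(B.q s' : Measure X)) (fun i => ?_) Seed.measurable_idx
  have key := (hK i).lintegral_prod_right' (ν := (B.q s' : Measure X))
  exact key.comp B.measurable_obs₀

theorem pairSum_add (hK : ∀ i u s', Measurable fun p : X × X => K i p.1 u s' p.2)
    (K' : Fin N → X → A → S → X → ℝ≥0∞) :
    B.pairSum (fun i x u s' x' => K i x u s' x' + K' i x u s' x') =
      B.pairSum K + B.pairSum K' := by
  unfold pairSum
  rw [← lintegral_add_left]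
  · refine lintegral_congr fun w => ?_
    rw [← Finset.sum_add_distrib]
    refine Finset.sum_congr rfl fun u _ => ?_
    rw [← mul_add, ← Finset.sum_add_distrib]
    congr 1
    refine Finset.sum_congr rfl fun s' _ => ?_
    rw [← mul_add, lintegral_add_left]
    exact (hK w.idx u s').comp measurable_prodMk_left
  · refine Finset.measurable_sum _ fun u _ => Measurable.const_mul ?_ _
    refine Finset.measurable_sum _ fun s' _ => Measurable.const_mul ?_ _
    exact B.measurable_pairSum_inner (K := fun i x x' => K i x u s' x') (fun i => hK i u s') s'

theorem pairSum_mono_ae (h : ∀ᵐ w ∂(B.seedLaw (A := A)), ∀ u s', ∀ᵐ x' ∂(B.q s' : Measure X),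
      K w.idx (B.obs₀ w) u s' x' ≤ K' w.idx (B.obs₀ w) u s' x') :
    B.pairSum K ≤ B.pairSum K' := by
  refine lintegral_mono_ae ?_
  filter_upwards [h] with w hw
  refine Finset.sum_le_sum fun u _ => mul_le_mul_right (Finset.sum_le_sum fun s' _ =>
    mul_le_mul_right (lintegral_mono_ae (hw u s')) _) _

theorem pairSum_const_mul (c : ℝ≥0∞) (hc : c ≠ ∞) :
    B.pairSum (fun i x u s' x' => c * K i x u s' x') = c * B.pairSum K := by
  unfold pairSum
  rw [← lintegral_const_mul' _ _ hc]
  refine lintegral_congr fun w => ?_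
  simp only [Finset.mul_sum]
  refine Finset.sum_congr rfl fun u _ => Finset.sum_congr rfl fun s' _ => ?_
  rw [lintegral_const_mul' _ _ hc]
  ring

end pairSum

/-- Probability of the second latent state `s'`, given the index `i` of the first one and the
first action. -/
def firstProb (B : BlockMDP S A X N H) (i : Fin N) (u : A) (s' : S) : ℝ :=
  B.latent.prob 0 (B.latent.start i) u s'

theorem firstProb_nonneg (B : BlockMDP S A X N H) (i : Fin N) (u : A) (s' : S) :
    0 ≤ B.firstProb i u s' := B.latent.prob_nonneg _ _ _ _

theorem secondProb_nonneg (B : BlockMDP S A X N H) (s' : S) : 0 ≤ B.secondProb s' := by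
  unfold secondProb
  refine Finset.sum_nonneg fun i _ => mul_nonneg ENNReal.toReal_nonneg (div_nonneg ?_ (by positivity))
  exact Finset.sum_nonneg fun a _ => B.latent.prob_nonneg _ _ _ _

theorem sum_firstProb (B : BlockMDP S A X N H) (i : Fin N) (u : A) :
    ∑ s', B.firstProb i u s' = 1 := B.latent.sum_prob _ _ _

theorem sum_secondProb (B : BlockMDP S A X N H) : ∑ s', B.secondProb s' = 1 := by
  have hA : (0 : ℝ) < Fintype.card A := by exact_mod_cast Fintype.card_pos
  unfold secondProb
  rw [Finset.sum_comm]
  have h : ∀ i, ∑ s', (B.latent.μ i).toReal *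
      ((∑ a, B.latent.prob 0 (B.latent.start i) a s') / Fintype.card A) =
      (B.latent.μ i).toReal := by
    intro i
    rw [← Finset.mul_sum, ← Finset.sum_div, Finset.sum_comm]
    simp only [B.latent.sum_prob]
    simp
  simp only [h]
  exact sum_toReal_pmf _

/-- A first transition with a uniform action. -/
theorem lintegral_first (B : BlockMDP S A X N H) {Ψ : X → A → X → ℝ≥0∞}
    (hΨ : ∀ u, Measurable fun p : X × X => Ψ p.1 u p.2) :
    ∫⁻ w, Ψ (B.obs₀ w) w.act (B.obs (fun _ _ u => u) w 1) ∂B.seedLaw =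
      ∫⁻ w, ∑ u, (Fintype.card A : ℝ≥0∞)⁻¹ * ∑ s', ENNReal.ofReal (B.firstProb w.idx u s') *
        ∫⁻ x', Ψ (B.obs₀ w) u x' ∂(B.q s' : Measure X) ∂B.seedLaw := by
  have hstart : Measurable fun w : Seed S A X N => B.latent.start w.idx :=
    (measurable_of_countable B.latent.start).comp Seed.measurable_idx
  have hT : ∀ w u s', B.latent.T 0 (B.latent.start (w : Seed S A X N).idx) u s' =
      ENNReal.ofReal (B.firstProb w.idx u s') := fun w u s' => by
    rw [firstProb, MDP.prob, ENNReal.ofReal_toReal (PMF.apply_ne_top _ _)]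
  have h1 := B.lintegral_step 0 (D := fun w => B.latent.start w.idx) (a := fun w => w.act)
    (G := fun w _ x' => Ψ (B.obs₀ w) w.act x') hstart Seed.measurable_act (fun s' => by
      refine measurable_eval (f := fun (p : Seed S A X N × X) u => Ψ (B.obs₀ p.1) u p.2)
        (fun u => ?_) (Seed.measurable_act.comp measurable_fst)
      have key := (hΨ u).comp ((B.measurable_obs₀.comp
        (measurable_fst (α := Seed S A X N) (β := X))).prodMk measurable_snd)
      exact key) (fun _ _ _ => rfl) (fun _ _ _ => rfl) (fun w r e => by
      funext _ x'
      have : B.obs₀ ((w.setTrans 0 r).setEmit (0 + 1) e) = B.obs₀ w := by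
        unfold obs₀ Seed.emit Seed.setEmit Seed.setTrans Seed.idx
        simp
      rw [this]; rfl)
  have h2 := B.lintegral_act (F := fun w u => ∑ s', ENNReal.ofReal (B.firstProb w.idx u s') *
        ∫⁻ x', Ψ (B.obs₀ w) u x' ∂(B.q s' : Measure X)) (fun u => by
      refine Finset.measurable_sum _ fun s' _ => Measurable.mul ?_ ?_
      · exact (measurable_of_countable fun i => ENNReal.ofReal (B.firstProb i u s')).comp
          Seed.measurable_idx
      · exact B.measurable_pairSum_inner (K := fun _ x x' => Ψ x u x') (fun _ => hΨ u) s')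
      (fun _ _ => rfl)
  rw [← h2]
  simp only [hT] at h1
  rw [← h1]
  refine lintegral_congr fun w => ?_
  rw [obs_eq_emit]
  rfl

theorem lintegral_second (B : BlockMDP S A X N H) {f : X → ℝ≥0∞} (hf : Measurable f) :
    ∫⁻ w, f (B.obs (fun _ _ u => u) w 1) ∂(B.seedLaw (A := A)) =
      ∑ s', ENNReal.ofReal (B.secondProb s') * ∫⁻ x', f x' ∂(B.q s' : Measure X) := by
  have hA : (0 : ℝ) < Fintype.card A := by exact_mod_cast Fintype.card_pos
  rw [B.lintegral_first (Ψ := fun _ _ x' => f x') fun u => hf.comp measurable_snd]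
  have hmp := B.measurePreserving_idx.lintegral_comp (f := fun i =>
    ∑ u : A, (Fintype.card A : ℝ≥0∞)⁻¹ * ∑ s', ENNReal.ofReal (B.firstProb i u s') *
        ∫⁻ x', f x' ∂(B.q s' : Measure X)) (measurable_of_countable _)
  rw [hmp, lintegral_pmf]
  simp only [Finset.mul_sum]
  calc _ = ∑ i, ∑ s', ∑ u : A, B.latent.μ i * ((Fintype.card A : ℝ≥0∞)⁻¹ *
        (ENNReal.ofReal (B.firstProb i u s') * ∫⁻ x', f x' ∂(B.q s' : Measure X))) :=
        Finset.sum_congr rfl fun i _ => Finset.sum_comm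
    _ = _ := by
        rw [Finset.sum_comm]
        refine Finset.sum_congr rfl fun s' _ => ?_
        simp only [← mul_assoc, ← Finset.sum_mul]
        congr 1
        unfold secondProb
        rw [ENNReal.ofReal_sum_of_nonneg fun i _ => mul_nonneg ENNReal.toReal_nonneg
          (div_nonneg (Finset.sum_nonneg fun a _ => B.latent.prob_nonneg _ _ _ _) hA.le)]
        refine Finset.sum_congr rfl fun i _ => ?_
        rw [ENNReal.ofReal_mul ENNReal.toReal_nonneg,
          ENNReal.ofReal_toReal (PMF.apply_ne_top _ _), ENNReal.ofReal_div_of_pos hA,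
          ENNReal.ofReal_sum_of_nonneg fun a _ => B.latent.prob_nonneg _ _ _ _,
          ENNReal.ofReal_natCast, div_eq_mul_inv, Finset.sum_mul, Finset.mul_sum]
        refine Finset.sum_congr rfl fun u _ => ?_
        rw [mul_assoc, mul_comm (Fintype.card A : ℝ≥0∞)⁻¹]
        rfl

/-- The law of a labelled transition. -/
theorem lintegral_sample (B : BlockMDP S A X N H) {Ψ : X → A → X → Bool → ℝ≥0∞}
    (hΨ : ∀ u b, Measurable fun p : X × X => Ψ p.1 u p.2 b) :
    ∫⁻ w₁, ∫⁻ w₂, Ψ (B.obs₀ w₁) w₁.act (if w₁.coin then B.obs (fun _ _ u => u) w₁ 1 else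
      B.obs (fun _ _ u => u) w₂ 1) w₁.coin ∂B.seedLaw ∂B.seedLaw =
      B.pairSum fun i x u s' x' => ENNReal.ofReal (B.firstProb i u s') * Ψ x u x' true +
        ENNReal.ofReal (B.secondProb s') * Ψ x u x' false := by
  have hobs := B.measurable_obs_of_policy (measurableFamily_random (X := X) (A := A)) 1
  have hΨ1 : ∀ x u b, Measurable fun x' => Ψ x u x' b := fun x u b =>
    (hΨ u b).comp measurable_prodMk_left
  have hF : ∀ b : Bool, Measurable fun w : Seed S A X N => if b then
      Ψ (B.obs₀ w) w.act (B.obs (fun _ _ u => u) w 1) true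
      else ∑ s', ENNReal.ofReal (B.secondProb s') *
        ∫⁻ x', Ψ (B.obs₀ w) w.act x' false ∂(B.q s' : Measure X) := by
    intro b
    cases b
    · simp only [Bool.false_eq_true, if_false]
      refine Finset.measurable_sum _ fun s' _ => Measurable.const_mul ?_ _
      exact measurable_eval (f := fun (w : Seed S A X N) u =>
        ∫⁻ x', Ψ (B.obs₀ w) u x' false ∂(B.q s' : Measure X)) (fun u =>
          B.measurable_pairSum_inner (K := fun _ x x' => Ψ x u x' false) (fun _ => hΨ u _) s')
          Seed.measurable_act
    · simp only [if_true]
      refine measurable_eval (f := fun (w : Seed S A X N) u =>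
        Ψ (B.obs₀ w) u (B.obs (fun _ _ u => u) w 1) true) (fun u => ?_) Seed.measurable_act
      have key := (hΨ u true).comp (B.measurable_obs₀.prodMk hobs)
      exact key
  have h1 := B.lintegral_coin (F := fun w b => if b then
      Ψ (B.obs₀ w) w.act (B.obs (fun _ _ u => u) w 1) true
      else ∑ s', ENNReal.ofReal (B.secondProb s') *
        ∫⁻ x', Ψ (B.obs₀ w) w.act x' false ∂(B.q s' : Measure X)) hF (fun w b => rfl)
  -- The second episode matters only for an imposter, where its observation is integrated out as a
  -- mixture with weights `secondProb`.
  have h2 : ∀ w₁ : Seed S A X N, ∫⁻ w₂, Ψ (B.obs₀ w₁) w₁.act (if w₁.coin then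
      B.obs (fun _ _ u => u) w₁ 1 else B.obs (fun _ _ u => u) w₂ 1) w₁.coin ∂B.seedLaw =
      if w₁.coin then Ψ (B.obs₀ w₁) w₁.act (B.obs (fun _ _ u => u) w₁ 1) true
      else ∑ s', ENNReal.ofReal (B.secondProb s') *
        ∫⁻ x', Ψ (B.obs₀ w₁) w₁.act x' false ∂(B.q s' : Measure X) := by
    intro w₁
    cases hc : w₁.coin
    · simp only [Bool.false_eq_true, if_false]
      exact B.lintegral_second (hΨ1 _ _ _)
    · simp
  simp only [h2]
  rw [h1]
  simp only [Bool.false_eq_true, if_false, if_true]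
  rw [pairSum_add]
  · congr 1
    · rw [B.lintegral_first (Ψ := fun x u x' => Ψ x u x' true) fun u => hΨ u _, pairSum,
        ← lintegral_const_mul' _ _ (by simp)]
      refine lintegral_congr fun w => ?_
      simp only [Finset.mul_sum]
      refine Finset.sum_congr rfl fun u _ => Finset.sum_congr rfl fun s' _ => ?_
      rw [lintegral_const_mul _ (hΨ1 _ _ _)]
      ring
    · rw [B.lintegral_act (F := fun w u => ∑ s', ENNReal.ofReal (B.secondProb s') *
        ∫⁻ x', Ψ (B.obs₀ w) u x' false ∂(B.q s' : Measure X)) (fun u =>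
          Finset.measurable_sum _ fun s' _ => Measurable.const_mul (B.measurable_pairSum_inner
            (K := fun _ x x' => Ψ x u x' false) (fun _ => hΨ u _) s') _) (fun _ _ => rfl), pairSum,
        ← lintegral_const_mul' _ _ (by simp)]
      refine lintegral_congr fun w => ?_
      simp only [Finset.mul_sum]
      refine Finset.sum_congr rfl fun u _ => Finset.sum_congr rfl fun s' _ => ?_
      rw [lintegral_const_mul _ (hΨ1 _ _ _)]
      ring
  · exact fun i u s' => (hΨ u true).const_mul _

end BlockMDP

end

noncomputable section

/-! ### Least squares for the clustering function -/

/-- Use `exp z ≤ 1 + z + z ^ 2` for `|z| ≤ 1`. As `y` is the regression function, the linear terms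
average to `-(T + ϱ) * (h - y) ^ 2 / 8`; the quadratic ones are at most half as large because the
loss difference is at most `2 * |h - y|`. Half of the gain remains, which yields the rate `1 / n`
and not `1 / √n`. -/
theorem exp_excess_le {T ϱ y h : ℝ} (hT : 0 ≤ T) (hϱ : 0 ≤ ϱ) (hy : y ∈ Set.Icc (0 : ℝ) 1)
    (hh : h ∈ Set.Icc (0 : ℝ) 1) (hTy : T = (T + ϱ) * y) :
    T * Real.exp (((y - 1) ^ 2 - (h - 1) ^ 2) / 8) + ϱ * Real.exp ((y ^ 2 - h ^ 2) / 8) +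
      16⁻¹ * ((T + ϱ) * (h - y) ^ 2) ≤ T + ϱ := by
  obtain ⟨hy0, hy1⟩ := hy
  obtain ⟨hh0, hh1⟩ := hh
  have key : ∀ z : ℝ, |z| ≤ 2 * |h - y| →
      Real.exp (z / 8) ≤ 1 + z / 8 + (h - y) ^ 2 / 16 := by
    intro z hz
    have h1 : |h - y| ≤ 1 := abs_le.2 ⟨by linarith, by linarith⟩
    have h2 : |z / 8| ≤ 1 := by
      rw [abs_div, abs_of_pos (by norm_num : (0 : ℝ) < 8)]
      linarith
    have h3 := abs_le.1 (Real.abs_exp_sub_one_sub_id_le h2)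
    have h4 : z ^ 2 ≤ 4 * (h - y) ^ 2 := by
      rw [← sq_abs z, ← sq_abs (h - y)]
      nlinarith [abs_nonneg z, abs_nonneg (h - y)]
    nlinarith [h3.2]
  have e1 := key ((y - 1) ^ 2 - (h - 1) ^ 2) (by
    rw [show (y - 1) ^ 2 - (h - 1) ^ 2 = (2 - h - y) * (h - y) by ring, abs_mul]
    gcongr
    exact abs_le.2 ⟨by linarith, by linarith⟩)
  have e2 := key (y ^ 2 - h ^ 2) (by
    rw [show y ^ 2 - h ^ 2 = -(h + y) * (h - y) by ring, abs_mul]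
    gcongr
    exact abs_le.2 ⟨by linarith, by linarith⟩)
  have e3 := mul_le_mul_of_nonneg_left e1 hT
  have e4 := mul_le_mul_of_nonneg_left e2 hϱ
  have e5 : T * ((y - 1) ^ 2 - (h - 1) ^ 2) + ϱ * (y ^ 2 - h ^ 2) = -(T + ϱ) * (h - y) ^ 2 := by
    linear_combination (2 * h - 2 * y) * hTy
  nlinarith

namespace BlockMDP

variable {S A X κ l : Type*} {N H : ℕ} [Fintype S] [MeasurableSpace S] [MeasurableSingletonClass S]
  [Fintype A] [Nonempty A] [MeasurableSpace A] [MeasurableSingletonClass A] [MeasurableSpace X]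
  [Nonempty X]

theorem le_secondProb (B : BlockMDP S A X N H) (i : Fin N) (u : A) (s' : S) :
    (B.latent.μ i).toReal * (B.firstProb i u s' / Fintype.card A) ≤ B.secondProb s' := by
  have h0 : ∀ i a, 0 ≤ B.latent.prob 0 (B.latent.start i) a s' := fun i a =>
    B.latent.prob_nonneg _ _ _ _
  refine le_trans ?_ (Finset.single_le_sum (f := fun i => (B.latent.μ i).toReal *
    ((∑ a, B.latent.prob 0 (B.latent.start i) a s') / Fintype.card A))
    (fun i _ => mul_nonneg ENNReal.toReal_nonneg
      (div_nonneg (Finset.sum_nonneg fun a _ => h0 i a) (by positivity))) (Finset.mem_univ i))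
  gcongr
  exact Finset.single_le_sum (f := fun a => B.latent.prob 0 (B.latent.start i) a s')
    (fun a _ => h0 i a) (Finset.mem_univ u)

/-- Probability that a transition to `s'` is real rather than an imposter. -/
def bayes (B : BlockMDP S A X N H) (i : Fin N) (u : A) (s' : S) : ℝ :=
  B.firstProb i u s' / (B.firstProb i u s' + B.secondProb s')

/-- The excess risk of a classifier (up to a factor). -/
def excess (B : BlockMDP S A X N H) (h : X → A → X → ℝ) : ℝ≥0∞ :=
  B.pairSum fun i x u s' x' => ENNReal.ofReal
    ((B.firstProb i u s' + B.secondProb s') * (h x u x' - B.bayes i u s') ^ 2)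

/-- `exp_excess_le` integrated against the law of a labelled transition. The total mass is one: real
and imposter transitions contribute one half each. -/
theorem lintegral_sample_exp_add_le (B : BlockMDP S A X N H)
    (hμ : ∀ i, 0 < (B.latent.μ i).toReal) {h h₀ : X → A → X → ℝ}
    (hm : ∀ u, Measurable fun p : X × X => h p.1 u p.2)
    (hm₀ : ∀ u, Measurable fun p : X × X => h₀ p.1 u p.2)
    (hh : ∀ x u x', h x u x' ∈ Set.Icc (0 : ℝ) 1)
    (hreal : ∀ i a s', 0 < B.secondProb s' →
      ∀ᵐ x ∂(B.q (B.latent.start i) : Measure X), ∀ᵐ x' ∂(B.q s' : Measure X),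
        h₀ x a x' = B.bayes i a s') :
    (B.pairSum fun i x u s' x' => ENNReal.ofReal (B.firstProb i u s') *
        ENNReal.ofReal (Real.exp (((h₀ x u x' - 1) ^ 2 - (h x u x' - 1) ^ 2) / 8)) +
      ENNReal.ofReal (B.secondProb s') *
        ENNReal.ofReal (Real.exp ((h₀ x u x' ^ 2 - h x u x' ^ 2) / 8))) +
      16⁻¹ * B.excess h ≤ 1 := by
  have hA : (0 : ℝ) < Fintype.card A := by exact_mod_cast Fintype.card_pos
  have hae : ∀ᵐ w ∂(B.seedLaw (A := A)), ∀ u s', 0 < B.secondProb s' →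
      ∀ᵐ x' ∂(B.q s' : Measure X), h₀ (B.obs₀ w) u x' = B.bayes w.idx u s' := by
    have := B.ae_emit (A := A) (P := fun s x => ∀ i, B.latent.start i = s → ∀ a s',
      0 < B.secondProb s' → ∀ᵐ x' ∂(B.q s' : Measure X), h₀ x a x' = B.bayes i a s') (by
      intro s
      rw [ae_all_iff]; intro i
      by_cases hs : B.latent.start i = s
      · subst hs
        have h2 : ∀ᵐ x ∂(B.q (B.latent.start i) : Measure X), ∀ a s', 0 < B.secondProb s' →
            ∀ᵐ x' ∂(B.q s' : Measure X), h₀ x a x' = B.bayes i a s' := by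
          rw [ae_all_iff]; intro a
          rw [ae_all_iff]; intro s'
          by_cases hp : 0 < B.secondProb s'
          · filter_upwards [hreal i a s' hp] with x hx _ using hx
          · exact Filter.Eventually.of_forall fun x hx => absurd hx hp
        filter_upwards [h2] with x hx _ using hx
      · exact Filter.Eventually.of_forall fun x hx => absurd hx hs)
    filter_upwards [this] with w hw u s' hp
    exact hw 0 _ w.idx rfl u s' hp
  unfold excess
  rw [← pairSum_const_mul _ _ (by simp), ← pairSum_add]
  swap
  · intro i u s'
    have h1 := hm u
    have h2 := hm₀ u
    fun_prop
  calc _ ≤ B.pairSum fun i (_ : X) u s' (_ : X) =>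
        ENNReal.ofReal (B.firstProb i u s' + B.secondProb s') := by
        refine B.pairSum_mono_ae ?_
        filter_upwards [hae] with w hw u s'
        set T := B.firstProb w.idx u s' with hT
        set ϱ := B.secondProb s' with hϱ
        have hT0 : 0 ≤ T := B.firstProb_nonneg _ _ _
        have hϱ0 : 0 ≤ ϱ := B.secondProb_nonneg _
        rcases hϱ0.eq_or_lt with h0 | hpos
        -- Realizability is silent about states of marginal probability zero. Since every initial
        -- state has positive mass, such a state is not reached by a real transition either, and all
        -- terms vanish.
        · have hT1 : T = 0 := by
            have := B.le_secondProb w.idx u s'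
            rw [← hϱ, ← h0, ← hT] at this
            have h2 : T / Fintype.card A ≤ 0 := nonpos_of_mul_nonpos_right this (hμ w.idx)
            have h3 : T ≤ 0 := by
              by_contra hc
              exact absurd h2 (not_le.2 (div_pos (not_le.1 hc) hA))
            linarith
          refine Filter.Eventually.of_forall fun x' => ?_
          simp [hT1, ← h0]
        · filter_upwards [hw u s' hpos] with x' hx'
          have hy : B.bayes w.idx u s' ∈ Set.Icc (0 : ℝ) 1 := by
            unfold bayes
            rw [← hT, ← hϱ]
            exact ⟨by positivity, div_le_one_of_le₀ (by linarith) (by linarith)⟩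
          have hTy : T = (T + ϱ) * B.bayes w.idx u s' := by
            unfold bayes
            rw [← hT, ← hϱ]
            field_simp
          rw [hx']
          have h16 : (16⁻¹ : ℝ≥0∞) = ENNReal.ofReal 16⁻¹ := by
            rw [ENNReal.ofReal_inv_of_pos (by norm_num)]; norm_num
          rw [h16, ← ENNReal.ofReal_mul hT0, ← ENNReal.ofReal_mul hϱ0,
            ← ENNReal.ofReal_mul (by norm_num), ← ENNReal.ofReal_add (by positivity) (by positivity),
            ← ENNReal.ofReal_add (by positivity) (by positivity)]
          exact ENNReal.ofReal_le_ofReal (exp_excess_le hT0 hϱ0 hy (hh _ _ _) hTy)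
    _ = 1 := by
        have h1 : ∀ (i : Fin N) (u : A), ∑ s', 2⁻¹ *
            ENNReal.ofReal (B.firstProb i u s' + B.secondProb s') = 1 := by
          intro i u
          rw [← Finset.mul_sum, ← ENNReal.ofReal_sum_of_nonneg fun s' _ =>
            add_nonneg (B.firstProb_nonneg _ _ _) (B.secondProb_nonneg _),
            Finset.sum_add_distrib, B.sum_firstProb, B.sum_secondProb]
          norm_num
          exact ENNReal.inv_mul_cancel (by norm_num) (by norm_num)
        unfold pairSum
        simp only [lintegral_const, measure_univ, mul_one, h1, Finset.sum_const, Finset.card_univ,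
          nsmul_eq_mul]
        exact ENNReal.mul_inv_cancel (by simp) (by simp)

end BlockMDP

/-! ### Concentration of the least-squares fit -/

section Erm

variable {S A X κ l : Type*} {N H : ℕ} [Fintype S] [MeasurableSpace S] [MeasurableSingletonClass S]
  [Fintype A] [Nonempty A] [MeasurableSpace A] [MeasurableSingletonClass A] [MeasurableSpace X]
  [Nonempty X] {B : BlockMDP S A X N H} {G : κ → Fin N → A → X → ℝ} {Φ : l → X → Fin N}
  {erm : (n : ℕ) → (Fin n → X × A × X × Bool) → κ × l}

theorem measurable_classifier (hG : ∀ g i a, Measurable (G g i a)) (hΦ : ∀ p, Measurable (Φ p))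
    (g : κ) (p : l) (u : A) : Measurable fun z : X × X => G g (Φ p z.1) u z.2 :=
  measurable_eval (f := fun (z : X × X) i => G g i u z.2)
    (fun i => (hG g i u).comp measurable_snd) ((hΦ p).comp measurable_fst)

/-- If `r` is selected, its empirical loss does not exceed that of the Bayes classifier and the
product of the exponentials is at least one; Markov's inequality with independent samples bounds
this. Finiteness of the excess comes out of the same inequality. -/
theorem measure_erm_le (hμ : ∀ i, 0 < (B.latent.μ i).toReal) (hG : ∀ g i a, Measurable (G g i a))
    (hG01 : ∀ g i a x, G g i a x ∈ Set.Icc (0 : ℝ) 1) (hΦ : ∀ p, Measurable (Φ p))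
    (hreal : B.RealizableClassifier G Φ) (herm : IsERM G Φ erm) (n : ℕ) (r : κ × l) :
    B.excess (fun x u x' => G r.1 (Φ r.2 x) u x') ≠ ∞ ∧
    B.runLaw {ω | erm n (clusterData B n ω) = r} ≤ ENNReal.ofReal
      (Real.exp (-(n * ((B.excess fun x u x' => G r.1 (Φ r.2 x) u x').toReal / 16)))) := by
  obtain ⟨g₀, p₀, h₀⟩ := hreal
  set h : X → A → X → ℝ := fun x u x' => G r.1 (Φ r.2 x) u x' with hh
  set k : X → A → X → ℝ := fun x u x' => G g₀ (Φ p₀ x) u x' with hk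
  set Ψ : X → A → X → Bool → ℝ≥0∞ := fun x u x' b => ENNReal.ofReal (Real.exp
    (((k x u x' - if b then 1 else 0) ^ 2 - (h x u x' - if b then 1 else 0) ^ 2) / 8)) with hΨdef
  have hΨ : ∀ u b, Measurable fun p : X × X => Ψ p.1 u p.2 b := by
    intro u b
    have h1 : Measurable fun p : X × X => h p.1 u p.2 := measurable_classifier hG hΦ _ _ u
    have h2 : Measurable fun p : X × X => k p.1 u p.2 := measurable_classifier hG hΦ _ _ u
    simp only [hΨdef]
    fun_prop
  set ψ : Seed S A X N → Seed S A X N → ℝ≥0∞ := fun w₁ w₂ =>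
    Ψ (B.obs₀ w₁) w₁.act (if w₁.coin then B.obs (fun _ _ u => u) w₁ 1 else
      B.obs (fun _ _ u => u) w₂ 1) w₁.coin with hψdef
  have hobs := B.measurable_obs_of_policy (measurableFamily_random (X := X) (A := A)) 1
  have hψ : Measurable fun p : Seed S A X N × Seed S A X N => ψ p.1 p.2 := by
    have hx : Measurable fun p : Seed S A X N × Seed S A X N =>
        if p.1.coin then B.obs (fun _ _ u => u) p.1 1 else B.obs (fun _ _ u => u) p.2 1 :=
      Measurable.ite ((Seed.measurable_coin.comp measurable_fst) (measurableSet_singleton true))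
        (hobs.comp measurable_fst) (hobs.comp measurable_snd)
    refine measurable_eval (f := fun (p : Seed S A X N × Seed S A X N) (z : A × Bool) =>
      Ψ (B.obs₀ p.1) z.1 (if p.1.coin then B.obs (fun _ _ u => u) p.1 1 else
        B.obs (fun _ _ u => u) p.2 1) z.2) (fun z => ?_)
      ((Seed.measurable_act.comp measurable_fst).prodMk (Seed.measurable_coin.comp measurable_fst))
    have key := (hΨ z.1 z.2).comp ((B.measurable_obs₀.comp
      (measurable_fst (α := Seed S A X N) (β := Seed S A X N))).prodMk hx)
    exact key
  have hE := B.lintegral_sample hΨ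
  have hle := B.lintegral_sample_exp_add_le hμ (h := h) (h₀ := k)
    (fun u => measurable_classifier hG hΦ _ _ u) (fun u => measurable_classifier hG hΦ _ _ u)
    (fun _ _ _ => hG01 _ _ _ _) (fun i a s' hp => h₀ i a s' hp)
  set E := ∫⁻ w₁, ∫⁻ w₂, ψ w₁ w₂ ∂B.seedLaw ∂B.seedLaw with hEdef
  have hle' : E + 16⁻¹ * B.excess h ≤ 1 := by
    rw [hE]
    simpa [hΨdef] using hle
  have hfin : B.excess h ≠ ∞ := by
    intro hc
    rw [hc, ENNReal.mul_top (by simp), add_top] at hle'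
    simp at hle'
  refine ⟨hfin, ?_⟩
  have hE1 : E ≤ ENNReal.ofReal (Real.exp (-((B.excess h).toReal / 16))) := by
    have hEfin : E ≠ ∞ := ne_top_of_le_ne_top ENNReal.one_ne_top (le_self_add.trans hle')
    rw [← ENNReal.ofReal_toReal hEfin]
    refine ENNReal.ofReal_le_ofReal ?_
    have h1 := ENNReal.toReal_mono ENNReal.one_ne_top hle'
    rw [ENNReal.toReal_add hEfin (ENNReal.mul_ne_top (by simp) hfin), ENNReal.toReal_mul,
      ENNReal.toReal_one] at h1
    have h2 := Real.add_one_le_exp (-((B.excess h).toReal / 16))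
    have h3 : ((16⁻¹ : ℝ≥0∞)).toReal = 1 / 16 := by norm_num
    rw [h3] at h1
    linarith
  have hsub : {ω | erm n (clusterData B n ω) = r} ⊆
      {ω | 1 ≤ ∏ k ∈ Finset.range n, ψ (ω (2 * k)) (ω (2 * k + 1))} := by
    intro ω hω
    have h1 := herm.1 n (clusterData B n ω) g₀ p₀
    rw [show erm n (clusterData B n ω) = r from hω] at h1
    unfold sqLoss at h1
    have h2 : ∀ j : Fin n, ψ (ω (2 * j)) (ω (2 * j + 1)) = ENNReal.ofReal (Real.exp
        (((G g₀ (Φ p₀ (clusterData B n ω j).1) (clusterData B n ω j).2.1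
          (clusterData B n ω j).2.2.1 - if (clusterData B n ω j).2.2.2 then 1 else 0) ^ 2 -
         (G r.1 (Φ r.2 (clusterData B n ω j).1) (clusterData B n ω j).2.1
          (clusterData B n ω j).2.2.1 - if (clusterData B n ω j).2.2.2 then 1 else 0) ^ 2) / 8)) :=
      fun j => rfl
    simp only [Set.mem_ofPred_eq]
    rw [← Fin.prod_univ_eq_prod_range (fun k => ψ (ω (2 * k)) (ω (2 * k + 1))) n,
      Finset.prod_congr rfl fun j _ => h2 j, ← ENNReal.ofReal_prod_of_nonneg
        fun _ _ => (Real.exp_pos _).le, ← Real.exp_sum, ← ENNReal.ofReal_one]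
    refine ENNReal.ofReal_le_ofReal (Real.one_le_exp ?_)
    rw [← Finset.sum_div, Finset.sum_sub_distrib]
    linarith
  calc B.runLaw {ω | erm n (clusterData B n ω) = r}
      ≤ B.runLaw {ω | 1 ≤ ∏ k ∈ Finset.range n, ψ (ω (2 * k)) (ω (2 * k + 1))} :=
        measure_mono hsub
    _ ≤ ∫⁻ ω, ∏ k ∈ Finset.range n, ψ (ω (2 * k)) (ω (2 * k + 1)) ∂B.runLaw := by
        have := mul_meas_ge_le_lintegral (μ := B.runLaw)
          (f := fun ω => ∏ k ∈ Finset.range n, ψ (ω (2 * k)) (ω (2 * k + 1)))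
          (Finset.measurable_prod _ fun k _ => by
            have key := hψ.comp ((measurable_pi_apply (X := fun _ : ℕ => Seed S A X N)
              (2 * k)).prodMk (measurable_pi_apply (X := fun _ : ℕ => Seed S A X N) (2 * k + 1)))
            exact key) 1
        simpa using this
    _ ≤ E ^ n := lintegral_prod_pairs_le B.seedLaw hψ n
    _ ≤ _ := by
        refine (pow_le_pow_left' hE1 n).trans_eq ?_
        rw [← ENNReal.ofReal_pow (Real.exp_pos _).le, ← Real.exp_nat_mul]
        congr 2
        ring

/-- The excess risk of the learned classifier. -/
theorem measure_excess_erm_le [Fintype κ] [Fintype l] (hμ : ∀ i, 0 < (B.latent.μ i).toReal)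
    (hG : ∀ g i a, Measurable (G g i a))
    (hG01 : ∀ g i a x, G g i a x ∈ Set.Icc (0 : ℝ) 1) (hΦ : ∀ p, Measurable (Φ p))
    (hreal : B.RealizableClassifier G Φ) (herm : IsERM G Φ erm) {n : ℕ} (hn : 0 < n) {δ : ℝ}
    (hδ : 0 < δ) :
    B.runLaw {ω | ENNReal.ofReal (16 * Real.log (Fintype.card κ * Fintype.card l / δ) / n) <
      B.excess fun x u x' => G (erm n (clusterData B n ω)).1
        (Φ (erm n (clusterData B n ω)).2 x) u x'} ≤ ENNReal.ofReal δ := by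
  classical
  obtain ⟨g₀, p₀, -⟩ := id hreal
  have hκ : (0 : ℝ) < Fintype.card κ := by exact_mod_cast Fintype.card_pos_iff.2 ⟨g₀⟩
  have hl : (0 : ℝ) < Fintype.card l := by exact_mod_cast Fintype.card_pos_iff.2 ⟨p₀⟩
  have hn' : (0 : ℝ) < n := by exact_mod_cast hn
  set Λ := Real.log (Fintype.card κ * Fintype.card l / δ) with hΛ
  set V : κ × l → ℝ≥0∞ := fun r => B.excess fun x u x' => G r.1 (Φ r.2 x) u x' with hV
  set T : Finset (κ × l) := Finset.univ.filter fun r => ENNReal.ofReal (16 * Λ / n) < V r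
  have hsub : {ω | ENNReal.ofReal (16 * Λ / n) < V (erm n (clusterData B n ω))} ⊆
      ⋃ r ∈ T, {ω | erm n (clusterData B n ω) = r} := by
    intro ω hω
    simp only [Set.mem_iUnion]
    exact ⟨_, Finset.mem_filter.2 ⟨Finset.mem_univ _, hω⟩, rfl⟩
  refine (measure_mono hsub).trans ((measure_biUnion_finset_le _ _).trans ?_)
  calc ∑ r ∈ T, B.runLaw {ω | erm n (clusterData B n ω) = r}
      ≤ ∑ r ∈ T, ENNReal.ofReal (δ / (Fintype.card κ * Fintype.card l)) := by
        refine Finset.sum_le_sum fun r hr => ?_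
        obtain ⟨hfin, hle⟩ := measure_erm_le hμ hG hG01 hΦ hreal herm n r
        refine hle.trans (ENNReal.ofReal_le_ofReal ?_)
        have h1 : 16 * Λ / n < (V r).toReal :=
          not_le.1 fun hc => absurd (ENNReal.le_ofReal_iff_toReal_le hfin
            (ENNReal.toReal_nonneg.trans hc) |>.2 hc) (not_le.2 (Finset.mem_filter.1 hr).2)
        rw [div_lt_iff₀ hn'] at h1
        calc Real.exp (-(n * ((V r).toReal / 16))) ≤ Real.exp (-Λ) := by
              refine Real.exp_le_exp.2 ?_
              linarith
          _ = _ := by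
              rw [hΛ, Real.exp_neg, Real.exp_log (by positivity), inv_div]
    _ ≤ ∑ _r : κ × l, ENNReal.ofReal (δ / (Fintype.card κ * Fintype.card l)) :=
        Finset.sum_le_sum_of_subset (Finset.subset_univ _)
    _ = ENNReal.ofReal δ := by
        rw [Finset.sum_const, Finset.card_univ, Fintype.card_prod, nsmul_eq_mul, Nat.cast_mul,
          ← ENNReal.ofReal_natCast, ← ENNReal.ofReal_natCast, ← ENNReal.ofReal_mul hκ.le,
          ← ENNReal.ofReal_mul (by positivity)]
        congr 1
        field_simp

end Erm

end

noncomputable section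

/-! ### A small excess risk separates the initial states -/

/-- The difference of the posteriors equals `ϱ * (T - T') / ((T + ϱ) * (T' + ϱ))`, and each factor
of the denominator is at most `2 * ϱ / k`. Thus separated transitions have separated Bayes
classifiers. -/
theorem abs_sub_le_of_bayes {k T T' ϱ : ℝ} (hk : 0 < k) (hk1 : k ≤ 1) (hT : 0 ≤ T) (hT' : 0 ≤ T')
    (hϱ : 0 ≤ ϱ) (h : k * T ≤ ϱ) (h' : k * T' ≤ ϱ) :
    k ^ 2 * |T - T'| ≤ 4 * (ϱ * |T / (T + ϱ) - T' / (T' + ϱ)|) := by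
  rcases hϱ.eq_or_lt with h0 | hpos
  · subst h0
    have h1 : T = 0 := le_antisymm (nonpos_of_mul_nonpos_right h hk) hT
    have h2 : T' = 0 := le_antisymm (nonpos_of_mul_nonpos_right h' hk) hT'
    simp [h1, h2]
  · have e : T / (T + ϱ) - T' / (T' + ϱ) = ϱ * (T - T') / ((T + ϱ) * (T' + ϱ)) := by
      field_simp
      ring
    rw [e, abs_div, abs_mul, abs_of_pos hpos, abs_of_pos (by positivity : 0 < (T + ϱ) * (T' + ϱ)),
      mul_div_assoc', mul_div_assoc', le_div_iff₀ (by positivity)]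
    have h1 : k * (T + ϱ) ≤ 2 * ϱ := by nlinarith
    have h2 : k * (T' + ϱ) ≤ 2 * ϱ := by nlinarith
    have h3 : (k * (T + ϱ)) * (k * (T' + ϱ)) ≤ (2 * ϱ) * (2 * ϱ) := by gcongr
    nlinarith [abs_nonneg (T - T')]

/-- If different rows of a nonnegative matrix hardly overlap in any column, then every column is
almost concentrated in one row. -/
theorem exists_dominant_row {N : ℕ} {m : Fin N → Fin N → ℝ} {μ τ r : ℝ}
    (hsum : ∀ j, μ ≤ ∑ i, m j i) (hmin : ∀ j j' i, j ≠ j' → min (m j i) (m j' i) ≤ τ)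
    (hτ0 : 0 ≤ τ) (hτ : N * τ < μ) (hr : 0 ≤ r) (hτr : (N : ℝ) ^ 2 * τ ≤ r * μ) (i : Fin N) :
    ∃ j, 0 < m j i ∧ ∑ j' ∈ Finset.univ.erase j, m j' i ≤ r * m j i := by
  classical
  have hN : (0 : ℝ) < N := by exact_mod_cast i.pos
  -- Each row has an entry at least its share `μ / N`, which exceeds `τ`; no column can serve two
  -- rows, so the assignment is injective and, the matrix being square, hits every column.
  have hbig : ∀ j, ∃ i, μ / N ≤ m j i := by
    intro j
    by_contra! hc
    have := Finset.sum_lt_sum_of_nonempty (s := Finset.univ) ⟨i, Finset.mem_univ i⟩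
      fun i _ => hc i
    rw [Finset.sum_const, Finset.card_univ, Fintype.card_fin, nsmul_eq_mul,
      mul_div_cancel₀ _ hN.ne'] at this
    exact absurd (hsum j) (not_le.2 this)
  choose f hf using hbig
  have hτ' : τ < μ / N := by rw [lt_div_iff₀ hN]; linarith
  have hinj : Function.Injective f := by
    intro j j' hjj
    by_contra hne
    have h1 := hmin j j' (f j) hne
    have h2 := hf j'
    rw [← hjj] at h2
    exact absurd h1 (not_le.2 (lt_min (hτ'.trans_le (hf j)) (hτ'.trans_le h2)))
  obtain ⟨j, rfl⟩ := Finite.surjective_of_injective hinj i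
  refine ⟨j, (hτ0.trans_lt hτ').trans_le (hf j), ?_⟩
  calc ∑ j' ∈ Finset.univ.erase j, m j' (f j) ≤ ∑ _j' ∈ Finset.univ.erase j, τ := by
        refine Finset.sum_le_sum fun j' hj' => ?_
        have h1 := hmin j j' (f j) (Finset.ne_of_mem_erase hj').symm
        exact (min_le_iff.1 h1).resolve_left (not_le.2 (hτ'.trans_le (hf j)))
    _ ≤ N * τ := by
        rw [Finset.sum_const, nsmul_eq_mul]
        gcongr
        exact (Finset.card_le_univ _).trans_eq (Fintype.card_fin N)
    _ ≤ r * (μ / N) := by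
        rw [mul_div_assoc', le_div_iff₀ hN]
        linarith
    _ ≤ _ := by gcongr; exact hf j

namespace BlockMDP

variable {S A X : Type*} {N H : ℕ} [Fintype S] [MeasurableSpace S] [MeasurableSingletonClass S]
  [Fintype A] [Nonempty A] [MeasurableSpace A] [MeasurableSingletonClass A] [MeasurableSpace X]
  [Nonempty X]

/-- The error of the prediction `c`, given the initial state `j`. -/
def stateExcess (B : BlockMDP S A X N H) (c : A → X → ℝ) (j : Fin N) : ℝ≥0∞ :=
  ∑ u, (Fintype.card A : ℝ≥0∞)⁻¹ * ∑ s', 2⁻¹ * ∫⁻ x', ENNReal.ofReal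
    ((B.firstProb j u s' + B.secondProb s') * (c u x' - B.bayes j u s') ^ 2) ∂(B.q s' : Measure X)

/-- Restrict the expectation to the two disjoint events. In cluster `i` the same prediction `c i` is
charged against the Bayes classifiers of both states. -/
theorem le_excess (B : BlockMDP S A X N H) {φ : X → Fin N} (hφ : Measurable φ)
    (c : Fin N → A → X → ℝ) (i : Fin N) {j j' : Fin N} (hj : j ≠ j') :
    B.stateExcess (c i) j * B.seedLaw (A := A) (B.clusterEvent φ i ∩ {w | w.idx = j}) +
      B.stateExcess (c i) j' * B.seedLaw (A := A) (B.clusterEvent φ i ∩ {w | w.idx = j'}) ≤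
      B.excess fun x u x' => c (φ x) u x' := by
  have hm : ∀ j, MeasurableSet (B.clusterEvent (A := A) φ i ∩ {w | w.idx = j}) := fun j =>
    (B.measurableSet_clusterEvent hφ i).inter (Seed.measurable_idx (measurableSet_singleton j))
  rw [← lintegral_indicator_const (hm j), ← lintegral_indicator_const (hm j'),
    ← lintegral_add_left (measurable_const.indicator (hm j))]
  refine lintegral_mono fun w => ?_
  by_cases hw : w ∈ B.clusterEvent φ i
  · have hw' : φ (B.obs₀ w) = i := hw
    by_cases h1 : w.idx = j
    · have h2 : w.idx ≠ j' := fun h => hj (h1.symm.trans h)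
      simp [hw, h1, hw', hj, stateExcess]
    · by_cases h2 : w.idx = j'
      · simp [hw, h2, hw', hj.symm, stateExcess]
      · simp [h1, h2]
  · simp [hw]

/-- Whatever `c` predicts, its squared distances to two numbers sum to at least half their squared
difference. The resulting `secondProb`-weighted square distance of the Bayes classifiers is bounded
below through their total variation. -/
theorem le_stateExcess_add (B : BlockMDP S A X N H) {k Γ : ℝ} (hk : 0 < k) (hk1 : k ≤ 1)
    (hkT : ∀ i u s', k * B.firstProb i u s' ≤ B.secondProb s') (hΓ : 0 ≤ Γ)
    (hmargin : B.InitialMargin Γ) {c : A → X → ℝ} (hc : ∀ u, Measurable (c u)) {j j' : Fin N}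
    (hj : j ≠ j') :
    ENNReal.ofReal (k ^ 4 * Γ ^ 2 / 16) ≤ B.stateExcess c j + B.stateExcess c j' := by
  have hpt : ∀ u s', ENNReal.ofReal (B.secondProb s' * (B.bayes j u s' - B.bayes j' u s') ^ 2 / 4) ≤
      2⁻¹ * ∫⁻ x', ENNReal.ofReal ((B.firstProb j u s' + B.secondProb s') *
        (c u x' - B.bayes j u s') ^ 2) ∂(B.q s' : Measure X) +
      2⁻¹ * ∫⁻ x', ENNReal.ofReal ((B.firstProb j' u s' + B.secondProb s') *
        (c u x' - B.bayes j' u s') ^ 2) ∂(B.q s' : Measure X) := by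
    intro u s'
    have hϱ := B.secondProb_nonneg s'
    have hT := B.firstProb_nonneg j u s'
    have hT' := B.firstProb_nonneg j' u s'
    have hcu := hc u
    rw [← mul_add, ← lintegral_add_left (by fun_prop)]
    have h2 : (2⁻¹ : ℝ≥0∞) = ENNReal.ofReal 2⁻¹ := by
      rw [ENNReal.ofReal_inv_of_pos (by norm_num)]; norm_num
    calc _ = 2⁻¹ * ∫⁻ _x', ENNReal.ofReal
          (B.secondProb s' * (B.bayes j u s' - B.bayes j' u s') ^ 2 / 2) ∂(B.q s' : Measure X) := by
          rw [lintegral_const, measure_univ, mul_one, h2, ← ENNReal.ofReal_mul (by norm_num)]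
          congr 1
          ring
      _ ≤ _ := by
          gcongr with x'
          rw [← ENNReal.ofReal_add (by positivity) (by positivity)]
          refine ENNReal.ofReal_le_ofReal ?_
          set a := B.bayes j u s'
          set b := B.bayes j' u s'
          have h3 : (a - b) ^ 2 / 2 ≤ (c u x' - a) ^ 2 + (c u x' - b) ^ 2 := by
            nlinarith [sq_nonneg (2 * c u x' - a - b)]
          have h4 := mul_le_mul_of_nonneg_left h3 hϱ
          have h5 := mul_nonneg hT (sq_nonneg (c u x' - a))
          have h6 := mul_nonneg hT' (sq_nonneg (c u x' - b))
          linarith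
  have hu : ∀ u, ENNReal.ofReal (k ^ 4 * Γ ^ 2 / 16) ≤ ∑ s', ENNReal.ofReal
      (B.secondProb s' * (B.bayes j u s' - B.bayes j' u s') ^ 2 / 4) := by
    intro u
    rw [← ENNReal.ofReal_sum_of_nonneg fun s' _ => by
      have := B.secondProb_nonneg s'
      positivity]
    refine ENNReal.ofReal_le_ofReal ?_
    have hs := hmargin j j' hj u
    -- Cauchy–Schwarz in linearized form, `x ^ 2 ≥ 2 * lam * x - lam ^ 2`, with the optimal `lam = k
    -- ^ 2 * Γ / 2`; the weights `secondProb` sum to one.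
    have h1 : ∀ s', k ^ 2 * Γ / 2 * (k ^ 2 / 2 * |B.firstProb j u s' - B.firstProb j' u s'|) -
        (k ^ 2 * Γ / 2) ^ 2 * B.secondProb s' ≤
        B.secondProb s' * (B.bayes j u s' - B.bayes j' u s') ^ 2 := by
      intro s'
      have h2 := abs_sub_le_of_bayes hk hk1 (B.firstProb_nonneg j u s')
        (B.firstProb_nonneg j' u s') (B.secondProb_nonneg s') (hkT _ _ _) (hkT _ _ _)
      change _ ≤ 4 * (_ * |B.bayes j u s' - B.bayes j' u s'|) at h2
      rw [← sq_abs (B.bayes j u s' - B.bayes j' u s')]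
      set δ := |B.bayes j u s' - B.bayes j' u s'|
      set lam := k ^ 2 * Γ / 2 with hlam
      have hlam0 : 0 ≤ lam := by positivity
      have h3 := mul_le_mul_of_nonneg_left h2 hlam0
      have h4 := mul_nonneg (B.secondProb_nonneg s') (sq_nonneg (δ - lam))
      nlinarith
    have h2 := Finset.sum_le_sum fun s' (_ : s' ∈ Finset.univ) => h1 s'
    rw [Finset.sum_sub_distrib, ← Finset.mul_sum, ← Finset.mul_sum, ← Finset.mul_sum,
      B.sum_secondProb] at h2
    rw [← Finset.sum_div]
    have h3 : 2 * Γ ≤ ∑ s', |B.firstProb j u s' - B.firstProb j' u s'| := by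
      have := hmargin j j' hj u
      unfold firstProb
      linarith
    have h4 : k ^ 2 * Γ / 2 * (k ^ 2 / 2 * (2 * Γ)) ≤ k ^ 2 * Γ / 2 *
      (k ^ 2 / 2 * ∑ s', |B.firstProb j u s' - B.firstProb j' u s'|) := by gcongr
    nlinarith
  unfold stateExcess
  rw [← Finset.sum_add_distrib]
  calc ENNReal.ofReal (k ^ 4 * Γ ^ 2 / 16)
      = ∑ _u : A, (Fintype.card A : ℝ≥0∞)⁻¹ * ENNReal.ofReal (k ^ 4 * Γ ^ 2 / 16) := by
        rw [Finset.sum_const, Finset.card_univ, nsmul_eq_mul, ← mul_assoc,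
          ENNReal.mul_inv_cancel (by simp) (by simp), one_mul]
    _ ≤ _ := by
        refine Finset.sum_le_sum fun u _ => ?_
        rw [← mul_add, ← Finset.sum_add_distrib]
        gcongr
        exact (hu u).trans (Finset.sum_le_sum fun s' _ => hpt u s')

/-- If two initial states share a cluster, the smaller of their masses times the separation `w` is
at most the excess risk. So `v / w` serves as overlap `τ` in `exists_dominant_row`, applied to the
matrix of joint masses of state and cluster. -/
theorem separates_of_excess_le (B : BlockMDP S A X N H) {μmin Γ r v : ℝ} (hμ0 : 0 < μmin)
    (hμ : ∀ i, μmin ≤ (B.latent.μ i).toReal) (hΓ : 0 < Γ) (hmargin : B.InitialMargin Γ)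
    {φ : X → Fin N} (hφ : Measurable φ) {c : Fin N → A → X → ℝ} (hc : ∀ i u, Measurable (c i u))
    (hr : 0 < r) (hv0 : 0 ≤ v)
    (hv : B.excess (fun x u x' => c (φ x) u x') ≤ ENNReal.ofReal v)
    (h1 : v ≤ (μmin / Fintype.card A) ^ 4 * Γ ^ 2 / 16 * (r ^ 2 / N ^ 4))
    (h2 : v ≤ (μmin / Fintype.card A) ^ 4 * Γ ^ 2 / 16 * (μmin ^ 2 / (4 * N ^ 4))) :
    B.Separates φ r := by
  intro i
  have hA : (1 : ℝ) ≤ Fintype.card A := by exact_mod_cast Fintype.card_pos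
  have hN : (1 : ℝ) ≤ N := by exact_mod_cast i.pos
  have hμ1 : μmin ≤ 1 := (hμ i).trans (ENNReal.toReal_mono ENNReal.one_ne_top (PMF.coe_le_one _ _))
  set k := μmin / Fintype.card A with hk
  have hk0 : 0 < k := by positivity
  have hk1 : k ≤ 1 := div_le_one_of_le₀ (hμ1.trans hA) (by positivity)
  set w := k ^ 4 * Γ ^ 2 / 16 with hw
  have hw0 : 0 < w := by positivity
  -- The marginal contains state `i` with weight at least `μmin` and action `u` with weight `1 /
  -- |A|`, hence the choice of `k`.
  have hkT : ∀ i u s', k * B.firstProb i u s' ≤ B.secondProb s' := by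
    intro i u s'
    refine le_trans ?_ (B.le_secondProb i u s')
    rw [hk, div_mul_eq_mul_div, mul_div_assoc]
    have := B.firstProb_nonneg i u s'
    gcongr
    exact hμ i
  set P := B.seedLaw (A := A) with hP
  set m : Fin N → Fin N → ℝ := fun j i => (P (B.clusterEvent φ i ∩ {w | w.idx = j})).toReal with hmdef
  have hmof : ∀ j i, P (B.clusterEvent φ i ∩ {w | w.idx = j}) = ENNReal.ofReal (m j i) := fun j i =>
    (ENNReal.ofReal_toReal (measure_ne_top _ _)).symm
  have hm0 : ∀ j i, 0 ≤ m j i := fun _ _ => ENNReal.toReal_nonneg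
  have hmin : ∀ j j' i, j ≠ j' → min (m j i) (m j' i) ≤ v / w := by
    intro j j' i hjj
    have e1 := (B.le_excess hφ c i hjj).trans hv
    have e2 := B.le_stateExcess_add hk0 hk1 hkT hΓ.le hmargin (hc i) hjj
    set t := min (m j i) (m j' i) with ht
    have ht0 : 0 ≤ t := le_min (hm0 _ _) (hm0 _ _)
    rw [← hP, hmof, hmof] at e1
    have e3 : ENNReal.ofReal w * ENNReal.ofReal t ≤ ENNReal.ofReal v := by
      calc _ ≤ (B.stateExcess (c i) j + B.stateExcess (c i) j') * ENNReal.ofReal t := by gcongr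
        _ ≤ _ := by
          rw [add_mul]
          refine le_trans ?_ e1
          gcongr
          · exact min_le_left _ _
          · exact min_le_right _ _
    rw [← ENNReal.ofReal_mul hw0.le, ENNReal.ofReal_le_ofReal_iff hv0] at e3
    rw [le_div_iff₀ hw0]
    linarith
  have hsum : ∀ j, μmin ≤ ∑ i, m j i := by
    intro j
    refine (hμ j).trans ?_
    have e1 : B.latent.μ j = P {w | w.idx = j} := by
      have := B.measurePreserving_idx.measure_preimage
        (measurableSet_singleton j).nullMeasurableSet
      rw [PMF.toMeasure_apply_singleton _ _ (measurableSet_singleton j)] at this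
      exact this.symm
    have e2 : P {w | w.idx = j} ≤ ∑ i, P (B.clusterEvent φ i ∩ {w | w.idx = j}) := by
      refine (measure_mono fun w hw => ?_).trans (measure_iUnion_fintype_le _ _)
      exact Set.mem_iUnion.2 ⟨φ (B.obs₀ w), rfl, hw⟩
    rw [e1]
    refine (ENNReal.toReal_mono ?_ e2).trans_eq ?_
    · exact ENNReal.sum_ne_top.2 fun _ _ => measure_ne_top _ _
    · exact ENNReal.toReal_sum fun _ _ => measure_ne_top _ _
  have hb0 : 0 ≤ v / w := by positivity
  have hb1 : v / w ≤ r ^ 2 / N ^ 4 := by rw [div_le_iff₀ hw0]; linarith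
  have hb2 : v / w ≤ μmin ^ 2 / (4 * N ^ 4) := by rw [div_le_iff₀ hw0]; linarith
  have hN4 : (N : ℝ) ≤ N ^ 4 := le_self_pow₀ hN (by norm_num)
  have hτ : N * (v / w) < μmin := by
    calc N * (v / w) ≤ N ^ 4 * (μmin ^ 2 / (4 * N ^ 4)) := by gcongr
      _ = μmin * (μmin / 4) := by field_simp
      _ < μmin * 1 := by gcongr; linarith
      _ = μmin := mul_one _
  -- The product `r * μmin` appears as the geometric mean of the two available bounds on `v / w`,
  -- one with `r ^ 2` and one with `μmin ^ 2`.
  have hτr : (N : ℝ) ^ 2 * (v / w) ≤ r * μmin := by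
    refine le_of_sq_le_sq ?_ (by positivity)
    calc ((N : ℝ) ^ 2 * (v / w)) ^ 2 = N ^ 4 * ((v / w) * (v / w)) := by ring
      _ ≤ N ^ 4 * ((r ^ 2 / N ^ 4) * (μmin ^ 2 / (4 * N ^ 4))) := by gcongr
      _ = (r * μmin) ^ 2 / (4 * N ^ 4) := by field_simp
      _ ≤ (r * μmin) ^ 2 := div_le_self (by positivity) (by nlinarith)
  obtain ⟨j, hj0, hj⟩ := exists_dominant_row hsum hmin hb0 hτ hr.le hτr i
  have hi : P (B.clusterEvent φ i) ≠ 0 := fun h => by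
    have : m j i = 0 := by
      simp only [hmdef]
      rw [measure_mono_null Set.inter_subset_left h, ENNReal.toReal_zero]
    exact hj0.ne' this
  refine ⟨hi, j, ?_⟩
  rw [ProbabilityTheory.cond_apply (B.measurableSet_clusterEvent hφ i)]
  have e1 : P (B.clusterEvent φ i ∩ {w | w.idx ≠ j}) ≤ ENNReal.ofReal r * P (B.clusterEvent φ i) := by
    calc _ ≤ ∑ j' ∈ Finset.univ.erase j, P (B.clusterEvent φ i ∩ {w | w.idx = j'}) := by
          refine (measure_mono fun w hw => ?_).trans (measure_biUnion_finset_le _ _)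
          simp only [Set.mem_iUnion]
          exact ⟨w.idx, Finset.mem_erase.2 ⟨hw.2, Finset.mem_univ _⟩, hw.1, rfl⟩
      _ = ENNReal.ofReal (∑ j' ∈ Finset.univ.erase j, m j' i) := by
          rw [ENNReal.ofReal_sum_of_nonneg fun j' _ => hm0 j' i]
          exact Finset.sum_congr rfl fun j' _ => hmof j' i
      _ ≤ ENNReal.ofReal (r * m j i) := ENNReal.ofReal_le_ofReal hj
      _ = ENNReal.ofReal r * P (B.clusterEvent φ i ∩ {w | w.idx = j}) := by
          rw [ENNReal.ofReal_mul hr.le, hmof]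
      _ ≤ _ := by gcongr; exact Set.inter_subset_left
  calc _ ≤ (P (B.clusterEvent φ i))⁻¹ * (ENNReal.ofReal r * P (B.clusterEvent φ i)) := by gcongr
    _ = ENNReal.ofReal r := by
        rw [mul_left_comm, ENNReal.inv_mul_cancel hi (measure_ne_top _ _), mul_one]

end BlockMDP

end

noncomputable section

/-! ### Sample sizes -/

theorem one_le_log_of_three_le {x : ℝ} (hx : 3 ≤ x) : 1 ≤ Real.log x := by
  rw [Real.le_log_iff_exp_le (by linarith)]
  linarith [Real.exp_one_lt_d9]

/-- At this sample size the exponent is at least `H * |A| ^ 2 * Λ`, where `Λ + log H` would do. The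
logarithm comes from the union over steps and is absorbed by `log H ≤ H - 1` and `1 ≤ Λ`. -/
theorem mul_exp_le_of_dataSize_le {N H A F n : ℕ} {ε η δ : ℝ} (hN : 0 < N) (hH : 1 ≤ H) (hA : 0 < A)
    (hF : 0 < F) (hε : 0 < ε) (hη : η < 1 / 2) (hδ : 0 < δ)
    (hlog : 1 ≤ Real.log ((N : ℝ) ^ 2 * F / δ)) (hn : dataSize N H A F ε η δ ≤ n) :
    F * Real.exp (-(n * ((1 - 2 * η) ^ 2 / (8 * A) * (ε / H ^ 2)))) ≤ δ / (N * H) := by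
  have hN' : (1 : ℝ) ≤ N := by exact_mod_cast hN
  have hH' : (1 : ℝ) ≤ H := by exact_mod_cast hH
  have hA' : (1 : ℝ) ≤ A := by exact_mod_cast hA
  have hF' : (0 : ℝ) < F := by exact_mod_cast hF
  have hη' : 0 < 1 - 2 * η := by linarith
  set Λ := Real.log ((N : ℝ) ^ 2 * F / δ) with hΛ
  have h1 : Λ + Real.log H ≤ n * ((1 - 2 * η) ^ 2 / (8 * A) * (ε / H ^ 2)) := by
    have h2 : 8 * (H : ℝ) ^ 3 * (A : ℝ) ^ 3 * Λ / (ε * (1 - 2 * η) ^ 2) ≤ n :=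
      (Nat.le_ceil _).trans (Nat.cast_le.2 hn)
    have h3 : Real.log H ≤ H - 1 := Real.log_le_sub_one_of_pos (by linarith)
    calc Λ + Real.log H ≤ H * Λ := by nlinarith
      _ ≤ H * Λ * A ^ 2 := le_mul_of_one_le_right (by positivity) (one_le_pow₀ hA')
      _ = 8 * (H : ℝ) ^ 3 * (A : ℝ) ^ 3 * Λ / (ε * (1 - 2 * η) ^ 2) *
          ((1 - 2 * η) ^ 2 / (8 * A) * (ε / H ^ 2)) := by field_simp
      _ ≤ _ := by gcongr
  calc F * Real.exp (-(n * ((1 - 2 * η) ^ 2 / (8 * A) * (ε / H ^ 2))))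
      ≤ F * Real.exp (-(Λ + Real.log H)) := by gcongr
    _ = δ / (N ^ 2 * H) := by
        rw [Real.exp_neg, Real.exp_add, hΛ, Real.exp_log (by positivity),
          Real.exp_log (by linarith)]
        field_simp
    _ ≤ δ / (N * H) := by
        gcongr
        exact le_self_pow₀ hN' (by norm_num)

theorem exp_le_of_testSize_le {N H n : ℕ} {ε δ : ℝ} (hN : 0 < N) (hH : 1 ≤ H) (hε : 0 < ε)
    (hδ : 0 < δ) (hn : testSize N H ε δ ≤ n) :
    Real.exp (-(n * (2 * ε ^ 2 / H ^ 2))) ≤ δ / N ^ 2 := by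
  have hN' : (0 : ℝ) < N := by exact_mod_cast hN
  have hH' : (0 : ℝ) < H := by exact_mod_cast hH
  have h1 : Real.log ((N : ℝ) ^ 2 / δ) ≤ n * (2 * ε ^ 2 / H ^ 2) := by
    calc Real.log ((N : ℝ) ^ 2 / δ) =
        (H : ℝ) ^ 2 * Real.log ((N : ℝ) ^ 2 / δ) / (2 * ε ^ 2) * (2 * ε ^ 2 / H ^ 2) := by
          field_simp
      _ ≤ _ := by
          gcongr
          exact (Nat.le_ceil _).trans (Nat.cast_le.2 hn)
  calc Real.exp (-(n * (2 * ε ^ 2 / H ^ 2))) ≤ Real.exp (-Real.log ((N : ℝ) ^ 2 / δ)) :=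
        Real.exp_le_exp.2 (neg_le_neg h1)
    _ = _ := by rw [Real.exp_neg, Real.exp_log (by positivity), inv_div]

theorem ceil_le_two_mul {x : ℝ} (hx : 1 ≤ x) : (⌈x⌉₊ : ℝ) ≤ 2 * x := by
  linarith [Nat.ceil_lt_add_one (by linarith : 0 ≤ x)]

/-- In the nontrivial range `4 * ε < H` the argument of the ceiling is at least one, so rounding up
costs at most a factor `2`. -/
theorem dataSize_le {N H A F : ℕ} {ε η δ : ℝ} (hH : 1 ≤ H) (hA : 0 < A) (hε : 0 < ε)
    (hεH : 4 * ε < H) (hη0 : 0 ≤ η) (hη : η < 1 / 2)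
    (hlog : 1 ≤ Real.log ((N : ℝ) ^ 2 * F / δ)) :
    (dataSize N H A F ε η δ : ℝ) ≤
      16 * ((H : ℝ) ^ 3 * (A : ℝ) ^ 3 * Real.log ((N : ℝ) ^ 2 * F / δ) /
        (ε * (1 - 2 * η) ^ 2)) := by
  have hH' : (1 : ℝ) ≤ H := by exact_mod_cast hH
  have hA' : (1 : ℝ) ≤ A := by exact_mod_cast hA
  have hη' : 0 < 1 - 2 * η := by linarith
  refine (ceil_le_two_mul ?_).trans_eq (by ring)
  rw [le_div_iff₀ (by positivity), one_mul]
  calc ε * (1 - 2 * η) ^ 2 ≤ H * 1 := by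
        gcongr
        · linarith
        · exact pow_le_one₀ hη'.le (by linarith)
    _ ≤ H ^ 3 * 1 := by gcongr; exact le_self_pow₀ hH' (by norm_num)
    _ ≤ 8 * (H : ℝ) ^ 3 * ((A : ℝ) ^ 3 * Real.log ((N : ℝ) ^ 2 * F / δ)) := by
        gcongr
        · exact le_mul_of_one_le_left (by positivity) (by norm_num)
        · exact one_le_mul_of_one_le_of_one_le (one_le_pow₀ hA') hlog
    _ = _ := by ring

theorem testSize_le {N H : ℕ} {ε δ : ℝ} (hε : 0 < ε) (hεH : 4 * ε < H)
    (hlog : 1 ≤ Real.log ((N : ℝ) ^ 2 / δ)) :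
    (testSize N H ε δ : ℝ) ≤ (H : ℝ) ^ 2 * Real.log ((N : ℝ) ^ 2 / δ) / ε ^ 2 := by
  refine (ceil_le_two_mul ?_).trans_eq (by field_simp)
  rw [le_div_iff₀ (by positivity), one_mul]
  calc 2 * ε ^ 2 ≤ (4 * ε) ^ 2 * 1 := by nlinarith
    _ ≤ _ := by gcongr

/-! ### Counting the mistakes of the whole run -/

section Mistakes

variable {S A X ι κ l : Type*} {N H : ℕ} [Fintype S] [MeasurableSpace S]
  [MeasurableSingletonClass S] [Fintype A] [Nonempty A] [MeasurableSpace A]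
  [MeasurableSingletonClass A] [MeasurableSpace X] [Nonempty X] [Fintype ι] [Fintype κ]
  [Fintype l] {B : BlockMDP S A X N H} {G : κ → Fin N → A → X → ℝ} {Φ : l → X → Fin N}
  {erm : (n : ℕ) → (Fin n → X × A × X × Bool) → κ × l}

theorem BlockMDP.clusterValue_mem (B : BlockMDP S A X N H) (φ : X → Fin N) (i : Fin N)
    (π : Policy X A) : B.clusterValue φ i π ∈ Set.Icc (0 : ℝ) H := by
  unfold clusterValue
  refine ⟨integral_nonneg fun w => (B.ret_mem π w).1, ?_⟩
  have h := norm_integral_le_of_norm_le_const (μ := B.seedLaw[|{w | φ (B.obs₀ w) = i}])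
    (f := B.ret π) (C := H) (Filter.Eventually.of_forall fun w => by
      rw [Real.norm_eq_abs, abs_of_nonneg (B.ret_mem π w).1]
      exact (B.ret_mem π w).2)
  exact (le_abs_self _).trans
    (h.trans (mul_le_of_le_one_right (Nat.cast_nonneg H) measureReal_le_one))

theorem clusterThreshold_le {N H A : ℕ} {ε Γ μmin C : ℝ} (hε : 0 < ε) (hΓ : 0 < Γ)
    (hμ : 0 < μmin) (hC : 0 ≤ C) :
    clusterThreshold N H A ε Γ μmin C ≤ 1024 * ((N : ℝ) ^ 4 * (A : ℝ) ^ 4 * C /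
      (Γ ^ 2 * μmin ^ 4) * max ((H : ℝ) ^ 2 / ε ^ 2) (1 / μmin ^ 2)) := by
  set a := (N : ℝ) ^ 4 * (A : ℝ) ^ 4 * C / (Γ ^ 2 * μmin ^ 4) with ha
  have ha0 : 0 ≤ a := by positivity
  refine max_le ?_ ?_
  · calc _ = 256 * (a * ((H : ℝ) ^ 2 / ε ^ 2)) := by rw [ha]; field_simp
      _ ≤ _ := by gcongr <;> norm_num
  · calc _ = 1024 * (a * (1 / μmin ^ 2)) := by rw [ha]; field_simp
      _ ≤ _ := by gcongr; exact le_max_right _ _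

/-- Guarantees a nonempty clustering sample and lets the ceiling of the threshold be bounded by
twice the threshold. -/
theorem one_le_clusterThreshold {N H A : ℕ} {ε Γ μmin C : ℝ} (hN : 0 < N) (hA : 0 < A)
    (hΓ : 0 < Γ) (hΓ1 : Γ ≤ 1) (hμ : 0 < μmin) (hμ1 : μmin ≤ 1) (hC : 1 ≤ C) :
    1 ≤ clusterThreshold N H A ε Γ μmin C := by
  have hN' : (1 : ℝ) ≤ N := by exact_mod_cast hN
  have hA' : (1 : ℝ) ≤ A := by exact_mod_cast hA
  refine le_trans ?_ (le_max_right _ _)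
  rw [le_div_iff₀ (by positivity)]
  calc 1 * (Γ ^ 2 * μmin ^ 6) ≤ 1 * (1 * 1) := by
        gcongr
        · exact pow_le_one₀ hΓ.le hΓ1
        · exact pow_le_one₀ hμ.le hμ1
    _ ≤ 1024 * 1 * 1 * 1 := by norm_num
    _ ≤ _ := by
        gcongr
        · exact one_le_pow₀ hN'
        · exact one_le_pow₀ hA'

/-- The learned clustering function separates the initial states. -/
theorem measure_not_separates_le {μmin Γ : ℝ} (hμ0 : 0 < μmin)
    (hμ : ∀ i, μmin ≤ (B.latent.μ i).toReal) (hΓ : 0 < Γ) (hmargin : B.InitialMargin Γ)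
    (hG : ∀ g i a, Measurable (G g i a)) (hG01 : ∀ g i a x, G g i a x ∈ Set.Icc (0 : ℝ) 1)
    (hΦ : ∀ p, Measurable (Φ p)) (hreal : B.RealizableClassifier G Φ) (herm : IsERM G Φ erm)
    {ε δ : ℝ} (hε : 0 < ε) (hδ : 0 < δ) (hH : 1 ≤ H) {n : ℕ} (hn : 0 < n)
    (hlog : 0 ≤ Real.log (Fintype.card κ * Fintype.card l / δ))
    (hthr : clusterThreshold N H (Fintype.card A) ε Γ μmin
      (Real.log (Fintype.card κ * Fintype.card l / δ)) ≤ n) :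
    B.runLaw {ω | ¬ B.Separates (Φ (erm n (clusterData B n ω)).2) (ε / H)} ≤
      ENNReal.ofReal δ := by
  have hH' : (0 : ℝ) < H := by exact_mod_cast hH
  have hn' : (0 : ℝ) < n := by exact_mod_cast hn
  have hA : (0 : ℝ) < Fintype.card A := by exact_mod_cast Fintype.card_pos
  have hN : (0 : ℝ) < N := by
    have : N ≠ 0 := by
      rintro rfl
      obtain ⟨i, -⟩ := B.latent.μ.support_nonempty
      exact i.elim0
    exact_mod_cast Nat.pos_of_ne_zero this
  refine le_trans (measure_mono fun ω hω => ?_)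
    (measure_excess_erm_le (fun i => hμ0.trans_le (hμ i)) hG hG01 hΦ hreal herm hn hδ)
  by_contra hle
  refine hω (B.separates_of_excess_le hμ0 hμ hΓ hmargin (hΦ _) (fun i u => hG _ i u)
    (by positivity) (by positivity) (not_lt.1 hle) ?_ ?_)
  -- Here `256 = 16 * 16`, one factor from the excess risk bound and one from the separation; in the
  -- second case a further `4` makes `1024`. The goal is a positive multiple of the slack in `h1`.
  · have h1 := (le_max_left _ _).trans hthr
    rw [div_le_iff₀ (by positivity)] at h1 ⊢
    rw [← sub_nonneg] at h1 ⊢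
    refine (mul_nonneg (by positivity : 0 ≤ μmin ^ 4 * Γ ^ 2 * ε ^ 2 /
      (16 * (Fintype.card A : ℝ) ^ 4 * (N : ℝ) ^ 4 * (H : ℝ) ^ 2 * (ε ^ 2 * Γ ^ 2 * μmin ^ 4)))
      h1).trans_eq ?_
    field_simp
    ring
  · have h1 := (le_max_right _ _).trans hthr
    rw [div_le_iff₀ (by positivity)] at h1 ⊢
    rw [← sub_nonneg] at h1 ⊢
    refine (mul_nonneg (by positivity : 0 ≤ 1 /
      (64 * (Fintype.card A : ℝ) ^ 4 * (N : ℝ) ^ 4)) h1).trans_eq ?_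
    field_simp
    ring

/-- The number of mistakes of the whole run. -/
theorem measure_mistakes_le {L : Learner S A X ι N} {M : MDP S A N H} {η : ℝ}
    (hL : L.IsMeasurable) (h0 : 0 ≤ η) (h1 : η < 1 / 2) (hM : M.IsDeterministic)
    (hp : MDP.IsPerturbation η M B.latent) (hLH : L.H = H) (hstart : L.start = M.start)
    (hnext : L.next = M.nextState) (hH : 1 ≤ H) (hF0 : ∀ j x x' a, 0 ≤ L.F j x x' a)
    (hF1 : ∀ j x x', ∑ a, L.F j x x' a = 1)
    (hsel : ∀ (v : A → ℝ) (a : A), v a ≤ v (L.selA v))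
    (hselN : ∀ (v : Fin N → ℝ) (i : Fin N), v i ≤ v (L.selN v)) (hmle : IsMLE L.F L.mle)
    (hrealF : B.RealizableInverse L.F) {μmin Γ : ℝ} (hμ0 : 0 < μmin)
    (hμ : ∀ i, μmin ≤ (B.latent.μ i).toReal) (hΓ : 0 < Γ) (hmargin : B.InitialMargin Γ)
    (hG : ∀ g i a, Measurable (G g i a)) (hG01 : ∀ g i a x, G g i a x ∈ Set.Icc (0 : ℝ) 1)
    (hΦ : ∀ p, Measurable (Φ p)) (hreal : B.RealizableClassifier G Φ) (herm : IsERM G Φ erm)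
    {ε δ : ℝ} (hε : 0 < ε) (hδ : 0 < δ) {n : ℕ} (hn : 0 < n)
    (hlog : 0 ≤ Real.log (Fintype.card κ * Fintype.card l / δ))
    (hthr : clusterThreshold N H (Fintype.card A) ε Γ μmin
      (Real.log (Fintype.card κ * Fintype.card l / δ)) ≤ n)
    (hnt : 0 < L.nt) (hN : 0 < N)
    (hfit : Fintype.card ι * Real.exp
      (-(L.nD * ((1 - 2 * η) ^ 2 / (8 * Fintype.card A) * (ε / H ^ 2)))) ≤ δ / (N * H))
    (htest : Real.exp (-(L.nt * (2 * ε ^ 2 / H ^ 2))) ≤ δ / N ^ 2) :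
    B.runLaw {ω | ¬ ((mistakes B L Φ erm n (B.lift L.ρ) (4 * ε) ω).Finite ∧
      (mistakes B L Φ erm n (B.lift L.ρ) (4 * ε) ω).ncard ≤
        2 * n + N * (N * (L.nl + L.nt)))} ≤ ENNReal.ofReal (3 * δ) := by
  have key := measure_clustering_le (B := B) herm.2 n (fun p => B.Separates (Φ p) (ε / H))
    (fun p => {ω | ∃ e i, N * (L.nl + L.nt) ≤ (L.memory B (Φ p) ω e i).length ∧
      B.clusterValue (Φ p) i (L.policy (L.memory B (Φ p) ω e i)) <
        B.clusterValue (Φ p) i (B.lift L.ρ) - 4 * ε})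
    (measure_not_separates_le hμ0 hμ hΓ hmargin hG hG01 hΦ hreal herm hε hδ hH hn hlog hthr)
    (fun p hsep => Learner.measure_exists_bad_policy_le hL h0 h1 hM hp hLH
      (by rw [hstart, hp.1]) hnext hH hF0 hF1 hsel hselN hmle hrealF (hΦ p) hε hδ hsep hnt hN
      hfit htest)
  rw [← ENNReal.ofReal_add hδ.le (by positivity), show δ + 2 * δ = 3 * δ by ring] at key
  refine (measure_mono fun ω hω => ?_).trans key
  by_contra hgood
  simp only [Set.mem_ofPred_eq, not_exists, not_and, not_lt] at hgood
  exact hω (mistakes_finite L B Φ erm n _ _ ω _ hgood)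

/-- If the required accuracy is trivial, only the episodes for the clustering function count. -/
theorem mistakes_eq_of_le {L : Learner S A X ι N} {gap : ℝ} (hgap : H ≤ gap) (n : ℕ)
    (bench : Policy X A) (ω : ℕ → Seed S A X N) :
    mistakes B L Φ erm n bench gap ω = Set.Iio (2 * n) := by
  ext e
  refine ⟨?_, fun h => Or.inl h⟩
  rintro (h | ⟨k, rfl, h⟩)
  · exact h
  · have h1 := (B.clusterValue_mem (clustering B Φ erm n ω)
      (clustering B Φ erm n ω (B.obs₀ (ω (2 * n + k)))) bench).2
    have h2 := (B.clusterValue_mem (clustering B Φ erm n ω)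
      (clustering B Φ erm n ω (B.obs₀ (ω (2 * n + k))))
      (L.executed B (clustering B Φ erm n ω) (fun k => ω (2 * n + k)) k)).1
    exact absurd h (not_lt.2 (by linarith))

end Mistakes

end

end TASID

/-! ### Assembly and constants -/

open TASID in
theorem mainTheorem4 :
    ∃ c₀ C : ℝ, 0 < c₀ ∧ 0 < C ∧
    ∀ {S A X ι κ l : Type*}
      [Fintype S] [MeasurableSpace S] [MeasurableSingletonClass S]
      [Fintype A] [Nonempty A] [MeasurableSpace A] [MeasurableSingletonClass A]
      [MeasurableSpace X] [Nonempty X] [Fintype ι] [Fintype κ] [Fintype l]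
      (N H : ℕ) (_ : 1 ≤ H)
      -- simulator, target environment, perturbation level
      (M : MDP S A N H) (_ : M.IsDeterministic) (B : BlockMDP S A X N H)
      (η : ℝ) (_ : 0 ≤ η) (_ : η < 1 / 2) (_ : MDP.IsPerturbation η M B.latent)
      -- conditions on the initial states
      (μmin Γ : ℝ) (_ : 0 < μmin) (_ : ∀ i, μmin ≤ (B.latent.μ i).toReal)
      (_ : 0 < Γ) (_ : Γ ≤ 1) (_ : B.InitialMargin Γ)
      -- the finite class of inverse dynamics models
      (F : ι → X → X → A → ℝ) (_ : ∀ j a, Measurable fun p : X × X => F j p.1 p.2 a)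
      (_ : ∀ j x x' a, 0 ≤ F j x x' a) (_ : ∀ j x x', ∑ a, F j x x' a = 1)
      (_ : B.RealizableInverse F)
      -- the finite classes for the clustering function
      (G : κ → Fin N → A → X → ℝ) (_ : ∀ g i a, Measurable (G g i a))
      (_ : ∀ g i a x, G g i a x ∈ Set.Icc (0 : ℝ) 1)
      (Φ : l → X → Fin N) (_ : ∀ p, Measurable (Φ p)) (_ : B.RealizableClassifier G Φ)
      -- optimization oracles and tie-breaking rules
      (mle : (n : ℕ) → (Fin n → X × A × X) → ι) (_ : IsMLE F mle)
      (erm : (n : ℕ) → (Fin n → X × A × X × Bool) → κ × l) (_ : IsERM G Φ erm)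
      (selA : (A → ℝ) → A) (_ : IsArgmaxRule selA)
      (selN : (Fin N → ℝ) → Fin N) (_ : IsArgmaxRule selN)
      -- output of robust dynamic programming, accuracy, failure probability, sample size
      (ρ : ℕ → S → A) (_ : M.IsRDPOutput η ρ)
      (ε δ : ℝ) (_ : 0 < ε) (_ : 0 < δ) (_ : δ < 1) (n₀ : ℕ),
      let nA := Fintype.card A
      let nF := Fintype.card ι
      let cplx : ℝ := c₀ * Real.log (Fintype.card κ * Fintype.card l / δ)
      let thr : ℝ := clusterThreshold N H nA ε Γ μmin cplx
      let L : Learner S A X ι N :=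
        { H := H, start := M.start, next := M.nextState, ρ := ρ, F := F, mle := mle,
          selA := selA, selN := selN, nD := dataSize N H nA nF ε η δ, nt := testSize N H ε δ }
      let bad := mistakes B L Φ erm n₀ (B.lift ρ) (4 * ε)
      let b₁ : ℝ := (N : ℝ) ^ 2 * (H : ℝ) ^ 4 * (nA : ℝ) ^ 3 * Real.log ((N : ℝ) ^ 2 * nF / δ) /
          (ε * (1 - 2 * η) ^ 2) +
        (N : ℝ) ^ 2 * (H : ℝ) ^ 2 * Real.log ((N : ℝ) ^ 2 / δ) / ε ^ 2
      let b₂ : ℝ := (N : ℝ) ^ 4 * (nA : ℝ) ^ 4 *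
          Real.log (Fintype.card κ * Fintype.card l / δ) / (Γ ^ 2 * μmin ^ 4) *
        max ((H : ℝ) ^ 2 / ε ^ 2) (1 / μmin ^ 2)
      thr ≤ n₀ →
        M.IsRobustPolicy η ρ ∧
        B.runLaw {ω | ¬ ((bad ω).Finite ∧ ((bad ω).ncard : ℝ) ≤ 2 * n₀ + C * b₁)} ≤
          ENNReal.ofReal (3 * δ) ∧
        (n₀ = ⌈thr⌉₊ →
          B.runLaw {ω | ¬ ((bad ω).Finite ∧ ((bad ω).ncard : ℝ) ≤ C * (b₁ + b₂))} ≤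
            ENNReal.ofReal (3 * δ)) := by
  -- `4096 = 2 * 2 * 1024`: two episodes per clustering sample, a factor `2` for rounding up, and
  -- `1024` from the threshold. The testing phase needs only `16`.
  refine ⟨1, 4096, one_pos, by norm_num, ?_⟩
  intro S A X ι κ l _ _ _ _ _ _ _ _ _ _ _ _ N H hH M hM B η h0 h1 hp μmin Γ hμ0 hμ hΓ hΓ1 hmargin
    F hF hF0 hF1 hrealF G hG hG01 Φ hΦ hreal mle hmle erm herm selA hselA selN hselN ρ hρ ε δ
    hε hδ hδ1 n₀ nA nF cplx thr L bad b₁ b₂ hthr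
  refine ⟨hρ.isRobustPolicy h0 (by linarith), ?_⟩
  have hprob : IsProbabilityMeasure B.runLaw := by unfold BlockMDP.runLaw; infer_instance
  -- For `δ ≥ 1 / 3` the probability bound is void. Otherwise every logarithm involved is at least
  -- `log 3 ≥ 1`, as the rounding estimates require.
  rcases le_or_gt (1 / 3) δ with hδ3 | hδ3
  · have htriv : (1 : ENNReal) ≤ ENNReal.ofReal (3 * δ) := by
      rw [← ENNReal.ofReal_one]
      exact ENNReal.ofReal_le_ofReal (by linarith)
    exact ⟨prob_le_one.trans htriv, fun _ => prob_le_one.trans htriv⟩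
  have hN : 0 < N := by
    refine Nat.pos_of_ne_zero ?_
    rintro rfl
    obtain ⟨i, -⟩ := B.latent.μ.support_nonempty
    exact i.elim0
  have hA : 0 < nA := Fintype.card_pos
  -- Applying the oracles to the empty data set shows that the classes are nonempty.
  have hι : 0 < nF := Fintype.card_pos_iff.2 ⟨mle 0 Fin.elim0⟩
  have hκ : 0 < Fintype.card κ := Fintype.card_pos_iff.2 ⟨(erm 0 Fin.elim0).1⟩
  have hl : 0 < Fintype.card l := Fintype.card_pos_iff.2 ⟨(erm 0 Fin.elim0).2⟩
  have hN1 : (1 : ℝ) ≤ N := by exact_mod_cast hN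
  have hF1' : (1 : ℝ) ≤ nF := by exact_mod_cast hι
  have hκ1 : (1 : ℝ) ≤ Fintype.card κ := by exact_mod_cast hκ
  have hl1 : (1 : ℝ) ≤ Fintype.card l := by exact_mod_cast hl
  have hlog : ∀ {x : ℝ}, 1 ≤ x → 1 ≤ Real.log (x / δ) := fun {x} hx =>
    one_le_log_of_three_le ((le_div_iff₀ hδ).2 (by linarith))
  have hlogF : 1 ≤ Real.log ((N : ℝ) ^ 2 * nF / δ) :=
    hlog (one_le_mul_of_one_le_of_one_le (one_le_pow₀ hN1) hF1')
  have hlogN : 1 ≤ Real.log ((N : ℝ) ^ 2 / δ) := hlog (one_le_pow₀ hN1)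
  have hlogG : 1 ≤ cplx := by
    simp only [cplx, one_mul]
    exact hlog (one_le_mul_of_one_le_of_one_le hκ1 hl1)
  have hμ1 : μmin ≤ 1 :=
    (hμ ⟨0, hN⟩).trans (ENNReal.toReal_mono ENNReal.one_ne_top (PMF.coe_le_one _ _))
  have hthr1 : 1 ≤ thr := one_le_clusterThreshold hN hA hΓ hΓ1 hμ0 hμ1 hlogG
  have hη' : 0 < 1 - 2 * η := by linarith
  have hb₁ : 0 ≤ b₁ := by positivity
  have hmain : B.runLaw {ω | ¬ ((bad ω).Finite ∧ ((bad ω).ncard : ℝ) ≤ 2 * n₀ + 4096 * b₁)} ≤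
      ENNReal.ofReal (3 * δ) := by
    -- Values lie in `[0, H]`, so with a gap of at least `H` only the data-gathering episodes count.
    -- This case is separate because `dataSize` could be rounded up from a number far below one.
    rcases le_or_gt (H : ℝ) (4 * ε) with hεH | hεH
    · have hempty : {ω | ¬ ((bad ω).Finite ∧ ((bad ω).ncard : ℝ) ≤ 2 * n₀ + 4096 * b₁)} = ∅ := by
        refine Set.eq_empty_of_forall_notMem fun ω hω => hω ?_
        have hbad : bad ω = Set.Iio (2 * n₀) := mistakes_eq_of_le hεH n₀ _ ω
        rw [hbad]
        refine ⟨Set.finite_Iio _, ?_⟩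
        rw [Set.ncard_eq_toFinset_card', Set.toFinset_Iio, Nat.card_Iio]
        push_cast
        linarith
      rw [hempty, measure_empty]
      exact zero_le
    · have hnt : 0 < L.nt := Nat.ceil_pos.2 (by positivity)
      have hLm : L.IsMeasurable := ⟨hF, hmle.2, hselA.2, hselN.2⟩
      refine (measure_mono fun ω hω => ?_).trans (measure_mistakes_le (L := L) (n := n₀) hLm h0 h1
        hM hp rfl rfl rfl hH hF0 hF1 hselA.1 hselN.1 hmle hrealF hμ0 hμ hΓ hmargin hG hG01 hΦ
        hreal herm hε hδ (by exact_mod_cast zero_lt_one.trans_le (hthr1.trans hthr))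
        (by simpa [cplx] using zero_le_one.trans hlogG) (by simpa [thr, cplx] using hthr) hnt hN
        (mul_exp_le_of_dataSize_le hN hH hA hι hε h1 hδ hlogF le_rfl)
        (exp_le_of_testSize_le hN hH hε hδ le_rfl))
      intro hgood
      refine hω ⟨hgood.1, ?_⟩
      have hc : ((bad ω).ncard : ℝ) ≤ 2 * n₀ + N * (N * (H * L.nD + L.nt)) := by
        exact_mod_cast hgood.2
      have hD : (L.nD : ℝ) ≤ _ := dataSize_le hH hA hε hεH h0 h1 hlogF
      have hT : (L.nt : ℝ) ≤ _ := testSize_le hε hεH hlogN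
      calc ((bad ω).ncard : ℝ) ≤ 2 * n₀ + N * (N * (H * L.nD + L.nt)) := hc
        _ ≤ 2 * n₀ + N * (N * (H * (16 * ((H : ℝ) ^ 3 * (nA : ℝ) ^ 3 *
            Real.log ((N : ℝ) ^ 2 * nF / δ) / (ε * (1 - 2 * η) ^ 2))) +
            (H : ℝ) ^ 2 * Real.log ((N : ℝ) ^ 2 / δ) / ε ^ 2)) := by gcongr
        _ = 2 * n₀ + (16 * ((N : ℝ) ^ 2 * (H : ℝ) ^ 4 * (nA : ℝ) ^ 3 *
            Real.log ((N : ℝ) ^ 2 * nF / δ) / (ε * (1 - 2 * η) ^ 2)) +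
            (N : ℝ) ^ 2 * (H : ℝ) ^ 2 * Real.log ((N : ℝ) ^ 2 / δ) / ε ^ 2) := by ring
        _ ≤ 2 * n₀ + 4096 * b₁ := by
          have e1 : 0 ≤ (N : ℝ) ^ 2 * (H : ℝ) ^ 4 * (nA : ℝ) ^ 3 *
            Real.log ((N : ℝ) ^ 2 * nF / δ) / (ε * (1 - 2 * η) ^ 2) := by positivity
          have e2 : 0 ≤ (N : ℝ) ^ 2 * (H : ℝ) ^ 2 * Real.log ((N : ℝ) ^ 2 / δ) / ε ^ 2 := by
            positivity
          simp only [b₁]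
          linarith
  refine ⟨hmain, fun hn => le_trans (measure_mono fun ω hω => ?_) hmain⟩
  intro hgood
  refine hω ⟨hgood.1, hgood.2.trans ?_⟩
  have h2 : thr ≤ 1024 * b₂ := by
    have h3 : thr ≤ _ := clusterThreshold_le hε hΓ hμ0 (zero_le_one.trans hlogG)
    simpa only [b₂, cplx, one_mul] using h3
  have h4 : (n₀ : ℝ) ≤ 2 * thr := by
    rw [hn]
    exact ceil_le_two_mul hthr1
  linarith
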